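/- Let $\Sigma$ be a smooth surface (possibly with boundary, compact or not) and let $(M,\mathcal P)$ be a smooth Poisson manifold with bivector $\mathcal P=\frac12\mathcal P^{ij}\partial_i\wedge\partial_j$, $\mathcal P(dX^i,dX^j)=\mathcal P^{ij}$. The fields of the Poisson sigma model are a smooth map $X\colon\Sigma\to M$ and a smooth 1-form $A$ on $\Sigma$ with values in $X^*T^*M$, with components $A_i$ in local coordinates $X^i$ of $M$. The field equations are $$dX^i+\mathcal P^{ij}(X)A_j=0,\qquad dA_i+\tfrac12\,\mathcal P^{kl}{}_{,i}(X)\,A_k\wedge A_l=0 \qquad (1)$$ in all local coordinates of $M$. A gauge transformation between two solutions is a smooth path of solutions $(X_t,A_t)$, $0\le t\le 1$, joining them, whose velocity is at each time $$\delta_\epsilon X^i=\epsilon_j\mathcal P^{ji}(X),\qquad \delta_\epsilon A_i=d\epsilon_i+\mathcal P^{kl}{}_{,i}(X)A_k\epsilon_l$$ for a section $\epsilon=\epsilon_t$ of $X_t^*T^*M$ depending smoothly on $t$. Gauge equivalence is the equivalence relation generated by gauge transformations. Let $L\subset M$ be a symplectic leaf with an open neighborhood $U$ that carries * a presymplectic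 form $\widetilde\Omega$ compatible with $\mathcal P$, that is, a smooth closed 2-form on $U$ which, at each point of $U$, restricts on the tangent space of the symplectic leaf through that point to the symplectic form of the leaf, with the sign for which it is inverse to $\mathcal P$: $\mathcal P^{ij}\widetilde\Omega_{jl}v^l=v^i$ for all $v$ tangent to the leaf; * smooth Casimir functions $C^1,\dots,C^k$ with $L=\{q\in U: C^1(q)=\dots=C^k(q)=0\}$, where $k$ is the corank of $\mathcal P$ along $L$ (the codimension of $L$), and with $dC^1,\dots,dC^k$ linearly independent at every point of $L$ (in particular $L$ is then a regular leaf of trivial holonomy). Fix $L,U,\widetilde\Omega,C^I$ and a smooth map $X\colon\Sigma\to M$ with image in $L$. 1. Every $A$ such that $(X,A)$ solves (1) can be written as $$A_i=-X^*(\partial_i\lrcorner\widetilde\Omega)+\alpha_I\,X^*(\partial_iC^I)\qquad(2)$$ (sum over $I=1,\dots,k$, with $\partial_i\lrcorner\widetilde\Omega=\widetilde\Omega_{ij}dX^j$) with uniquely determined smooth closed 1-forms $\alpha_1,\dots,\alpha_k$ on $\Sigma$. Conversely, for all smooth closed 1-forms $\alpha_1,\dots,\alpha_k$ on $\Sigma$,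 (2) defines a solution. 2. If each $\alpha_I$ is changed by adding an exact 1-form on $\Sigma$, the corresponding solutions (2) are related by a gauge transformation. 3. The map that sends the solution (2) to $([\alpha_1],\dots,[\alpha_k])$ induces a bijection from the set of gauge equivalence classes of solutions with the given map $X$ onto $H^1(\Sigma;\mathbb R)^k$. -/

import Mathlib

open scoped Manifold ContDiff

noncomputable section

namespace PSM

section Forms

/-- Differential `k`-forms (no smoothness imposed) on a manifold `N`, possibly with boundary. -/
abbrev DForm {E H : Type*} [NormedAddCommGroup E] [NormedSpace ℝ E] [TopologicalSpace H]
    (I : ModelWithCorners ℝ E H) (N : Type*) [TopologicalSpace N] [ChartedSpace H N] (k : ℕ) :=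
  ∀ x : N, TangentSpace I x [⋀^Fin k]→L[ℝ] ℝ

variable {E H : Type*} [NormedAddCommGroup E] [NormedSpace ℝ E] [TopologicalSpace H]
  {I : ModelWithCorners ℝ E H} {N : Type*} [TopologicalSpace N] [ChartedSpace H N] {k : ℕ}

/-- The form `η` written in the preferred chart at `p`. -/
def DForm.inChart (η : DForm I N k) (p : N) : E → E [⋀^Fin k]→L[ℝ] ℝ := fun y =>
  (η ((extChartAt I p).symm y)).compContinuousLinearMap
    (mfderivWithin 𝓘(ℝ, E) I (extChartAt I p).symm (Set.range I) y)

/-- Smoothness of a form at a point. -/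
def DForm.SmoothAt (η : DForm I N k) (p : N) : Prop :=
  ContDiffWithinAt ℝ ∞ (η.inChart p) (Set.range I) (extChartAt I p p)

/-- The exterior derivative at `p`. It is computed in the preferred chart at `p`, whose derivative
at `p` is the identification of the tangent space `TangentSpace I p` with `E`. -/
def DForm.d (η : DForm I N k) (p : N) : TangentSpace I p [⋀^Fin (k + 1)]→L[ℝ] ℝ :=
  (extDerivWithin (η.inChart p) (Set.range I) (extChartAt I p p) : E [⋀^Fin (k + 1)]→L[ℝ] ℝ)

/-- A field of linear functionals, seen as a 1-form. -/
def oneForm (β : ∀ x : N, TangentSpace I x →L[ℝ] ℝ) : DForm I N 1 := fun x =>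
  ContinuousAlternatingMap.ofSubsingleton ℝ (TangentSpace I x) ℝ 0 (β x)

theorem oneForm_apply (β : ∀ x : N, TangentSpace I x →L[ℝ] ℝ) (x : N)
    (v : Fin 1 → TangentSpace I x) : oneForm β x v = β x (v 0) := rfl

/-- The differential of a function at a point, as a covector. -/
def dAt (I : ModelWithCorners ℝ E H) (h : N → ℝ) (x : N) : TangentSpace I x →L[ℝ] ℝ :=
  mfderiv I 𝓘(ℝ, ℝ) h x

theorem DForm.inChart_add (η θ : DForm I N k) (p : N) :
    DForm.inChart (η + θ) p = DForm.inChart η p + DForm.inChart θ p := by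
  ext y v; rfl

theorem DForm.inChart_smul (c : ℝ) (η : DForm I N k) (p : N) :
    DForm.inChart (c • η) p = c • DForm.inChart η p := by
  ext y v; rfl

theorem DForm.inChart_zero (p : N) : DForm.inChart (0 : DForm I N k) p = 0 := by
  ext y v; rfl

variable (I N) in
/-- The real vector space of smooth closed 1-forms. -/
def closedForms : Submodule ℝ (DForm I N 1) where
  carrier := {α | ∀ p, DForm.SmoothAt α p ∧ DForm.d α p = 0}
  zero_mem' := by
    intro p
    refine ⟨?_, ?_⟩
    · unfold DForm.SmoothAt
      rw [DForm.inChart_zero]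
      exact contDiffWithinAt_const
    · have h : extDerivWithin (0 : E → E [⋀^Fin 1]→L[ℝ] ℝ) (Set.range I) (extChartAt I p p) = 0 := by
        have h0 : fderivWithin ℝ (0 : E → E [⋀^Fin 1]→L[ℝ] ℝ) (Set.range I) (extChartAt I p p)
            = 0 :=
          by
            have := fderivWithin_const_apply (𝕜 := ℝ) (0 : E [⋀^Fin 1]→L[ℝ] ℝ)
              (s := Set.range I) (x := extChartAt I p p)
            exact this
        simp only [extDerivWithin, h0]
        ext v
        simp [ContinuousAlternatingMap.alternatizeUncurryFin_apply]
      unfold DForm.d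
      rw [DForm.inChart_zero]
      exact h
  add_mem' := by
    intro α β hα hβ p
    refine ⟨?_, ?_⟩
    · unfold DForm.SmoothAt
      rw [DForm.inChart_add]
      exact (hα p).1.add (hβ p).1
    · have h := extDerivWithin_add
        (I.uniqueDiffOn (extChartAt I p p) (Set.mem_range_self _))
        ((hα p).1.differentiableWithinAt (by simp)) ((hβ p).1.differentiableWithinAt (by simp))
      have h1 := (hα p).2
      have h2 := (hβ p).2
      unfold DForm.d at h1 h2 ⊢
      rw [DForm.inChart_add]
      refine h.trans ?_
      rw [h1, h2]
      exact add_zero _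
  smul_mem' := by
    intro c α hα p
    refine ⟨?_, ?_⟩
    · unfold DForm.SmoothAt
      rw [DForm.inChart_smul]
      exact (hα p).1.const_smul c
    · have h := extDerivWithin_smul (𝕜 := ℝ) c (DForm.inChart α p)
        (I.uniqueDiffOn (extChartAt I p p) (Set.mem_range_self _))
      have h1 := (hα p).2
      unfold DForm.d at h1 ⊢
      rw [DForm.inChart_smul]
      refine h.trans ?_
      rw [h1]
      ext v
      exact mul_zero c

variable (I N) in
/-- The real vector space of exact 1-forms `dh`, with `h` a smooth function. -/
def exactForms : Submodule ℝ (DForm I N 1) where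
  carrier := {α | ∃ h : N → ℝ, ContMDiff I 𝓘(ℝ, ℝ) ∞ h ∧ α = oneForm (dAt I h)}
  zero_mem' := by
    refine ⟨fun _ => 0, contMDiff_const, ?_⟩
    ext x v
    have hx : dAt I (fun _ : N => (0 : ℝ)) x = 0 := mfderiv_const
    rw [oneForm_apply, hx]
    rfl
  add_mem' := by
    rintro _ _ ⟨f, hf, rfl⟩ ⟨g, hg, rfl⟩
    refine ⟨f + g, hf.add hg, ?_⟩
    ext x v
    have h := mfderiv_add ((hf x).mdifferentiableAt (by simp)) ((hg x).mdifferentiableAt (by simp))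
    have hx : dAt I (f + g) x = dAt I f x + dAt I g x := h
    rw [oneForm_apply, hx]
    rfl
  smul_mem' := by
    rintro c _ ⟨f, hf, rfl⟩
    refine ⟨c • f, (contDiff_const.mul contDiff_id : ContDiff ℝ ∞ fun r : ℝ => c * r).contMDiff.comp hf, ?_⟩
    ext x v
    have h := const_smul_mfderiv ((hf x).mdifferentiableAt (by simp)) c
    have hx : dAt I (c • f) x = c • dAt I f x := h
    rw [oneForm_apply, hx]
    rfl

variable (I N) in
/-- The first de Rham cohomology: the space of classes modulo exact 1-forms of the smooth closed
1-forms. -/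
abbrev H1 : Submodule ℝ (DForm I N 1 ⧸ exactForms I N) :=
  (closedForms I N).map (exactForms I N).mkQ

/-- The cohomology class of a closed 1-form. -/
def cohomClass (α : closedForms I N) : H1 I N :=
  ⟨(exactForms I N).mkQ α.1, Submodule.mem_map_of_mem α.2⟩

end Forms

section Target

variable {n : ℕ} {M : Type*} [TopologicalSpace M] [ChartedSpace (EuclideanSpace ℝ (Fin n)) M]

/-- The coordinate vector field `∂_i` of the chart `e`, at `q`. -/
def coordVec (e : OpenPartialHomeomorph M (EuclideanSpace ℝ (Fin n))) (i : Fin n) (q : M) :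
    TangentSpace (𝓡 n) q :=
  (mfderiv (𝓡 n) (𝓡 n) e.symm (e q) (EuclideanSpace.single i (1 : ℝ)) : EuclideanSpace ℝ (Fin n))

/-- The differential `dX^i` of the `i`-th coordinate function of the chart `e`, at `q`. -/
def coordCovec (e : OpenPartialHomeomorph M (EuclideanSpace ℝ (Fin n))) (i : Fin n) (q : M) :
    TangentSpace (𝓡 n) q →L[ℝ] ℝ :=
  dAt (𝓡 n) (fun q' : M => (e q') i) q

/-- Fields of bilinear forms on the cotangent spaces. -/
abbrev CotBilin (n : ℕ) (M : Type*) [TopologicalSpace M]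
    [ChartedSpace (EuclideanSpace ℝ (Fin n)) M] :=
  ∀ q : M, (TangentSpace (𝓡 n) q →L[ℝ] ℝ) →L[ℝ] (TangentSpace (𝓡 n) q →L[ℝ] ℝ) →L[ℝ] ℝ

/-- The components `P^{ij}` in the chart `e`, as functions on the coordinate domain. -/
def CotBilin.comp (P : CotBilin n M) (e : OpenPartialHomeomorph M (EuclideanSpace ℝ (Fin n)))
    (i j : Fin n) (y : EuclideanSpace ℝ (Fin n)) : ℝ :=
  P (e.symm y) (coordCovec e i (e.symm y)) (coordCovec e j (e.symm y))

/-- The partial derivatives `P^{ij}_{,l}` in the chart `e`, at the point `q`. -/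
def CotBilin.dcomp (P : CotBilin n M) (e : OpenPartialHomeomorph M (EuclideanSpace ℝ (Fin n)))
    (i j l : Fin n) (q : M) : ℝ :=
  fderiv ℝ (P.comp e i j) (e q) (EuclideanSpace.single l (1 : ℝ))

variable (n M) in
/-- A Poisson structure, given by its smooth bivector field `P = ½ P^{ij} ∂_i ∧ ∂_j`, i.e.
`P(dX^i, dX^j) = P^{ij}`, subject to the Jacobi identity. -/
structure PoissonStructure where
  /-- the bivector -/
  bivector : CotBilin n M
  alternating : ∀ q a, bivector q a a = 0
  smooth : ∀ e ∈ IsManifold.maximalAtlas (𝓡 n) ∞ M, ∀ i j,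
    ContDiffOn ℝ ∞ (bivector.comp e i j) e.target
  jacobi : ∀ e ∈ IsManifold.maximalAtlas (𝓡 n) ∞ M, ∀ q ∈ e.source, ∀ i j k,
    ∑ l, (bivector.comp e i l (e q) * bivector.dcomp e j k l q
      + bivector.comp e j l (e q) * bivector.dcomp e k i l q
      + bivector.comp e k l (e q) * bivector.dcomp e i j l q) = 0

/-- `u = P♯ a`, i.e. `u^i = P^{ij} a_j`. -/
def PoissonStructure.IsSharp (P : PoissonStructure n M) (q : M)
    (a : TangentSpace (𝓡 n) q →L[ℝ] ℝ) (u : TangentSpace (𝓡 n) q) : Prop :=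
  ∀ b : TangentSpace (𝓡 n) q →L[ℝ] ℝ, b u = P.bivector q b a

/-- A smooth path `γ` together with a smooth covector field `a` along it such that
`dγ/dt = P♯ a` (a cotangent path). -/
structure PoissonStructure.IsCotangentPath (P : PoissonStructure n M) (γ : ℝ → M)
    (a : ∀ t, TangentSpace (𝓡 n) (γ t) →L[ℝ] ℝ) : Prop where
  smooth : ContMDiff 𝓘(ℝ, ℝ) (𝓡 n) ∞ γ
  smooth_covector : ∀ t, ∀ e ∈ IsManifold.maximalAtlas (𝓡 n) ∞ M, γ t ∈ e.source → ∀ i,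
    ContDiffAt ℝ ∞ (fun s => a s (coordVec e i (γ s))) t
  deriv : ∀ t, P.IsSharp (γ t) (a t) (mfderiv 𝓘(ℝ, ℝ) (𝓡 n) γ t (1 : ℝ))

/-- Two points are joined by a cotangent path. -/
def PoissonStructure.Joined (P : PoissonStructure n M) (q q' : M) : Prop :=
  ∃ (γ : ℝ → M) (a : ∀ t, TangentSpace (𝓡 n) (γ t) →L[ℝ] ℝ),
    P.IsCotangentPath γ a ∧ γ 0 = q ∧ γ 1 = q'

/-- The symplectic leaves: the classes of points that are joined by (finite chains of) cotangent
paths. -/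
def PoissonStructure.IsSymplecticLeaf (P : PoissonStructure n M) (L : Set M) : Prop :=
  ∃ q₀, L = {q | Relation.EqvGen P.Joined q₀ q}

/-- A Casimir function on the open set `U`. -/
structure PoissonStructure.IsCasimirOn (P : PoissonStructure n M) (U : Set M) (f : M → ℝ) :
    Prop where
  smooth : ContMDiffOn (𝓡 n) 𝓘(ℝ, ℝ) ∞ f U
  casimir : ∀ q ∈ U, ∀ b, P.bivector q (dAt (𝓡 n) f q) b = 0

/-- A presymplectic form on the open set `U` compatible with `P`: a smooth closed 2-form whose
restriction to the tangent space `P♯(T_q^*M)` of the leaf through `q`, for every `q ∈ U`, is the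
symplectic form of that leaf. The latter is the inverse of `P`, `P^{ij} Ω_{jk} v^k = v^i` for `v`
tangent to the leaf, which is the same as `Ω(P♯ a, P♯ b) = P(b, a)`. -/
structure PoissonStructure.IsCompatiblePresymplectic (P : PoissonStructure n M) (U : Set M)
    (Ω : DForm (𝓡 n) M 2) : Prop where
  smooth : ∀ q ∈ U, Ω.SmoothAt q
  closed : ∀ q ∈ U, Ω.d q = 0
  compatible : ∀ q ∈ U, ∀ a b u v, P.IsSharp q a u → P.IsSharp q b v →
    Ω q ![u, v] = P.bivector q b a

end Target

section Sigma

variable {E H : Type*} [NormedAddCommGroup E] [NormedSpace ℝ E] [TopologicalSpace H]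
  {I : ModelWithCorners ℝ E H} {S : Type*} [TopologicalSpace S] [ChartedSpace H S]
  {n : ℕ} {M : Type*} [TopologicalSpace M] [ChartedSpace (EuclideanSpace ℝ (Fin n)) M]

variable (I n) in
/-- 1-forms on `S` with values in the pullback of the cotangent bundle of `M` by `X`. -/
abbrev OneFormAlong (X : S → M) :=
  ∀ x : S, TangentSpace I x →L[ℝ] TangentSpace (𝓡 n) (X x) →L[ℝ] ℝ

variable (I n S M) in
/-- The fields of the Poisson sigma model. -/
structure Fields where
  /-- the map from the worldsheet to the target -/
  X : S → M
  /-- the 1-form along it -/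
  A : OneFormAlong I n X

/-- The component `A_i` with respect to the chart `e` of `M`, a 1-form on `S` (meaningful on the
preimage of the chart domain). -/
def Fields.comp (Φ : Fields I S n M) (e : OpenPartialHomeomorph M (EuclideanSpace ℝ (Fin n)))
    (i : Fin n) : DForm I S 1 :=
  oneForm fun x =>
    let B : E →L[ℝ] EuclideanSpace ℝ (Fin n) →L[ℝ] ℝ := Φ.A x
    (B.flip (coordVec e i (Φ.X x)) : E →L[ℝ] ℝ)

theorem Fields.comp_apply (Φ : Fields I S n M)
    (e : OpenPartialHomeomorph M (EuclideanSpace ℝ (Fin n))) (i : Fin n) (x : S)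
    (v : Fin 1 → TangentSpace I x) :
    Φ.comp e i x v = Φ.A x (v 0) (coordVec e i (Φ.X x)) := rfl

/-- Smooth solutions of the field equations
`dX^i + P^{ij} A_j = 0` and `dA_i + ½ P^{kl}_{,i} A_k ∧ A_l = 0`. -/
structure IsSolution (P : PoissonStructure n M) (Φ : Fields I S n M) : Prop where
  smooth_X : ContMDiff I (𝓡 n) ∞ Φ.X
  smooth_A : ∀ p, ∀ e ∈ IsManifold.maximalAtlas (𝓡 n) ∞ M, Φ.X p ∈ e.source → ∀ i,
    (Φ.comp e i).SmoothAt p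
  eq_X : ∀ p (v : TangentSpace I p) (b : TangentSpace (𝓡 n) (Φ.X p) →L[ℝ] ℝ),
    b (mfderiv I (𝓡 n) Φ.X p v) + P.bivector (Φ.X p) b (Φ.A p v) = 0
  eq_A : ∀ p, ∀ e ∈ IsManifold.maximalAtlas (𝓡 n) ∞ M, Φ.X p ∈ e.source → ∀ i,
    ∀ v w : TangentSpace I p,
    (Φ.comp e i).d p ![v, w] + (1 / 2 : ℝ) * ∑ k, ∑ l, P.bivector.dcomp e k l i (Φ.X p) *
      (Φ.comp e k p ![v] * Φ.comp e l p ![w] - Φ.comp e k p ![w] * Φ.comp e l p ![v]) = 0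

/-- A smooth path of solutions generated by the infinitesimal gauge transformations
`δX^i = ε_j P^{ji}`, `δA_i = dε_i + P^{kl}_{,i} A_k ε_l` with smooth, time dependent parameter `ε`,
a section of the pullback of the cotangent bundle of `M`. -/
structure IsGaugePath (P : PoissonStructure n M) (Φ : ℝ → Fields I S n M)
    (ε : ∀ t x, TangentSpace (𝓡 n) ((Φ t).X x) →L[ℝ] ℝ) : Prop where
  solution : ∀ t, IsSolution P (Φ t)
  smooth_X : ContMDiff (𝓘(ℝ, ℝ).prod I) (𝓡 n) ∞ fun z : ℝ × S => (Φ z.1).X z.2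
  smooth_A : ∀ t p, ∀ e ∈ IsManifold.maximalAtlas (𝓡 n) ∞ M, (Φ t).X p ∈ e.source → ∀ i,
    ContDiffWithinAt ℝ ∞ (fun z : ℝ × E => ((Φ z.1).comp e i).inChart p z.2)
      (Set.univ ×ˢ Set.range I) (t, extChartAt I p p)
  smooth_param : ∀ t p, ∀ e ∈ IsManifold.maximalAtlas (𝓡 n) ∞ M, (Φ t).X p ∈ e.source → ∀ i,
    ContMDiffAt (𝓘(ℝ, ℝ).prod I) 𝓘(ℝ, ℝ) ∞
      (fun z : ℝ × S => ε z.1 z.2 (coordVec e i ((Φ z.1).X z.2))) (t, p)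
  flow_X : ∀ t p (b : TangentSpace (𝓡 n) ((Φ t).X p) →L[ℝ] ℝ),
    b (mfderiv 𝓘(ℝ, ℝ) (𝓡 n) (fun s => (Φ s).X p) t (1 : ℝ)) = P.bivector ((Φ t).X p) (ε t p) b
  flow_A : ∀ t p, ∀ e ∈ IsManifold.maximalAtlas (𝓡 n) ∞ M, (Φ t).X p ∈ e.source → ∀ i,
    ∀ v : TangentSpace I p,
    HasDerivAt (fun s => (Φ s).comp e i p ![v])
      (dAt I (fun x => ε t x (coordVec e i ((Φ t).X x))) p v
        + ∑ k, ∑ l, P.bivector.dcomp e k l i ((Φ t).X p) *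
          ((Φ t).comp e k p ![v] * ε t p (coordVec e l ((Φ t).X p)))) t

/-- `Φ'` is obtained from `Φ` by integrating infinitesimal gauge transformations over the time
interval from `0` to `1`. -/
def GaugeTransform (P : PoissonStructure n M) (Φ Φ' : Fields I S n M) : Prop :=
  ∃ (Ψ : ℝ → Fields I S n M) (ε : ∀ t x, TangentSpace (𝓡 n) ((Ψ t).X x) →L[ℝ] ℝ),
    IsGaugePath P Ψ ε ∧ Ψ 0 = Φ ∧ Ψ 1 = Φ'

/-- Gauge equivalence: the equivalence relation generated by gauge transformations. The map `X` is
allowed to move in between. -/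
def GaugeEquiv (P : PoissonStructure n M) : Fields I S n M → Fields I S n M → Prop :=
  Relation.EqvGen (GaugeTransform P)

/-- The `A`-fields that solve the field equations together with the fixed map `X`. -/
abbrev SolutionsOver (I : ModelWithCorners ℝ E H) (P : PoissonStructure n M) (X : S → M) :=
  {A : OneFormAlong I n X // IsSolution P (⟨X, A⟩ : Fields I S n M)}

/-- Gauge equivalence classes of solutions with the fixed map `X`. -/
abbrev GaugeClasses (I : ModelWithCorners ℝ E H) (P : PoissonStructure n M) (X : S → M) :=
  Quot fun A A' : SolutionsOver I P X => GaugeEquiv P (⟨X, A.1⟩ : Fields I S n M) ⟨X, A'.1⟩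

/-- `A_i = - X^*(∂_i ⌟ Ω) + ∑_K α_K X^*(∂_i C^K)`, evaluated on a tangent vector `v` of `S` and with
`∂_i` replaced by an arbitrary tangent vector `w` of `M`. -/
def HasSolutionForm {k : ℕ} (X : S → M) (Ω : DForm (𝓡 n) M 2) (C : Fin k → M → ℝ)
    (α : Fin k → DForm I S 1) (A : OneFormAlong I n X) : Prop :=
  ∀ x (v : TangentSpace I x) (w : TangentSpace (𝓡 n) (X x)),
    A x v w = - Ω (X x) ![w, mfderiv I (𝓡 n) X x v]
      + ∑ K, α K x ![v] * dAt (𝓡 n) (C K) (X x) w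

end Sigma

end PSM

end

/-!
Pointwise, the first field equation says `P♯ A(v) = -dX(v)`. On the leaf one solution of it is
`-Ω(·, dX(v))`, because `Ω` inverts `P` there, and the kernel of `P` is spanned by the differentials
of the Casimir functions. So the solutions are `-X^*(∂_i ⌟ Ω) + α_K X^*(∂_iC^K)` with unique 1-forms
`α_K`, which are smooth as soon as the field is (`IsLeafModel.exists_decomposition`,
`IsLeafModel.coefficient_smooth`).

For a field of this form whose first equation holds, the left side of the second equation is
`dα_K X^*(∂_iC^K)` (`LocalModel.curvature`, `IsLeafModel.fieldStrength`). This is a computation in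
coordinates from `P W P = P`, `P dC = 0`, their derivatives and `dW = 0`, where `W` is the matrix of
`Ω`. Independence of the `dC^K` then makes the second equation equivalent to closedness of all
`α_K`.

If the `α_K` change by `dh_K`, the constant gauge parameter `h_K X^*dC^K` generates a straight path
of solutions over the same map `X` (`IsLeafModel.gaugeTransform_of_exact`).

Conversely, along a gauge path `(X_t, A_t)` with parameter `ε_t` the velocity of `X_t` is
`-P♯ ε_t`, so that `X_t` stays in the leaf (`IsGaugePath.mem_leaf`), and `ε_t dt + A_t` is a field on
the cylinder `ℝ × S` that satisfies the first field equation and the `dt`-components of the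
second. What was said above holds on the cylinder as well, and gives coefficient forms
`β_K dt + α_{K,t}` with `∂_t α_{K,t} = dβ_K`. Hence `α_{K,1} - α_{K,0}` is the differential of `∫₀¹ β_K dt`
(`mem_exactForms_of_cylinder`, `IsLeafModel.sub_mem_exactForms`). Together these facts identify
the gauge classes with tuples of cohomology classes.
-/

namespace PSM

open Filter Topology

noncomputable section

/-! ### The algebra of compatible bivectors and 2-forms -/

section Algebra

open Matrix

variable {ι : Type*} [Fintype ι]

theorem mulVec_dotProduct_of_skew {A : Matrix ι ι ℝ} (hA : Aᵀ = -A) (x y : ι → ℝ) :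
    A *ᵥ x ⬝ᵥ y = -(x ⬝ᵥ A *ᵥ y) := by
  rw [dotProduct_comm, dotProduct_mulVec, ← mulVec_transpose, hA, neg_mulVec, neg_dotProduct,
    dotProduct_comm]

/-- The quadratic term of the field strength, at a point. Here `x`, `y` are the values of the field
on two tangent vectors whose images in the target are `u`, `v`; `γu`, `γv` are their Casimir parts,
`P γ = 0`, and `ηu`, `ηv` the `∂_i`-derivatives of these. The matrices `dP m`, `dW m` are the
derivatives in the direction `m`; of the first only the one in the direction `i` occurs. The
derivatives of `P W P = P` and of `P γ = 0` turn each term with `dP i` into one without it. -/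
theorem curvature_algebra (P W : Matrix ι ι ℝ) (dP dW : ι → Matrix ι ι ℝ) (i : ι)
    (hP : Pᵀ = -P) (hW : Wᵀ = -W) (hdP : (dP i)ᵀ = -dP i) (hdW : ∀ m, (dW m)ᵀ = -dW m)
    (hcompat : P * W * P = P)
    (hdcompat : dP i * W * P + P * dW i * P + P * W * dP i = dP i)
    (hclosed : ∀ m j, dW i m j + dW m j i + dW j i m = 0)
    {γu γv ηu ηv u v x y : ι → ℝ} (hγu : P *ᵥ γu = 0)
    (hηu : dP i *ᵥ γu + P *ᵥ ηu = 0) (hηv : dP i *ᵥ γv + P *ᵥ ηv = 0)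
    (hx : x = -(W *ᵥ u) + γu) (hy : y = -(W *ᵥ v) + γv)
    (hu : u = -(P *ᵥ x)) (hv : v = -(P *ᵥ y)) :
    x ⬝ᵥ dP i *ᵥ y =
      ∑ m, ∑ j, dW m i j * (u m * v j - v m * u j) + (ηu ⬝ᵥ v - ηv ⬝ᵥ u) := by
  -- the derivative of `P W P = P`, multiplied by `P W` on the left and by `W P` on the right
  have hsand : P * W * dP i * W * P = -(P * dW i * P) := by
    have h := congrArg (fun Z => P * W * Z * (W * P)) hdcompat
    have h1 : P * W * (dP i * W * P + P * dW i * P + P * W * dP i) * (W * P)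
        = P * W * dP i * W * (P * W * P) + (P * W * P) * dW i * (P * W * P)
          + (P * W * P) * W * dP i * W * P := by
      noncomm_ring
    simp only [h1, hcompat] at h
    have h2 : P * W * dP i * (W * P) = P * W * dP i * W * P := by noncomm_ring
    rw [h2, add_assoc, add_eq_left] at h
    exact eq_neg_of_add_eq_zero_right h
  have hPWu : ∀ {z s : ι → ℝ}, s = -(P *ᵥ z) → P *ᵥ (W *ᵥ s) = s := by
    intro z s hs
    rw [hs, mulVec_neg, mulVec_neg, mulVec_mulVec, mulVec_mulVec, hcompat]
  have hDγ : ∀ {γ η : ι → ℝ}, dP i *ᵥ γ + P *ᵥ η = 0 → dP i *ᵥ γ = -(P *ᵥ η) := fun h =>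
    eq_neg_of_add_eq_zero_left h
  have hWW : W *ᵥ u ⬝ᵥ dP i *ᵥ (W *ᵥ v) = u ⬝ᵥ dW i *ᵥ v := by
    rw [mulVec_dotProduct_of_skew hW]
    have e1 : u ⬝ᵥ W *ᵥ (dP i *ᵥ (W *ᵥ v)) = -(x ⬝ᵥ (P * W * dP i * W * P) *ᵥ y) := by
      conv_lhs => rw [hu, hv]
      simp only [mulVec_neg, neg_dotProduct, dotProduct_neg, neg_neg]
      rw [mulVec_dotProduct_of_skew hP]
      simp only [mulVec_mulVec, mul_assoc]
    have e2 : u ⬝ᵥ dW i *ᵥ v = -(x ⬝ᵥ (P * dW i * P) *ᵥ y) := by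
      conv_lhs => rw [hu, hv]
      simp only [mulVec_neg, neg_dotProduct, dotProduct_neg, neg_neg]
      rw [mulVec_dotProduct_of_skew hP]
      simp only [mulVec_mulVec, mul_assoc]
    rw [e1, e2, hsand, neg_mulVec, dotProduct_neg, neg_neg]
  have hWγ : W *ᵥ u ⬝ᵥ dP i *ᵥ γv = ηv ⬝ᵥ u := by
    rw [hDγ hηv, dotProduct_neg, ← mulVec_dotProduct_of_skew hP, hPWu hu, dotProduct_comm]
  have hγW : γu ⬝ᵥ dP i *ᵥ (W *ᵥ v) = -(ηu ⬝ᵥ v) := by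
    have h := mulVec_dotProduct_of_skew hdP γu (W *ᵥ v)
    rw [hDγ hηu, neg_dotProduct, mulVec_dotProduct_of_skew hP, hPWu hv] at h
    linarith
  have hγγ : γu ⬝ᵥ dP i *ᵥ γv = 0 := by
    rw [hDγ hηv, dotProduct_neg, ← mulVec_dotProduct_of_skew hP, hγu, zero_dotProduct]
  have hE : u ⬝ᵥ dW i *ᵥ v = ∑ m, ∑ j, dW m i j * (u m * v j - v m * u j) := by
    have e : ∀ m j, u m * (dW i m j * v j) =
        dW m i j * (u m * v j) - dW j i m * (v j * u m) := by
      intro m j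
      have h1 := hclosed m j
      have h2 : dW m j i = -dW m i j := by
        have := congrFun (congrFun (hdW m) i) j
        simpa using this
      rw [h2] at h1
      linear_combination (u m * v j) * h1
    simp only [dotProduct, mulVec, Finset.mul_sum, e, Finset.sum_sub_distrib, mul_sub]
    congr 1
    rw [Finset.sum_comm]
  rw [hx, hy, mulVec_add, mulVec_neg]
  simp only [add_dotProduct, dotProduct_add, neg_dotProduct, dotProduct_neg]
  rw [hWW, hWγ, hγW, hγγ, hE]
  ring

end Algebra

/-! ### Curls of 1-forms on subsets of normed spaces -/

section Calculus

variable {F : Type*} [NormedAddCommGroup F] [NormedSpace ℝ F]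

/-- The exterior derivative of a 1-form on a subset `s` of a normed space, with 1-forms seen as
functions with values in the dual: `D_v a(w) - D_w a(v)`. -/
def curl (s : Set F) (a : F → F →L[ℝ] ℝ) (z v w : F) : ℝ :=
  fderivWithin ℝ a s z v w - fderivWithin ℝ a s z w v

variable {n k : ℕ} {s : Set F} {z₀ : F}

theorem two_le_infty : (2 : ℕ∞ω) ≤ ∞ := WithTop.coe_le_coe.2 le_top

/-- The curl of `-W_j(Y) dY^j + c_K(Y) α_K`. The second derivatives of `Y` cancel; their symmetry at
boundary points of `s` needs `z₀ ∈ closure (interior s)`. -/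
theorem curl_of_solutionForm (hs : UniqueDiffOn ℝ s) (hz : z₀ ∈ s)
    (hz' : z₀ ∈ closure (interior s)) {Y : F → EuclideanSpace ℝ (Fin n)}
    (hY : ContDiffWithinAt ℝ ∞ Y s z₀) {W : Fin n → EuclideanSpace ℝ (Fin n) → ℝ}
    (hW : ∀ j, DifferentiableAt ℝ (W j) (Y z₀)) {c : Fin k → EuclideanSpace ℝ (Fin n) → ℝ}
    (hc : ∀ K, DifferentiableAt ℝ (c K) (Y z₀)) {α : Fin k → F → F →L[ℝ] ℝ}
    (hα : ∀ K, DifferentiableWithinAt ℝ (α K) s z₀) {a : F → F →L[ℝ] ℝ}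
    (ha : ∀ᶠ z in nhdsWithin z₀ s, ∀ w, a z w =
      -∑ j, W j (Y z) * (fderivWithin ℝ Y s z w) j + ∑ K, α K z w * c K (Y z)) (v w : F) :
    curl s a z₀ v w =
      -∑ j, (fderiv ℝ (W j) (Y z₀) (fderivWithin ℝ Y s z₀ v) * (fderivWithin ℝ Y s z₀ w) j
          - fderiv ℝ (W j) (Y z₀) (fderivWithin ℝ Y s z₀ w) * (fderivWithin ℝ Y s z₀ v) j)
      + ∑ K, (curl s (α K) z₀ v w * c K (Y z₀)
          + (α K z₀ w * fderiv ℝ (c K) (Y z₀) (fderivWithin ℝ Y s z₀ v)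
            - α K z₀ v * fderiv ℝ (c K) (Y z₀) (fderivWithin ℝ Y s z₀ w))) := by
  have hu : UniqueDiffWithinAt ℝ s z₀ := hs z₀ hz
  set b : F → F →L[ℝ] ℝ := fun z =>
    -∑ j, W j (Y z) • ((EuclideanSpace.proj j : EuclideanSpace ℝ (Fin n) →L[ℝ] ℝ).comp
      (fderivWithin ℝ Y s z)) + ∑ K, c K (Y z) • α K z with hb
  have hab : a =ᶠ[nhdsWithin z₀ s] b := by
    filter_upwards [ha] with z hz
    ext w
    rw [hz w]
    simp [hb, mul_comm]
  have hYd : HasFDerivWithinAt Y (fderivWithin ℝ Y s z₀) s z₀ :=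
    (hY.differentiableWithinAt (by simp)).hasFDerivWithinAt
  have hY2 : HasFDerivWithinAt (fderivWithin ℝ Y s) (fderivWithin ℝ (fderivWithin ℝ Y s) s z₀)
      s z₀ :=
    ((hY.fderivWithin_right (m := 1) hs (WithTop.coe_le_coe.2 le_top) hz).differentiableWithinAt
      (by simp)).hasFDerivWithinAt
  have hsymm : ∀ v w, fderivWithin ℝ (fderivWithin ℝ Y s) s z₀ v w =
      fderivWithin ℝ (fderivWithin ℝ Y s) s z₀ w v :=
    fun v w => hY.isSymmSndFDerivWithinAt (by simpa using two_le_infty) hs hz' hz v w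
  have h1 : ∀ j, HasFDerivWithinAt (fun z => W j (Y z))
      ((fderiv ℝ (W j) (Y z₀)).comp (fderivWithin ℝ Y s z₀)) s z₀ := fun j =>
    (hW j).hasFDerivAt.comp_hasFDerivWithinAt z₀ hYd
  have h2 : ∀ K, HasFDerivWithinAt (fun z => c K (Y z))
      ((fderiv ℝ (c K) (Y z₀)).comp (fderivWithin ℝ Y s z₀)) s z₀ := fun K =>
    (hc K).hasFDerivAt.comp_hasFDerivWithinAt z₀ hYd
  have h3 : ∀ j : Fin n, HasFDerivWithinAt (fun z =>
      (EuclideanSpace.proj j : EuclideanSpace ℝ (Fin n) →L[ℝ] ℝ).comp (fderivWithin ℝ Y s z)) _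
      s z₀ := fun j =>
    ((ContinuousLinearMap.compL ℝ F _ ℝ
      (EuclideanSpace.proj j : EuclideanSpace ℝ (Fin n) →L[ℝ] ℝ)).hasFDerivAt.comp_hasFDerivWithinAt
        z₀ hY2)
  have hbd := ((HasFDerivWithinAt.fun_sum (u := Finset.univ)
    fun j _ => (h1 j).smul (h3 j)).neg.add (HasFDerivWithinAt.fun_sum (u := Finset.univ)
      fun K _ => (h2 K).smul (hα K).hasFDerivWithinAt))
  have hfd := (hbd.congr_of_eventuallyEq hab (hab.eq_of_nhdsWithin hz)).fderivWithin hu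
  simp only [curl, hfd]
  simp only [_root_.add_apply, _root_.neg_apply,
    _root_.sum_apply, _root_.smul_apply,
    ContinuousLinearMap.smulRight_apply, ContinuousLinearMap.comp_apply,
    ContinuousLinearMap.compL_apply, PiLp.proj_apply, smul_eq_mul]
  simp only [hsymm w v, Finset.sum_add_distrib, Finset.sum_sub_distrib, sub_mul, mul_comm (c _ _),
    mul_comm (α _ _ _)]
  ring

end Calculus

/-! ### Coordinate expressions -/

section Local

variable {F : Type*} [NormedAddCommGroup F] [NormedSpace ℝ F] {s : Set F} {z₀ : F} {n k : ℕ}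

theorem contDiffWithinAt_det {ι : Type*} [Fintype ι] [DecidableEq ι] {A : F → Matrix ι ι ℝ}
    (hA : ∀ i j, ContDiffWithinAt ℝ ∞ (fun z => A z i j) s z₀) :
    ContDiffWithinAt ℝ ∞ (fun z => (A z).det) s z₀ := by
  simp only [Matrix.det_apply']
  refine ContDiffWithinAt.sum fun σ _ => contDiffWithinAt_const.mul ?_
  exact contDiffWithinAt_prod fun i _ => hA _ _

theorem exists_leftInverse_of_linearIndependent {c : Fin k → Fin n → ℝ}
    (hc : LinearIndependent ℝ c) :
    ∃ l : Fin k → Fin n → ℝ, ∀ J K, ∑ i, l J i * c K i = if J = K then 1 else 0 := by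
  obtain ⟨g, hg⟩ := LinearMap.exists_leftInverse_of_injective (Fintype.linearCombination ℝ c)
    (LinearMap.ker_eq_bot'.2 fun m hm =>
      funext (Fintype.linearIndependent_iff.1 hc m
        (by rwa [Fintype.linearCombination_apply] at hm)))
  refine ⟨fun J i => g (Pi.single i 1) J, fun J K => ?_⟩
  have h1 : g (c K) = Pi.single K 1 := by
    have := LinearMap.congr_fun hg (Pi.single K 1)
    simpa [Fintype.linearCombination_apply_single] using this
  have h2 : c K = ∑ i, c K i • (Pi.single i 1 : Fin n → ℝ) := by
    ext j; simp [Finset.sum_apply, Pi.single_apply]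
  rw [h2, map_sum] at h1
  have h3 := congrFun h1 J
  simp only [map_smul, Finset.sum_apply, Pi.smul_apply, smul_eq_mul, Pi.single_apply] at h3
  simpa [mul_comm] using h3

/-- The coefficients of smooth vectors with respect to smooth independent vectors are smooth: a
fixed left inverse of the matrix `c` at `z₀` makes it a square matrix that is invertible near `z₀`,
to which Cramer's rule applies. -/
theorem contDiffWithinAt_coeff {G : Type*} [NormedAddCommGroup G] [NormedSpace ℝ G]
    {c : Fin k → Fin n → F → ℝ} (hc : ∀ K i, ContDiffWithinAt ℝ ∞ (c K i) s z₀)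
    (hind : LinearIndependent ℝ fun K i => c K i z₀) {α : Fin k → F → G} {b : Fin n → F → G}
    (hb : ∀ i, ContDiffWithinAt ℝ ∞ (b i) s z₀) (hz : z₀ ∈ s)
    (h : ∀ i, ∀ᶠ z in 𝓝[s] z₀, b i z = ∑ K, c K i z • α K z) (K : Fin k) :
    ContDiffWithinAt ℝ ∞ (α K) s z₀ := by
  obtain ⟨l, hl⟩ := exists_leftInverse_of_linearIndependent hind
  set m : F → Matrix (Fin k) (Fin k) ℝ := fun z => Matrix.of fun J K => ∑ i, l J i * c K i z with hm
  have hms : ∀ J K, ContDiffWithinAt ℝ ∞ (fun z => m z J K) s z₀ := fun J K => by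
    simp only [hm, Matrix.of_apply]
    exact ContDiffWithinAt.sum fun i _ => contDiffWithinAt_const.mul (hc K i)
  have hdet := contDiffWithinAt_det hms
  have hm1 : m z₀ = 1 := by
    ext J K; simp [hm, hl, Matrix.one_apply]
  have hdet1 : (m z₀).det ≠ 0 := by simp [hm1]
  have hadj : ∀ J K, ContDiffWithinAt ℝ ∞ (fun z => (m z).adjugate J K) s z₀ := fun J K => by
    simp only [Matrix.adjugate_apply]
    refine contDiffWithinAt_det fun i j => ?_
    by_cases hi : i = K
    · subst hi; simpa using contDiffWithinAt_const
    · simpa [Matrix.updateRow_apply, hi] using hms i j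
  have hsm : ContDiffWithinAt ℝ ∞
      (fun z => ((m z).det)⁻¹ • ∑ J, (m z).adjugate K J • ∑ i, l J i • b i z) s z₀ :=
    (hdet.inv hdet1).smul (ContDiffWithinAt.sum fun J _ => (hadj K J).smul
      (ContDiffWithinAt.sum fun i _ => contDiffWithinAt_const.smul (hb i)))
  have hev : ∀ᶠ z in 𝓝[s] z₀, α K z =
      ((m z).det)⁻¹ • ∑ J, (m z).adjugate K J • ∑ i, l J i • b i z := by
    filter_upwards [eventually_all.2 h, hdet.continuousWithinAt.eventually_ne hdet1] with z hz hd
    have e1 : ∀ J, ∑ i, l J i • b i z = ∑ K, m z J K • α K z := by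
      intro J
      simp only [hz, Finset.smul_sum, hm, Matrix.of_apply, Finset.sum_smul, mul_smul]
      rw [Finset.sum_comm]
    have e2 : ∑ J, (m z).adjugate K J • ∑ i, l J i • b i z = (m z).det • α K z := by
      simp only [e1, Finset.smul_sum]
      rw [Finset.sum_comm]
      have h3 : ∀ I, ∑ J, (m z).adjugate K J • m z J I • α I z
          = ((m z).det • (1 : Matrix (Fin k) (Fin k) ℝ)) K I • α I z := by
        intro I
        rw [← Matrix.adjugate_mul, Matrix.mul_apply, Finset.sum_smul]
        simp only [mul_smul]
      simp [h3, Matrix.one_apply]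
    rw [e2, smul_smul, inv_mul_cancel₀ hd, one_smul]
  exact hsm.congr_of_eventuallyEq hev (hev.self_of_nhdsWithin hz)

theorem eq_sum_single (u : EuclideanSpace ℝ (Fin n)) :
    u = ∑ m, u m • EuclideanSpace.single m (1 : ℝ) := by
  ext j
  simp [Finset.sum_apply, Pi.single_apply]

theorem fderiv_apply_eq_sum (f : EuclideanSpace ℝ (Fin n) → ℝ) (y u : EuclideanSpace ℝ (Fin n)) :
    fderiv ℝ f y u = ∑ m, u m * fderiv ℝ f y (EuclideanSpace.single m 1) := by
  conv_lhs => rw [eq_sum_single u, map_sum]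
  simp

/-- The coordinate expressions, near a point `y₀`, of a Poisson bivector `P`, of a presymplectic
form `W` compatible with it, and of independent Casimir functions `C`. -/
structure LocalModel (P W : Fin n → Fin n → EuclideanSpace ℝ (Fin n) → ℝ)
    (C : Fin k → EuclideanSpace ℝ (Fin n) → ℝ) (y₀ : EuclideanSpace ℝ (Fin n)) : Prop where
  smooth_P : ∀ i j, ContDiffAt ℝ ∞ (P i j) y₀
  smooth_W : ∀ i j, ContDiffAt ℝ ∞ (W i j) y₀
  smooth_C : ∀ K, ContDiffAt ℝ ∞ (C K) y₀
  skew_P : ∀ i j, ∀ᶠ y in 𝓝 y₀, P j i y = -P i j y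
  skew_W : ∀ i j, ∀ᶠ y in 𝓝 y₀, W j i y = -W i j y
  compatible : ∀ i l, ∀ᶠ y in 𝓝 y₀, ∑ m, (∑ j, P i j y * W j m y) * P m l y = P i l y
  casimir : ∀ K i, ∀ᶠ y in 𝓝 y₀, ∑ l, P i l y * fderiv ℝ (C K) y (EuclideanSpace.single l 1) = 0
  closed : ∀ i m j, fderiv ℝ (W m j) y₀ (EuclideanSpace.single i 1)
    + fderiv ℝ (W j i) y₀ (EuclideanSpace.single m 1)
    + fderiv ℝ (W i m) y₀ (EuclideanSpace.single j 1) = 0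
  independent : LinearIndependent ℝ fun K i => fderiv ℝ (C K) y₀ (EuclideanSpace.single i 1)

namespace LocalModel

variable {P W : Fin n → Fin n → EuclideanSpace ℝ (Fin n) → ℝ}
  {C : Fin k → EuclideanSpace ℝ (Fin n) → ℝ} {Y : F → EuclideanSpace ℝ (Fin n)}
  {α : Fin k → F → F →L[ℝ] ℝ} {a : Fin n → F → F →L[ℝ] ℝ}

theorem smooth_dC {y₀ : EuclideanSpace ℝ (Fin n)} (h : LocalModel P W C y₀) (K : Fin k)
    (i : Fin n) :
    ContDiffAt ℝ ∞ (fun y => fderiv ℝ (C K) y (EuclideanSpace.single i 1)) y₀ :=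
  ((h.smooth_C K).fderiv_right (m := ∞) (by simp)).clm_apply contDiffAt_const

theorem fderiv_dC_symm {y₀ : EuclideanSpace ℝ (Fin n)} (h : LocalModel P W C y₀) (K : Fin k)
    (i j : Fin n) :
    fderiv ℝ (fun y => fderiv ℝ (C K) y (EuclideanSpace.single i 1)) y₀
      (EuclideanSpace.single j 1) = fderiv ℝ (fun y => fderiv ℝ (C K) y
        (EuclideanSpace.single j 1)) y₀ (EuclideanSpace.single i 1) := by
  have hd : DifferentiableAt ℝ (fderiv ℝ (C K)) y₀ :=
    ((h.smooth_C K).fderiv_right (m := ∞) (by simp)).differentiableAt (by simp)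
  have e : ∀ i u, fderiv ℝ (fun y => fderiv ℝ (C K) y (EuclideanSpace.single i 1)) y₀ u =
      fderiv ℝ (fderiv ℝ (C K)) y₀ u (EuclideanSpace.single i 1) := by
    intro i u
    have := (hd.hasFDerivAt.clm_apply (hasFDerivAt_const (EuclideanSpace.single i (1 : ℝ)) y₀))
    rw [this.fderiv]; simp
  rw [e, e]
  exact ((h.smooth_C K).isSymmSndFDerivAt (by simpa using two_le_infty)) _ _

/-- The derivative of the Casimir condition `P^{pl} ∂_l C = 0` in the direction `∂_i`. -/
theorem fderiv_casimir_condition {y₀ : EuclideanSpace ℝ (Fin n)} (h : LocalModel P W C y₀)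
    (K : Fin k) (i p : Fin n) :
    ∑ l, fderiv ℝ (P p l) y₀ (EuclideanSpace.single i 1)
        * fderiv ℝ (C K) y₀ (EuclideanSpace.single l 1)
      + ∑ l, P p l y₀ * fderiv ℝ (fun y => fderiv ℝ (C K) y (EuclideanSpace.single i 1)) y₀
        (EuclideanSpace.single l 1) = 0 := by
  have h0 : (fun y => ∑ l, P p l y * fderiv ℝ (C K) y (EuclideanSpace.single l 1)) =ᶠ[𝓝 y₀]
    fun _ => 0 := h.casimir K p
  have hd := HasFDerivAt.fun_sum (u := Finset.univ) fun l _ =>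
    ((h.smooth_P p l).differentiableAt (by simp)).hasFDerivAt.mul
      ((h.smooth_dC K l).differentiableAt (by simp)).hasFDerivAt
  have h1 := DFunLike.congr_fun (hd.fderiv.symm.trans h0.fderiv_eq) (EuclideanSpace.single i 1)
  simp only [_root_.sum_apply, _root_.add_apply, _root_.smul_apply, smul_eq_mul,
    Finset.sum_add_distrib, fderiv_fun_const, Pi.zero_apply, _root_.zero_apply] at h1
  simp only [h.fderiv_dC_symm K i]
  rw [← h1, add_comm]
  simp only [mul_comm]

theorem contDiffWithinAt_solutionForm (h : LocalModel P W C (Y z₀)) (hs : UniqueDiffOn ℝ s)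
    (hz : z₀ ∈ s) (hY : ContDiffWithinAt ℝ ∞ Y s z₀)
    (hα : ∀ K, ContDiffWithinAt ℝ ∞ (α K) s z₀) {i : Fin n} {a : F → F →L[ℝ] ℝ}
    (ha : ∀ᶠ z in 𝓝[s] z₀, ∀ w, a z w = -∑ j, W i j (Y z) * (fderivWithin ℝ Y s z w) j
      + ∑ K, α K z w * fderiv ℝ (C K) (Y z) (EuclideanSpace.single i 1)) :
    ContDiffWithinAt ℝ ∞ a s z₀ := by
  have hY' := hY.fderivWithin_right (m := ∞) hs (by simp) hz
  set b : F → F →L[ℝ] ℝ := fun z => -∑ j, W i j (Y z) •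
      ((EuclideanSpace.proj j : EuclideanSpace ℝ (Fin n) →L[ℝ] ℝ).comp (fderivWithin ℝ Y s z))
      + ∑ K, fderiv ℝ (C K) (Y z) (EuclideanSpace.single i 1) • α K z with hbdef
  have hb : ContDiffWithinAt ℝ ∞ b s z₀ :=
    (ContDiffWithinAt.sum fun j _ => ((h.smooth_W i j).comp_contDiffWithinAt z₀ hY).smul
      (contDiffWithinAt_const.clm_comp hY')).neg.add
    (ContDiffWithinAt.sum fun K _ => ((h.smooth_dC K i).comp_contDiffWithinAt z₀ hY).smul (hα K))
  have hab : a =ᶠ[𝓝[s] z₀] b := by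
    filter_upwards [ha] with z hz
    ext w
    rw [hz w]
    simp [hbdef, mul_comm]
  exact hb.congr_of_eventuallyEq hab (hab.eq_of_nhdsWithin hz)

theorem contDiffWithinAt_coefficient (h : LocalModel P W C (Y z₀)) (hs : UniqueDiffOn ℝ s)
    (hz : z₀ ∈ s) (hY : ContDiffWithinAt ℝ ∞ Y s z₀)
    (ha' : ∀ i, ContDiffWithinAt ℝ ∞ (a i) s z₀)
    (ha : ∀ i, ∀ᶠ z in 𝓝[s] z₀, ∀ w, a i z w = -∑ j, W i j (Y z) * (fderivWithin ℝ Y s z w) j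
      + ∑ K, α K z w * fderiv ℝ (C K) (Y z) (EuclideanSpace.single i 1)) (K : Fin k) :
    ContDiffWithinAt ℝ ∞ (α K) s z₀ := by
  have hY' := hY.fderivWithin_right (m := ∞) hs (by simp) hz
  refine contDiffWithinAt_coeff (c := fun K i z => fderiv ℝ (C K) (Y z)
    (EuclideanSpace.single i 1)) (fun K i => (h.smooth_dC K i).comp_contDiffWithinAt z₀ hY)
    h.independent (b := fun i z => a i z + ∑ j, W i j (Y z) •
      ((EuclideanSpace.proj j : EuclideanSpace ℝ (Fin n) →L[ℝ] ℝ).comp (fderivWithin ℝ Y s z)))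
    (fun i => (ha' i).add (ContDiffWithinAt.sum fun j _ =>
      ((h.smooth_W i j).comp_contDiffWithinAt z₀ hY).smul (contDiffWithinAt_const.clm_comp hY')))
    hz (fun i => ?_) K
  filter_upwards [ha i] with z hz
  ext w
  simp [hz w, mul_comm]

/-- The field strength of `a_i = -W_{ij}(Y) dY^j + α_K ∂_iC^K(Y)` is `dα_K ∂_iC^K(Y)`, provided that
`dY^i = -P^{ij} a_j`. The Jacobi identity is not needed: the closedness of `W` replaces it. -/
theorem curvature (h : LocalModel P W C (Y z₀)) (hs : UniqueDiffOn ℝ s)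
    (hz : z₀ ∈ s) (hz' : z₀ ∈ closure (interior s)) (hY : ContDiffWithinAt ℝ ∞ Y s z₀)
    (hα : ∀ K, ContDiffWithinAt ℝ ∞ (α K) s z₀)
    (ha : ∀ i, ∀ᶠ z in 𝓝[s] z₀, ∀ w, a i z w = -∑ j, W i j (Y z) * (fderivWithin ℝ Y s z w) j
      + ∑ K, α K z w * fderiv ℝ (C K) (Y z) (EuclideanSpace.single i 1))
    (hX : ∀ v i, (fderivWithin ℝ Y s z₀ v) i = -∑ j, P i j (Y z₀) * a j z₀ v)
    (i : Fin n) (v w : F) :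
    curl s (a i) z₀ v w + (1 / 2 : ℝ) * ∑ p, ∑ q,
        fderiv ℝ (P p q) (Y z₀) (EuclideanSpace.single i 1) *
          (a p z₀ v * a q z₀ w - a p z₀ w * a q z₀ v) =
      ∑ K, curl s (α K) z₀ v w * fderiv ℝ (C K) (Y z₀) (EuclideanSpace.single i 1) := by
  set y₀ := Y z₀ with hy₀
  have dP : ∀ i j, DifferentiableAt ℝ (P i j) y₀ := fun i j =>
    (h.smooth_P i j).differentiableAt (by simp)
  have dW : ∀ i j, DifferentiableAt ℝ (W i j) y₀ := fun i j =>
    (h.smooth_W i j).differentiableAt (by simp)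
  have dC : ∀ K i, DifferentiableAt ℝ
      (fun y => fderiv ℝ (C K) y (EuclideanSpace.single i 1)) y₀ := fun K i =>
    (h.smooth_dC K i).differentiableAt (by simp)
  have hcurl := curl_of_solutionForm hs hz hz' hY (W := fun j => W i j) (fun j => dW i j)
    (c := fun K y => fderiv ℝ (C K) y (EuclideanSpace.single i 1)) (fun K => dC K i)
    (fun K => (hα K).differentiableWithinAt (by simp)) (ha i) v w
  have hskP : ∀ i j, ∀ u, fderiv ℝ (P j i) y₀ u = -fderiv ℝ (P i j) y₀ u := fun i j u => by
    have h0 : P j i =ᶠ[𝓝 y₀] fun y => -P i j y := h.skew_P i j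
    rw [h0.fderiv_eq]; simp [fderiv_fun_neg]
  have hskW : ∀ i j, ∀ u, fderiv ℝ (W j i) y₀ u = -fderiv ℝ (W i j) y₀ u := fun i j u => by
    have h0 : W j i =ᶠ[𝓝 y₀] fun y => -W i j y := h.skew_W i j
    rw [h0.fderiv_eq]; simp [fderiv_fun_neg]
  -- the derivative of the compatibility condition
  have hdcompat : ∀ i p q, ∑ m, (∑ j, fderiv ℝ (P p j) y₀ (EuclideanSpace.single i 1) * W j m y₀)
        * P m q y₀ + ∑ m, (∑ j, P p j y₀ * fderiv ℝ (W j m) y₀ (EuclideanSpace.single i 1))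
        * P m q y₀ + ∑ m, (∑ j, P p j y₀ * W j m y₀)
        * fderiv ℝ (P m q) y₀ (EuclideanSpace.single i 1)
      = fderiv ℝ (P p q) y₀ (EuclideanSpace.single i 1) := by
    intro i p q
    have h0 : (fun y => ∑ m, (∑ j, P p j y * W j m y) * P m q y) =ᶠ[𝓝 y₀] P p q :=
      h.compatible p q
    rw [← h0.fderiv_eq]
    have hd := HasFDerivAt.fun_sum (u := Finset.univ) fun m _ =>
      (HasFDerivAt.fun_sum (u := Finset.univ) fun j _ =>
        (dP p j).hasFDerivAt.mul (dW j m).hasFDerivAt).mul (dP m q).hasFDerivAt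
    erw [hd.fderiv]
    simp only [_root_.sum_apply, _root_.add_apply, _root_.smul_apply, smul_eq_mul, Pi.mul_apply,
      mul_add, Finset.sum_add_distrib, Finset.mul_sum, Finset.sum_mul]
    simp only [mul_comm, mul_left_comm]
    ring
  have hdcas := h.fderiv_casimir_condition
  -- the hypotheses of `curvature_algebra`, in matrix form
  have hx : ∀ v, (fun p => a p z₀ v) = -(Matrix.mulVec (Matrix.of fun p q => W p q y₀)
      (fun j => (fderivWithin ℝ Y s z₀ v) j)) + fun p => ∑ K, α K z₀ v *
        fderiv ℝ (C K) y₀ (EuclideanSpace.single p 1) := by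
    intro v
    ext p
    exact (ha p).self_of_nhdsWithin hz v
  have hu : ∀ v, (fun j => (fderivWithin ℝ Y s z₀ v) j) =
      -(Matrix.mulVec (Matrix.of fun p q => P p q y₀) (fun p => a p z₀ v)) := by
    intro v
    ext p
    exact hX v p
  have hγ : ∀ v, Matrix.mulVec (Matrix.of fun p q => P p q y₀)
      (fun p => ∑ K, α K z₀ v * fderiv ℝ (C K) y₀ (EuclideanSpace.single p 1)) = 0 := by
    intro v
    ext p
    simp only [Matrix.mulVec, dotProduct, Matrix.of_apply, Finset.mul_sum, Pi.zero_apply]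
    rw [Finset.sum_comm]
    refine Finset.sum_eq_zero fun K _ => ?_
    have := (h.casimir K p).self_of_nhds
    simp only [mul_left_comm _ (α K z₀ v), ← Finset.mul_sum, this, mul_zero]
  have hη : ∀ v, Matrix.mulVec
        (Matrix.of fun p q => fderiv ℝ (P p q) y₀ (EuclideanSpace.single i 1))
        (fun p => ∑ K, α K z₀ v * fderiv ℝ (C K) y₀ (EuclideanSpace.single p 1))
      + Matrix.mulVec (Matrix.of fun p q => P p q y₀)
        (fun p => ∑ K, α K z₀ v * fderiv ℝ (fun y => fderiv ℝ (C K) y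
          (EuclideanSpace.single i 1)) y₀ (EuclideanSpace.single p 1)) = 0 := by
    intro v
    ext p
    simp only [Matrix.mulVec, dotProduct, Matrix.of_apply, Finset.mul_sum, Pi.add_apply,
      Pi.zero_apply]
    rw [Finset.sum_comm, Finset.sum_comm (f := fun q K => P p q y₀ * _),
      ← Finset.sum_add_distrib]
    refine Finset.sum_eq_zero fun K _ => ?_
    have := hdcas K i p
    simp only [mul_left_comm _ (α K z₀ v), ← Finset.mul_sum, ← mul_add, this, mul_zero]
  have halg := curvature_algebra (Matrix.of fun p q => P p q y₀) (Matrix.of fun p q => W p q y₀)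
    (fun i => Matrix.of fun p q => fderiv ℝ (P p q) y₀ (EuclideanSpace.single i 1))
    (fun i => Matrix.of fun p q => fderiv ℝ (W p q) y₀ (EuclideanSpace.single i 1)) i
    (by ext p q; exact (h.skew_P p q).self_of_nhds) (by ext p q; exact (h.skew_W p q).self_of_nhds)
    (by ext p q; exact hskP p q _) (fun m => by ext p q; exact hskW p q _)
    (by ext p q; simpa [Matrix.mul_apply] using (h.compatible p q).self_of_nhds)
    (by ext p q; simpa [Matrix.mul_apply] using hdcompat i p q)
    (fun m j => h.closed i m j) (hγ v) (hη v) (hη w) (hx v) (hx w) (hu v) (hu w)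
  have hquad : ∑ p, ∑ q, fderiv ℝ (P p q) y₀ (EuclideanSpace.single i 1) *
        (a p z₀ v * a q z₀ w - a p z₀ w * a q z₀ v) = 2 * ((fun p => a p z₀ v) ⬝ᵥ Matrix.mulVec
        (Matrix.of fun p q => fderiv ℝ (P p q) y₀ (EuclideanSpace.single i 1))
        (fun p => a p z₀ w)) := by
    simp only [Matrix.mulVec, dotProduct, Matrix.of_apply, Finset.mul_sum, mul_sub,
      Finset.sum_sub_distrib]
    rw [Finset.sum_comm (f := fun p q => fderiv ℝ (P p q) y₀ (EuclideanSpace.single i 1) *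
      (a p z₀ w * a q z₀ v))]
    simp only [← Finset.sum_sub_distrib]
    refine Finset.sum_congr rfl fun p _ => Finset.sum_congr rfl fun q _ => ?_
    rw [hskP p q]
    ring
  simp only [← hy₀] at hcurl
  rw [hcurl, hquad, halg]
  simp only [fderiv_apply_eq_sum (W _ _) y₀ (fderivWithin ℝ Y s z₀ _),
    fderiv_apply_eq_sum (fun y => fderiv ℝ (C _) y _) y₀ (fderivWithin ℝ Y s z₀ _)]
  have e1 : ∑ j, ((∑ m, (fderivWithin ℝ Y s z₀ v) m * fderiv ℝ (W i j) y₀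
          (EuclideanSpace.single m 1)) * (fderivWithin ℝ Y s z₀ w) j
        - (∑ m, (fderivWithin ℝ Y s z₀ w) m * fderiv ℝ (W i j) y₀
          (EuclideanSpace.single m 1)) * (fderivWithin ℝ Y s z₀ v) j)
      = ∑ m, ∑ j, fderiv ℝ (W i j) y₀ (EuclideanSpace.single m 1) *
        ((fderivWithin ℝ Y s z₀ v) m * (fderivWithin ℝ Y s z₀ w) j
          - (fderivWithin ℝ Y s z₀ w) m * (fderivWithin ℝ Y s z₀ v) j) := by
    rw [Finset.sum_comm]
    refine Finset.sum_congr rfl fun j _ => ?_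
    rw [Finset.sum_mul, Finset.sum_mul, ← Finset.sum_sub_distrib]
    exact Finset.sum_congr rfl fun m _ => by ring
  have e2 : ∀ v w : F, (fun p => ∑ K, α K z₀ v * fderiv ℝ (fun y => fderiv ℝ (C K) y
          (EuclideanSpace.single i 1)) y₀ (EuclideanSpace.single p 1)) ⬝ᵥ
        (fun j => (fderivWithin ℝ Y s z₀ w) j) =
      ∑ K, α K z₀ v * ∑ m, (fderivWithin ℝ Y s z₀ w) m * fderiv ℝ (fun y => fderiv ℝ (C K) y
          (EuclideanSpace.single i 1)) y₀ (EuclideanSpace.single m 1) := by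
    intro v w
    simp only [dotProduct, Finset.sum_mul, Finset.mul_sum]
    rw [Finset.sum_comm]
    exact Finset.sum_congr rfl fun K _ => Finset.sum_congr rfl fun m _ => by ring
  rw [e1, e2, e2]
  simp only [Matrix.of_apply, Finset.sum_add_distrib, Finset.sum_sub_distrib]
  ring

end LocalModel

end Local

/-! ### Coordinate frames of the target -/

section Frames

variable {n : ℕ} {M : Type*} [TopologicalSpace M] [ChartedSpace (EuclideanSpace ℝ (Fin n)) M]
  {e : OpenPartialHomeomorph M (EuclideanSpace ℝ (Fin n))}

theorem mdifferentiable_of_mem_maximalAtlas (he : e ∈ IsManifold.maximalAtlas (𝓡 n) ∞ M) :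
    e.MDifferentiable (𝓡 n) (𝓡 n) :=
  ⟨(contMDiffOn_of_mem_maximalAtlas he).mdifferentiableOn (by simp),
    (contMDiffOn_symm_of_mem_maximalAtlas he).mdifferentiableOn (by simp)⟩

/-- The derivative of the chart `e` at `q`, as an endomorphism of the model space. -/
def chartDeriv (e : OpenPartialHomeomorph M (EuclideanSpace ℝ (Fin n))) (q : M) :
    EuclideanSpace ℝ (Fin n) →L[ℝ] EuclideanSpace ℝ (Fin n) :=
  mfderiv (𝓡 n) (𝓡 n) e q

/-- The derivative of the inverse of the chart `e` at `y`, as an endomorphism of the model space. -/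
def chartSymmDeriv (e : OpenPartialHomeomorph M (EuclideanSpace ℝ (Fin n)))
    (y : EuclideanSpace ℝ (Fin n)) : EuclideanSpace ℝ (Fin n) →L[ℝ] EuclideanSpace ℝ (Fin n) :=
  mfderiv (𝓡 n) (𝓡 n) e.symm y

theorem coordVec_eq (i : Fin n) (q : M) :
    coordVec e i q = chartSymmDeriv e (e q) (EuclideanSpace.single i 1) := rfl

theorem coordVec_symm {y : EuclideanSpace ℝ (Fin n)} (hy : y ∈ e.target) (i : Fin n) :
    (coordVec e i (e.symm y) : EuclideanSpace ℝ (Fin n)) =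
      chartSymmDeriv e y (EuclideanSpace.single i 1) := by
  rw [coordVec_eq, e.right_inv hy]

theorem coordCovec_apply (he : e ∈ IsManifold.maximalAtlas (𝓡 n) ∞ M) {q : M} (hq : q ∈ e.source)
    (i : Fin n) (w : TangentSpace (𝓡 n) q) :
    coordCovec e i q w = (chartDeriv e q w) i := by
  have h := ((mdifferentiable_of_mem_maximalAtlas he).mdifferentiableAt hq).hasMFDerivAt
  have hp : HasMFDerivAt (𝓡 n) 𝓘(ℝ, ℝ) (fun y : EuclideanSpace ℝ (Fin n) => y i) (e q)
      (EuclideanSpace.proj i : EuclideanSpace ℝ (Fin n) →L[ℝ] ℝ) :=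
    (EuclideanSpace.proj i : EuclideanSpace ℝ (Fin n) →L[ℝ] ℝ).hasMFDerivAt
  have := (hp.comp q h).mfderiv
  exact DFunLike.congr_fun this w

theorem chartSymmDeriv_chartDeriv (he : e ∈ IsManifold.maximalAtlas (𝓡 n) ∞ M) {q : M}
    (hq : q ∈ e.source) (w : EuclideanSpace ℝ (Fin n)) :
    chartSymmDeriv e (e q) (chartDeriv e q w) = w :=
  DFunLike.congr_fun ((mdifferentiable_of_mem_maximalAtlas he).symm_comp_deriv hq) w

theorem eq_sum_coordVec (he : e ∈ IsManifold.maximalAtlas (𝓡 n) ∞ M) {q : M} (hq : q ∈ e.source)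
    (w : TangentSpace (𝓡 n) q) : w = ∑ i, coordCovec e i q w • coordVec e i q := by
  have h := congrArg (chartSymmDeriv e (e q)) (eq_sum_single (chartDeriv e q w))
  simp only [map_sum, map_smul] at h
  simp only [coordCovec_apply he hq]
  exact (chartSymmDeriv_chartDeriv he hq w).symm.trans h

theorem covec_eq_sum (he : e ∈ IsManifold.maximalAtlas (𝓡 n) ∞ M) {q : M} (hq : q ∈ e.source)
    (b : TangentSpace (𝓡 n) q →L[ℝ] ℝ) (w : TangentSpace (𝓡 n) q) :
    b w = ∑ i, coordCovec e i q w * b (coordVec e i q) := by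
  conv_lhs => rw [eq_sum_coordVec he hq w]
  rw [map_sum]
  simp only [map_smul, smul_eq_mul]

theorem covec_eq_sum_coordCovec (he : e ∈ IsManifold.maximalAtlas (𝓡 n) ∞ M) {q : M}
    (hq : q ∈ e.source) (b : TangentSpace (𝓡 n) q →L[ℝ] ℝ) :
    b = ∑ i, b (coordVec e i q) • coordCovec e i q := by
  ext w
  rw [covec_eq_sum he hq b w, _root_.sum_apply]
  simp only [_root_.smul_apply, smul_eq_mul, mul_comm]

theorem fderiv_comp_symm (he : e ∈ IsManifold.maximalAtlas (𝓡 n) ∞ M) {f : M → ℝ}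
    {y : EuclideanSpace ℝ (Fin n)} (hy : y ∈ e.target)
    (hf : MDifferentiableAt (𝓡 n) 𝓘(ℝ, ℝ) f (e.symm y)) (i : Fin n) :
    fderiv ℝ (fun y => f (e.symm y)) y (EuclideanSpace.single i 1) =
      dAt (𝓡 n) f (e.symm y) (coordVec e i (e.symm y)) := by
  have h := hf.hasMFDerivAt.comp y
    ((mdifferentiable_of_mem_maximalAtlas he).mdifferentiableAt_symm hy).hasMFDerivAt
  have h1 : HasFDerivAt (fun y => f (e.symm y))
      ((dAt (𝓡 n) f (e.symm y) : EuclideanSpace ℝ (Fin n) →L[ℝ] ℝ).comp (chartSymmDeriv e y)) y :=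
    hasMFDerivAt_iff_hasFDerivAt.1 h
  rw [h1.fderiv]
  have h2 := coordVec_symm hy i
  exact congrArg (fun z : EuclideanSpace ℝ (Fin n) => dAt (𝓡 n) f (e.symm y) z) h2.symm

end Frames

/-! ### Alternating 2-forms -/

section TwoForms

variable {V : Type*} [NormedAddCommGroup V] [NormedSpace ℝ V]

/-- The contraction of a 2-form with a vector, `contract η u v = η ![u, v]`. -/
def contract (η : V [⋀^Fin 2]→L[ℝ] ℝ) :
    V →L[ℝ] V →L[ℝ] ℝ :=
  (ContinuousAlternatingMap.ofSubsingletonLIE (𝕜 := ℝ) (E := V) (F := ℝ)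
    (0 : Fin 1)).symm.toContinuousLinearEquiv.toContinuousLinearMap.comp
      (ContinuousAlternatingMap.curryLeft (n := 1) η)

theorem contract_apply (η : V [⋀^Fin 2]→L[ℝ] ℝ) (u v : V) : contract η u v = η ![u, v] := by
  change η (Matrix.vecCons u fun _ => v) = _
  congr 1
  ext i
  fin_cases i <;> rfl

theorem twoForm_sum {ι : Type*} [Fintype ι] (η : V [⋀^Fin 2]→L[ℝ] ℝ) (X : ι → V) (c d : ι → ℝ) :
    η ![∑ m, c m • X m, ∑ j, d j • X j] = ∑ m, ∑ j, c m * (d j * η ![X m, X j]) := by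
  rw [← contract_apply]
  simp only [map_sum, map_smul, _root_.sum_apply, _root_.smul_apply, smul_eq_mul,
    Finset.mul_sum, contract_apply]
  rw [Finset.sum_comm]
  exact Finset.sum_congr rfl fun p _ => Finset.sum_congr rfl fun r _ => by ring

theorem twoForm_swap (η : V [⋀^Fin 2]→L[ℝ] ℝ) (u v : V) : η ![v, u] = -η ![u, v] := by
  have h : η ![u + v, u + v] = 0 := η.map_eq_zero_of_eq _ (i := 0) (j := 1) rfl (by decide)
  have h0 : ∀ w, η ![w, w] = 0 := fun w =>
    η.map_eq_zero_of_eq _ (i := 0) (j := 1) rfl (by decide)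
  simp only [← contract_apply, map_add, _root_.add_apply] at h h0 ⊢
  linarith [h0 u, h0 v]

end TwoForms

theorem exists_eq_sum_of_finrank_eq {D : Type*} [AddCommGroup D] [Module ℝ D]
    [FiniteDimensional ℝ D] {k : ℕ} {N : Submodule ℝ D} (hN : Module.finrank ℝ N = k)
    {c : Fin k → D} (hc : LinearIndependent ℝ c) (hcN : ∀ K, c K ∈ N) {x : D} (hx : x ∈ N) :
    ∃ m : Fin k → ℝ, x = ∑ K, m K • c K := by
  have hli : LinearIndependent ℝ (fun K => (⟨c K, hcN K⟩ : N)) :=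
    LinearIndependent.of_comp N.subtype hc
  have hspan := hli.span_eq_top_of_card_eq_finrank' (by simp [hN])
  have hx' : (⟨x, hx⟩ : N) ∈ Submodule.span ℝ (Set.range fun K => (⟨c K, hcN K⟩ : N)) := by
    rw [hspan]; trivial
  obtain ⟨m, hm⟩ := (Submodule.mem_span_range_iff_exists_fun ℝ).1 hx'
  refine ⟨m, ?_⟩
  have := congrArg N.subtype hm
  simpa using this.symm

/-! ### Linear algebra along the leaf -/

section Leaf

variable {n k : ℕ} {M : Type*} [TopologicalSpace M] [ChartedSpace (EuclideanSpace ℝ (Fin n)) M]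

/-- A neighbourhood `U` of `L` with a compatible presymplectic form and independent Casimir
functions, as many as the corank, that cut out `L`. -/
structure IsLeafModel (P : PoissonStructure n M) (L U : Set M) (Ω : DForm (𝓡 n) M 2)
    (C : Fin k → M → ℝ) : Prop where
  isOpen : IsOpen U
  presymplectic : P.IsCompatiblePresymplectic U Ω
  casimir : ∀ K, P.IsCasimirOn U (C K)
  zeroSet : L = {q | q ∈ U ∧ ∀ K, C K q = 0}
  independent : ∀ q ∈ L, LinearIndependent ℝ fun K => dAt (𝓡 n) (C K) q
  corank : ∀ q ∈ L, Module.finrank ℝ (P.bivector q).ker = k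

namespace PoissonStructure

variable (P : PoissonStructure n M)

theorem bivector_swap (q : M) (a b : TangentSpace (𝓡 n) q →L[ℝ] ℝ) :
    P.bivector q b a = -P.bivector q a b := by
  have h := P.alternating q (a + b)
  simp only [map_add, _root_.add_apply, P.alternating] at h
  linarith

theorem exists_isSharp [IsManifold (𝓡 n) ∞ M] (q : M) (a : TangentSpace (𝓡 n) q →L[ℝ] ℝ) :
    ∃ u, P.IsSharp q a u := by
  have he : chartAt (EuclideanSpace ℝ (Fin n)) q ∈ IsManifold.maximalAtlas (𝓡 n) ∞ M :=
    IsManifold.chart_mem_maximalAtlas q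
  refine ⟨∑ i, P.bivector q (coordCovec (chartAt _ q) i q) a • coordVec (chartAt _ q) i q,
    fun b => ?_⟩
  conv_rhs => rw [covec_eq_sum_coordCovec he (mem_chart_source _ q) b]
  simp only [map_sum, map_smul, _root_.sum_apply, _root_.smul_apply, smul_eq_mul, mul_comm]

end PoissonStructure

namespace IsLeafModel

variable {P : PoissonStructure n M} {L U : Set M} {Ω : DForm (𝓡 n) M 2} {C : Fin k → M → ℝ}

theorem mem_open (h : IsLeafModel P L U Ω C) {q : M} (hq : q ∈ L) : q ∈ U := by
  rw [h.zeroSet] at hq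
  exact hq.1

theorem exists_coefficients (h : IsLeafModel P L U Ω C) {q : M} (hq : q ∈ L)
    (x : TangentSpace (𝓡 n) q →L[ℝ] ℝ) (hx : P.bivector q x = 0) :
    ∃ m : Fin k → ℝ, x = ∑ K, m K • dAt (𝓡 n) (C K) q := by
  have hmem : ∀ K, dAt (𝓡 n) (C K) q ∈ (P.bivector q).ker := fun K =>
    LinearMap.mem_ker.2 (ContinuousLinearMap.ext fun b =>
      (h.casimir K).casimir q (h.mem_open hq) b)
  have : FiniteDimensional ℝ (TangentSpace (𝓡 n) q →L[ℝ] ℝ) :=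
    inferInstanceAs (FiniteDimensional ℝ (EuclideanSpace ℝ (Fin n) →L[ℝ] ℝ))
  exact exists_eq_sum_of_finrank_eq (h.corank q hq)
    (h.independent q hq) hmem (LinearMap.mem_ker.2 hx)

/-- The image of `P♯` is the common kernel of the differentials of the Casimir functions, since
these span the kernel of `P♯`. -/
theorem exists_isSharp_of_casimir (h : IsLeafModel P L U Ω C) {q : M} (hq : q ∈ L)
    (u : TangentSpace (𝓡 n) q) (hu : ∀ K, dAt (𝓡 n) (C K) q u = 0) :
    ∃ a, P.IsSharp q a u := by
  have : FiniteDimensional ℝ (TangentSpace (𝓡 n) q →L[ℝ] ℝ) :=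
    inferInstanceAs (FiniteDimensional ℝ (EuclideanSpace ℝ (Fin n) →L[ℝ] ℝ))
  set D := TangentSpace (𝓡 n) q →L[ℝ] ℝ
  let f : D →ₗ[ℝ] Module.Dual ℝ D :=
    LinearMap.mk₂ ℝ (fun b a => P.bivector q b a) (by simp) (by simp) (by simp) (by simp)
  let φ : Module.Dual ℝ D :=
    { toFun := fun b => b u, map_add' := fun _ _ => rfl, map_smul' := fun _ _ => rfl }
  have hφ : φ ∈ (LinearMap.ker f).dualAnnihilator := by
    rw [Submodule.mem_dualAnnihilator]
    intro b hb
    obtain ⟨m, hm⟩ := h.exists_coefficients hq b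
      (ContinuousLinearMap.ext fun a => LinearMap.congr_fun (LinearMap.mem_ker.1 hb) a)
    change b u = 0
    rw [hm, _root_.sum_apply]
    exact Finset.sum_eq_zero fun K _ => by rw [_root_.smul_apply, hu K, smul_zero]
  rw [← LinearMap.range_dualMap_eq_dualAnnihilator_ker] at hφ
  obtain ⟨ξ, hξ⟩ := hφ
  refine ⟨(Module.evalEquiv ℝ D).symm ξ, fun b => ?_⟩
  have h1 : f.dualMap ξ b = b u := LinearMap.congr_fun hξ b
  rw [← h1, LinearMap.dualMap_apply]
  exact (Module.apply_evalEquiv_symm_apply ℝ D (f b) ξ).symm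

/-- The pointwise form of the decomposition: `x` with `P♯ x = -u` differs from `-Ω(·, u)` by an
element of the kernel of `P`, which the differentials of the Casimir functions span. -/
theorem exists_decomposition [IsManifold (𝓡 n) ∞ M] (h : IsLeafModel P L U Ω C) {q : M}
    (hq : q ∈ L) (u : TangentSpace (𝓡 n) q) (x : TangentSpace (𝓡 n) q →L[ℝ] ℝ)
    (hux : ∀ b : TangentSpace (𝓡 n) q →L[ℝ] ℝ, b u + P.bivector q b x = 0) :
    ∃ m : Fin k → ℝ, ∀ w, x w = -Ω q ![w, u] + ∑ K, m K * dAt (𝓡 n) (C K) q w := by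
  let ι₀ : EuclideanSpace ℝ (Fin n) →L[ℝ] ℝ :=
    (contract (V := EuclideanSpace ℝ (Fin n)) (Ω q)).flip u
  let ι : TangentSpace (𝓡 n) q →L[ℝ] ℝ := ι₀
  have hι : ∀ w, ι w = Ω q ![w, u] := fun w => contract_apply _ _ _
  have hu : P.IsSharp q (-x) u := fun b => by
    rw [map_neg]; linarith [hux b]
  obtain ⟨m, hm⟩ := h.exists_coefficients hq (x + ι) (by
    ext b
    obtain ⟨w, hw⟩ := P.exists_isSharp q b
    have h1 := h.presymplectic.compatible q (h.mem_open hq) b (-x) w u hw hu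
    have h2 := hw (x + ι)
    have h3 := hw x
    rw [_root_.add_apply, hι, h1] at h2
    rw [map_neg, _root_.neg_apply] at h2
    rw [← h2, h3]
    simp)
  refine ⟨m, fun w => ?_⟩
  have h4 := DFunLike.congr_fun hm w
  rw [_root_.add_apply, hι, _root_.sum_apply] at h4
  simp only [_root_.smul_apply, smul_eq_mul] at h4
  linarith

theorem coefficients_unique (h : IsLeafModel P L U Ω C) {q : M} (hq : q ∈ L) {m m' : Fin k → ℝ}
    (hm : ∀ w, ∑ K, m K * dAt (𝓡 n) (C K) q w = ∑ K, m' K * dAt (𝓡 n) (C K) q w) : m = m' := by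
  have hli := Fintype.linearIndependent_iff.1 (h.independent q hq) (m - m') (by
    ext w
    rw [_root_.sum_apply]
    simp only [_root_.smul_apply, smul_eq_mul, Pi.sub_apply, sub_mul, Finset.sum_sub_distrib, hm w,
      sub_self]
    rfl)
  exact funext fun K => sub_eq_zero.1 (hli K)

/-- The converse of `exists_decomposition`, for `u` tangent to the leaf. -/
theorem eq_X_of_decomposition [IsManifold (𝓡 n) ∞ M] (h : IsLeafModel P L U Ω C) {q : M}
    (hq : q ∈ L) (u : TangentSpace (𝓡 n) q) (hu : ∀ K, dAt (𝓡 n) (C K) q u = 0)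
    (x : TangentSpace (𝓡 n) q →L[ℝ] ℝ) (m : Fin k → ℝ)
    (hx : ∀ w, x w = -Ω q ![w, u] + ∑ K, m K * dAt (𝓡 n) (C K) q w)
    (b : TangentSpace (𝓡 n) q →L[ℝ] ℝ) : b u + P.bivector q b x = 0 := by
  obtain ⟨a, ha⟩ := h.exists_isSharp_of_casimir hq u hu
  obtain ⟨w, hw⟩ := P.exists_isSharp q b
  have hC : ∀ K, dAt (𝓡 n) (C K) q w = 0 := fun K => by
    rw [hw]; exact (h.casimir K).casimir q (h.mem_open hq) b
  have h1 := h.presymplectic.compatible q (h.mem_open hq) b a w u hw ha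
  have h2 := hx w
  simp only [hC, mul_zero, Finset.sum_const_zero, add_zero] at h2
  rw [hw x, h1] at h2
  rw [ha b, P.bivector_swap q x b, h2, P.bivector_swap q b a]
  ring

/-- In every chart the data along the leaf satisfy the identities of `LocalModel`. Smoothness and
closedness of `Ω` are stated in the preferred chart at `q`, and carried over to the chart `e` by
pullback along the transition map. -/
theorem localModel [IsManifold (𝓡 n) ∞ M] (h : IsLeafModel P L U Ω C)
    {e : OpenPartialHomeomorph M (EuclideanSpace ℝ (Fin n))}
    (he : e ∈ IsManifold.maximalAtlas (𝓡 n) ∞ M) {q : M} (hq : q ∈ e.source) (hqL : q ∈ L) :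
    LocalModel (P.bivector.comp e)
      (fun i j y => Ω (e.symm y) ![coordVec e i (e.symm y), coordVec e j (e.symm y)])
      (fun K y => C K (e.symm y)) (e q) := by
  have hqt : e q ∈ e.target := e.map_source hq
  have hqU := h.mem_open hqL
  have htar : ∀ᶠ y in 𝓝 (e q), y ∈ e.target := e.open_target.mem_nhds hqt
  have hU : ∀ᶠ y in 𝓝 (e q), e.symm y ∈ U := by
    refine (e.continuousAt_symm hqt).eventually_mem (h.isOpen.mem_nhds ?_)
    rwa [e.left_inv hq]
  -- the form in the coordinates `e` is the pullback of the form in the preferred coordinates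
  let φ := chartAt (EuclideanSpace ℝ (Fin n)) q
  have hφ : φ ∈ IsManifold.maximalAtlas (𝓡 n) ∞ M := IsManifold.chart_mem_maximalAtlas q
  have hqφ : q ∈ φ.source := mem_chart_source _ q
  let τ : EuclideanSpace ℝ (Fin n) → EuclideanSpace ℝ (Fin n) := fun y => φ (e.symm y)
  have hτq : τ (e q) = φ q := by simp only [τ, e.left_inv hq]
  have hsrc : ∀ᶠ y in 𝓝 (e q), e.symm y ∈ φ.source := by
    refine (e.continuousAt_symm hqt).eventually_mem (φ.open_source.mem_nhds ?_)
    rwa [e.left_inv hq]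
  have hτ : ContDiffAt ℝ ∞ τ (e q) := by
    refine ContMDiffAt.contDiffAt ?_
    refine ContMDiffAt.comp (e q) (contMDiffAt_of_mem_maximalAtlas hφ ?_)
      (contMDiffAt_symm_of_mem_maximalAtlas he hqt)
    rwa [e.left_inv hq]
  let Ω' : M → EuclideanSpace ℝ (Fin n) [⋀^Fin 2]→L[ℝ] ℝ := Ω
  let G : EuclideanSpace ℝ (Fin n) → EuclideanSpace ℝ (Fin n) [⋀^Fin 2]→L[ℝ] ℝ := Ω.inChart q
  have hG : ∀ y, G y = (Ω' (φ.symm y)).compContinuousLinearMap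
      (chartSymmDeriv φ y) := by
    intro y
    simp only [G, DForm.inChart, chartSymmDeriv, modelWithCornersSelf_coe, Set.range_id,
      mfderivWithin_univ]
    rfl
  have hGs : ContDiffAt ℝ ∞ G (τ (e q)) := by
    have := h.presymplectic.smooth q hqU
    unfold DForm.SmoothAt at this
    rw [hτq]
    exact contDiffWithinAt_univ.1 (by simpa using this)
  have hGd : extDeriv G (τ (e q)) = 0 := by
    have := h.presymplectic.closed q hqU
    unfold DForm.d at this
    rw [hτq, ← extDerivWithin_univ]
    simp only [modelWithCornersSelf_coe, Set.range_id] at this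
    exact this
  have hτd : ∀ᶠ y in 𝓝 (e q), ∀ v, chartSymmDeriv φ (τ y) (fderiv ℝ τ y v) =
      chartSymmDeriv e y v := by
    filter_upwards [htar, hsrc] with y hy hys v
    have h1 : HasFDerivAt τ ((chartDeriv φ (e.symm y)).comp (chartSymmDeriv e y)) y :=
      hasMFDerivAt_iff_hasFDerivAt.1 (HasMFDerivAt.comp y
        ((mdifferentiable_of_mem_maximalAtlas hφ).mdifferentiableAt hys).hasMFDerivAt
        ((mdifferentiable_of_mem_maximalAtlas he).mdifferentiableAt_symm hy).hasMFDerivAt)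
    rw [h1.fderiv]
    exact chartSymmDeriv_chartDeriv hφ hys _
  have hpull : ∀ᶠ y in 𝓝 (e q), ∀ u v, Ω' (e.symm y) ![chartSymmDeriv e y u, chartSymmDeriv e y v] =
      (G (τ y)).compContinuousLinearMap (fderiv ℝ τ y) ![u, v] := by
    filter_upwards [hτd, hsrc] with y hy hys u v
    rw [hG, ContinuousAlternatingMap.compContinuousLinearMap_apply,
      ContinuousAlternatingMap.compContinuousLinearMap_apply]
    have : φ.symm (τ y) = e.symm y := φ.left_inv hys
    rw [this]
    congr 1
    ext i
    fin_cases i <;> simp [hy]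
  let W : Fin n → Fin n → EuclideanSpace ℝ (Fin n) → ℝ := fun i j y =>
    Ω (e.symm y) ![coordVec e i (e.symm y), coordVec e j (e.symm y)]
  have hW : ∀ i j, W i j =ᶠ[𝓝 (e q)] fun y => (G (τ y)).compContinuousLinearMap (fderiv ℝ τ y)
      ![EuclideanSpace.single i 1, EuclideanSpace.single j 1] := by
    intro i j
    filter_upwards [hpull, htar] with y hy hyt
    rw [← hy, ← coordVec_symm hyt, ← coordVec_symm hyt]
    rfl
  have hGτ : ContDiffAt ℝ ∞ (fun y => G (τ y)) (e q) := hGs.comp (e q) hτ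
  have hdτ : ContDiffAt ℝ ∞ (fderiv ℝ τ) (e q) := hτ.fderiv_right (m := ∞) (by simp)
  have hpd : DifferentiableAt ℝ (fun y => (G (τ y)).compContinuousLinearMap (fderiv ℝ τ y)) (e q) :=
    (hGτ.differentiableAt (by simp)).continuousAlternatingMapCompContinuousLinearMap
      (hdτ.differentiableAt (by simp))
  refine ⟨?_, ?_, ?_, ?_, ?_, ?_, ?_, ?_, ?_⟩
  · exact fun i j => (P.smooth e he i j).contDiffAt (e.open_target.mem_nhds hqt)
  · intro i j
    refine ContDiffAt.congr_of_eventuallyEq ?_ (hW i j)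
    have hexp : ∀ y, (G (τ y)).compContinuousLinearMap (fderiv ℝ τ y)
        ![EuclideanSpace.single i 1, EuclideanSpace.single j 1] =
        ∑ p, ∑ r, (fderiv ℝ τ y (EuclideanSpace.single i 1)) p *
          ((fderiv ℝ τ y (EuclideanSpace.single j 1)) r *
            G (τ y) ![EuclideanSpace.single p 1, EuclideanSpace.single r 1]) := by
      intro y
      have h1 : (G (τ y)).compContinuousLinearMap (fderiv ℝ τ y)
          ![EuclideanSpace.single i 1, EuclideanSpace.single j 1] =
          contract (G (τ y)) (fderiv ℝ τ y (EuclideanSpace.single i 1))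
            (fderiv ℝ τ y (EuclideanSpace.single j 1)) := by
        rw [ContinuousAlternatingMap.compContinuousLinearMap_apply, contract_apply]
        congr 1
        ext i
        fin_cases i <;> rfl
      rw [h1]
      conv_lhs => rw [eq_sum_single (fderiv ℝ τ y (EuclideanSpace.single i 1)),
        eq_sum_single (fderiv ℝ τ y (EuclideanSpace.single j 1))]
      exact (contract_apply _ _ _).trans <|
        twoForm_sum (G (τ y)) (fun p => EuclideanSpace.single p 1) _ _
    simp only [hexp]
    have hcoord : ∀ (i p : Fin n), ContDiffAt ℝ ∞
        (fun y => (fderiv ℝ τ y (EuclideanSpace.single i 1)) p) (e q) := fun i p =>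
      (EuclideanSpace.proj p : EuclideanSpace ℝ (Fin n) →L[ℝ] ℝ).contDiff.contDiffAt.comp (e q)
        (hdτ.clm_apply contDiffAt_const)
    refine ContDiffAt.sum fun p _ => ContDiffAt.sum fun r _ => (hcoord i p).mul
      ((hcoord j r).mul ?_)
    exact (ContinuousAlternatingMap.apply ℝ (EuclideanSpace ℝ (Fin n)) ℝ
      ![EuclideanSpace.single p 1, EuclideanSpace.single r 1]).contDiff.contDiffAt.comp (e q) hGτ
  · intro K
    have h1 : ContMDiffAt (𝓡 n) 𝓘(ℝ, ℝ) ∞ (C K) (e.symm (e q)) := by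
      rw [e.left_inv hq]
      exact (h.casimir K).smooth.contMDiffAt (h.isOpen.mem_nhds hqU)
    exact (h1.comp (e q) (contMDiffAt_symm_of_mem_maximalAtlas he hqt)).contDiffAt
  · exact fun i j => Eventually.of_forall fun y => P.bivector_swap _ _ _
  · exact fun i j => Eventually.of_forall fun y =>
      twoForm_swap (V := EuclideanSpace ℝ (Fin n)) (Ω (e.symm y)) _ _
  · intro i l
    filter_upwards [htar, hU] with y hyt hyU
    have hys : e.symm y ∈ e.source := e.map_target hyt
    have hsh : ∀ l, P.IsSharp (e.symm y) (coordCovec e l (e.symm y))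
        (∑ m, P.bivector.comp e m l y • coordVec e m (e.symm y)) := by
      intro l b
      conv_rhs => rw [covec_eq_sum_coordCovec he hys b]
      simp only [map_sum, map_smul, _root_.sum_apply, _root_.smul_apply, smul_eq_mul]
      exact Finset.sum_congr rfl fun m _ => mul_comm _ _
    have h1 := h.presymplectic.compatible (e.symm y) hyU _ _ _ _ (hsh l) (hsh i)
    have h2 := (twoForm_sum (V := EuclideanSpace ℝ (Fin n)) (Ω (e.symm y))
      (fun m => coordVec e m (e.symm y)) (fun m => P.bivector.comp e m l y)
      (fun j => P.bivector.comp e j i y)).symm.trans h1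
    change _ = P.bivector.comp e i l y at h2
    rw [← h2]
    refine Finset.sum_congr rfl fun m _ => ?_
    rw [Finset.sum_mul]
    refine Finset.sum_congr rfl fun j _ => ?_
    have e1 : P.bivector.comp e j i y = -P.bivector.comp e i j y := P.bivector_swap _ _ _
    have e2 := twoForm_swap (V := EuclideanSpace ℝ (Fin n)) (Ω (e.symm y))
      (coordVec e m (e.symm y)) (coordVec e j (e.symm y))
    rw [e1]
    have aux : ∀ p r w w' : ℝ, w' = -w → p * w' * r = r * (-p * w) := fun p r w w' h => by
      rw [h]; ring
    exact aux _ _ _ _ e2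
  · intro K i
    filter_upwards [htar, hU] with y hyt hyU
    have hys : e.symm y ∈ e.source := e.map_target hyt
    have hd : MDifferentiableAt (𝓡 n) 𝓘(ℝ, ℝ) (C K) (e.symm y) :=
      ((h.casimir K).smooth.contMDiffAt (h.isOpen.mem_nhds hyU)).mdifferentiableAt (by simp)
    have h1 := (h.casimir K).casimir (e.symm y) hyU (coordCovec e i (e.symm y))
    rw [P.bivector_swap, neg_eq_zero, covec_eq_sum_coordCovec he hys (dAt (𝓡 n) (C K) (e.symm y)),
      map_sum] at h1
    simp only [fderiv_comp_symm he hyt hd]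
    rw [← h1]
    refine Finset.sum_congr rfl fun l _ => ?_
    rw [map_smul, smul_eq_mul, mul_comm]
    rfl
  · intro i m j
    have h1 : extDeriv (fun y => (G (τ y)).compContinuousLinearMap (fderiv ℝ τ y)) (e q) = 0 := by
      rw [extDeriv_pullback (hGs.differentiableAt (by simp)) hτ (by simpa using two_le_infty), hGd]
      ext v
      rfl
    have h2 := DFunLike.congr_fun h1 ![EuclideanSpace.single i 1, EuclideanSpace.single m 1,
      EuclideanSpace.single j 1]
    rw [extDeriv_apply hpd, Fin.sum_univ_three] at h2
    have r0 : Fin.removeNth 0 ![EuclideanSpace.single i (1 : ℝ), EuclideanSpace.single m 1,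
      EuclideanSpace.single j 1] = ![EuclideanSpace.single m 1, EuclideanSpace.single j 1] := by
      ext i; fin_cases i <;> rfl
    have r1 : Fin.removeNth 1 ![EuclideanSpace.single i (1 : ℝ), EuclideanSpace.single m 1,
      EuclideanSpace.single j 1] = ![EuclideanSpace.single i 1, EuclideanSpace.single j 1] := by
      ext i; fin_cases i <;> rfl
    have r2 : Fin.removeNth 2 ![EuclideanSpace.single i (1 : ℝ), EuclideanSpace.single m 1,
      EuclideanSpace.single j 1] = ![EuclideanSpace.single i 1, EuclideanSpace.single m 1] := by
      ext i; fin_cases i <;> rfl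
    rw [r0, r1, r2, ← (hW m j).fderiv_eq, ← (hW i j).fderiv_eq, ← (hW i m).fderiv_eq] at h2
    have hsk : fderiv ℝ (W j i) (e q) = -fderiv ℝ (W i j) (e q) := by
      have : W j i = fun y => -W i j y := funext fun y =>
        twoForm_swap (V := EuclideanSpace ℝ (Fin n)) (Ω (e.symm y)) _ _
      rw [this, fderiv_fun_neg]
    have hsk' := DFunLike.congr_fun hsk (EuclideanSpace.single m (1 : ℝ))
    rw [_root_.neg_apply] at hsk'
    simp at h2
    change fderiv ℝ (W m j) (e q) _ + fderiv ℝ (W j i) (e q) _ + fderiv ℝ (W i m) (e q) _ = 0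
    rw [hsk']
    linarith
  · have hd : ∀ K, MDifferentiableAt (𝓡 n) 𝓘(ℝ, ℝ) (C K) (e.symm (e q)) := fun K => by
      rw [e.left_inv hq]
      exact ((h.casimir K).smooth.contMDiffAt (h.isOpen.mem_nhds hqU)).mdifferentiableAt (by simp)
    have h1 : ∀ K i, fderiv ℝ (fun y => C K (e.symm y)) (e q) (EuclideanSpace.single i 1) =
        dAt (𝓡 n) (C K) q (coordVec e i q) := fun K i => by
      rw [fderiv_comp_symm he hqt (hd K), e.left_inv hq]
    simp only [h1]
    rw [Fintype.linearIndependent_iff]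
    intro g hg
    refine Fintype.linearIndependent_iff.1 (h.independent q hqL) g ?_
    have h2 : ∀ i, (∑ K, g K • dAt (𝓡 n) (C K) q) (coordVec e i q) = 0 := fun i => by
      have := congrFun hg i
      rw [_root_.sum_apply]
      simpa using this
    ext w
    rw [covec_eq_sum he hq]
    simp only [h2, mul_zero, Finset.sum_const_zero]
    rfl

end IsLeafModel

end Leaf

/-! ### 1-forms on the worldsheet in charts -/

section OneForms

variable {E H : Type*} [NormedAddCommGroup E] [NormedSpace ℝ E] [TopologicalSpace H]
  {I : ModelWithCorners ℝ E H} {S : Type*} [TopologicalSpace S] [ChartedSpace H S]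

/-- A 1-form in the preferred chart at `p`, with values in the dual of the model space. -/
def DForm.chartCov (η : DForm I S 1) (p : S) (z : E) : E →L[ℝ] ℝ :=
  (ContinuousAlternatingMap.ofSubsingletonLIE (𝕜 := ℝ) (E := E) (F := ℝ) (0 : Fin 1)).symm
    (η.inChart p z)

theorem DForm.chartCov_apply (η : DForm I S 1) (p : S) (z v : E) :
    η.chartCov p z v = η ((extChartAt I p).symm z)
      ![mfderivWithin 𝓘(ℝ, E) I (extChartAt I p).symm (Set.range I) z v] := by
  change η ((extChartAt I p).symm z) _ = _
  congr 1
  ext i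
  fin_cases i
  rfl

theorem DForm.smoothAt_iff (η : DForm I S 1) (p : S) :
    η.SmoothAt p ↔ ContDiffWithinAt ℝ ∞ (η.chartCov p) (Set.range I) (extChartAt I p p) :=
  ((ContinuousAlternatingMap.ofSubsingletonLIE (𝕜 := ℝ) (E := E)
    (F := ℝ) (0 : Fin 1)).symm.toContinuousLinearEquiv.comp_contDiffWithinAt_iff).symm

/-- At the base point the preferred chart identifies the tangent space with the model space, so that
the 1-form in the chart has the same values there. -/
theorem DForm.chartCov_self [IsManifold I ∞ S] (η : DForm I S 1) (p : S) (v : TangentSpace I p) :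
    η.chartCov p (extChartAt I p p) v = η p ![v] := by
  refine (chartCov_apply η p _ v).trans ?_
  rw [mfderivWithin_range_extChartAt_symm]
  let η' : S → E [⋀^Fin 1]→L[ℝ] ℝ := η
  change η' ((extChartAt I p).symm (extChartAt I p p)) ![v] = η' p ![v]
  rw [extChartAt_to_inv]

theorem DForm.d_apply {η : DForm I S 1} {p : S} (hη : η.SmoothAt p) (v w : TangentSpace I p) :
    η.d p ![v, w] = curl (Set.range I) (η.chartCov p) (extChartAt I p p) v w := by
  have hd : DifferentiableWithinAt ℝ (η.inChart p) (Set.range I) (extChartAt I p p) :=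
    hη.differentiableWithinAt (by simp)
  have hu : UniqueDiffWithinAt ℝ (Set.range I) (extChartAt I p p) :=
    I.uniqueDiffOn _ (Set.mem_range_self _)
  let Λ := (ContinuousAlternatingMap.ofSubsingletonLIE (𝕜 := ℝ) (E := E)
    (F := ℝ) (0 : Fin 1)).symm.toContinuousLinearEquiv
  have h1 : HasFDerivWithinAt (η.chartCov p) (Λ.toContinuousLinearMap.comp
      (fderivWithin ℝ (η.inChart p) (Set.range I) (extChartAt I p p)))
      (Set.range I) (extChartAt I p p) :=
    Λ.toContinuousLinearMap.hasFDerivAt.comp_hasFDerivWithinAt _ hd.hasFDerivWithinAt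
  unfold curl
  rw [h1.fderivWithin hu]
  change extDerivWithin (η.inChart p) (Set.range I) (extChartAt I p p) (![v, w] : Fin 2 → E) = _
  rw [extDerivWithin, ContinuousAlternatingMap.alternatizeUncurryFin_apply, Fin.sum_univ_two]
  have e0 : Fin.removeNth 0 (![v, w] : Fin 2 → E) = fun _ => w := by ext i; fin_cases i; rfl
  have e1 : Fin.removeNth 1 (![v, w] : Fin 2 → E) = fun _ => v := by ext i; fin_cases i; rfl
  rw [e0, e1]
  simp only [Fin.val_zero, pow_zero, one_smul, Fin.val_one, pow_one, neg_smul]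
  rw [← sub_eq_add_neg]
  rfl

theorem DForm.d_eq_zero_iff {η : DForm I S 1} {p : S} (hη : η.SmoothAt p) :
    η.d p = 0 ↔ ∀ v w, curl (Set.range I) (η.chartCov p) (extChartAt I p p) v w = 0 := by
  constructor
  · intro h v w
    rw [← η.d_apply hη v w, h]
    rfl
  · intro h
    ext v
    have : v = ![v 0, v 1] := by ext i; fin_cases i <;> rfl
    rw [this, η.d_apply hη]
    exact h (v 0) (v 1)

end OneForms

/-! ### The decomposition in coordinates -/

section Coordinates

variable {n k : ℕ} {M : Type*} [TopologicalSpace M] [ChartedSpace (EuclideanSpace ℝ (Fin n)) M]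
  {P : PoissonStructure n M} {L U : Set M} {Ω : DForm (𝓡 n) M 2} {C : Fin k → M → ℝ}
  {e : OpenPartialHomeomorph M (EuclideanSpace ℝ (Fin n))}

namespace IsLeafModel

theorem mdifferentiableAt_casimir (h : IsLeafModel P L U Ω C) {q : M} (hq : q ∈ L) (K : Fin k) :
    MDifferentiableAt (𝓡 n) 𝓘(ℝ, ℝ) (C K) q :=
  ((h.casimir K).smooth.contMDiffAt (h.isOpen.mem_nhds (h.mem_open hq))).mdifferentiableAt (by simp)

theorem fderiv_casimir (h : IsLeafModel P L U Ω C) (he : e ∈ IsManifold.maximalAtlas (𝓡 n) ∞ M)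
    {q : M} (hq : q ∈ L) (hqe : q ∈ e.source) (K : Fin k) (i : Fin n) :
    fderiv ℝ (fun y => C K (e.symm y)) (e q) (EuclideanSpace.single i 1) =
      dAt (𝓡 n) (C K) q (coordVec e i q) := by
  rw [fderiv_comp_symm he (e.map_source hqe), e.left_inv hqe]
  rw [e.left_inv hqe]
  exact h.mdifferentiableAt_casimir hq K

theorem exists_dualVectors [IsManifold (𝓡 n) ∞ M] (h : IsLeafModel P L U Ω C) {q : M}
    (hq : q ∈ L) : ∃ w : Fin k → TangentSpace (𝓡 n) q,
      ∀ J K, dAt (𝓡 n) (C K) q (w J) = if J = K then 1 else 0 := by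
  have he : chartAt (EuclideanSpace ℝ (Fin n)) q ∈ IsManifold.maximalAtlas (𝓡 n) ∞ M :=
    IsManifold.chart_mem_maximalAtlas q
  have hqe := mem_chart_source (EuclideanSpace ℝ (Fin n)) q
  have hind := (h.localModel he hqe hq).independent
  simp only [h.fderiv_casimir he hq hqe] at hind
  obtain ⟨l, hl⟩ := exists_leftInverse_of_linearIndependent hind
  refine ⟨fun J => ∑ i, l J i • coordVec (chartAt _ q) i q, fun J K => ?_⟩
  simp only [map_sum, map_smul, smul_eq_mul]
  exact hl J K

/-- The decomposition of a covector in the chart `e`. The points are written as `e.symm (e q)` in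
the terms with `Ω` to match `IsLeafModel.localModel`. -/
theorem solutionForm_coord (h : IsLeafModel P L U Ω C)
    (he : e ∈ IsManifold.maximalAtlas (𝓡 n) ∞ M) {q : M} (hq : q ∈ L) (hqe : q ∈ e.source)
    {u : TangentSpace (𝓡 n) q} {x : TangentSpace (𝓡 n) q →L[ℝ] ℝ} {m : Fin k → ℝ}
    (hx : ∀ w, x w = -Ω q ![w, u] + ∑ K, m K * dAt (𝓡 n) (C K) q w) (i : Fin n) :
    x (coordVec e i q) = -∑ j, Ω (e.symm (e q)) ![coordVec e i (e.symm (e q)),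
        coordVec e j (e.symm (e q))] * coordCovec e j q u
      + ∑ K, m K * fderiv ℝ (fun y => C K (e.symm y)) (e q) (EuclideanSpace.single i 1) := by
  rw [hx]
  simp only [h.fderiv_casimir he hq hqe]
  rw [e.left_inv hqe]
  congr 2
  have h2 := congrArg (contract (V := EuclideanSpace ℝ (Fin n)) (Ω q) (coordVec e i q))
    (eq_sum_coordVec he hqe u)
  refine (contract_apply (V := EuclideanSpace ℝ (Fin n)) (Ω q) _ _).symm.trans
    ((h2.trans (map_sum (contract (V := EuclideanSpace ℝ (Fin n)) (Ω q) (coordVec e i q))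
    _ _)).trans (Finset.sum_congr rfl fun j _ => ?_))
  refine ((contract (V := EuclideanSpace ℝ (Fin n)) (Ω q) (coordVec e i q)).map_smul
    (coordCovec e j q u) (coordVec e j q)).trans ?_
  exact (mul_comm _ _).trans (congrArg (· * _) (contract_apply _ _ _))

end IsLeafModel

theorem eq_X_coord (he : e ∈ IsManifold.maximalAtlas (𝓡 n) ∞ M) {q : M} (hqe : q ∈ e.source)
    {u : TangentSpace (𝓡 n) q} {x : TangentSpace (𝓡 n) q →L[ℝ] ℝ}
    (hx : ∀ b : TangentSpace (𝓡 n) q →L[ℝ] ℝ, b u + P.bivector q b x = 0) (i : Fin n) :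
    coordCovec e i q u = -∑ j, P.bivector.comp e i j (e q) * x (coordVec e j q) := by
  rw [eq_neg_iff_add_eq_zero, ← hx (coordCovec e i q)]
  congr 1
  conv_rhs => rw [covec_eq_sum_coordCovec he hqe x]
  simp only [map_sum, map_smul, smul_eq_mul, CotBilin.comp]
  rw [e.left_inv hqe]
  exact Finset.sum_congr rfl fun j _ => mul_comm _ _

end Coordinates

/-! ### Maps into the target in charts -/

section Worldsheet

variable {E H : Type*} [NormedAddCommGroup E] [NormedSpace ℝ E] [TopologicalSpace H]
  {I : ModelWithCorners ℝ E H} {S : Type*} [TopologicalSpace S] [ChartedSpace H S]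
  {n k : ℕ} {M : Type*} [TopologicalSpace M] [ChartedSpace (EuclideanSpace ℝ (Fin n)) M]
  {P : PoissonStructure n M} {L U : Set M} {Ω : DForm (𝓡 n) M 2} {C : Fin k → M → ℝ}
  {e : OpenPartialHomeomorph M (EuclideanSpace ℝ (Fin n))} {X : S → M}

theorem eventually_mem_target (p : S) :
    ∀ᶠ z in 𝓝[Set.range I] (extChartAt I p p), z ∈ (extChartAt I p).target :=
  extChartAt_target_mem_nhdsWithin p

theorem eventually_symm_mem {s : Set S} {p : S} (hs : s ∈ 𝓝 p) :
    ∀ᶠ z in 𝓝[Set.range I] (extChartAt I p p), (extChartAt I p).symm z ∈ s := by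
  have h := continuousAt_extChartAt_symm (I := I) p
  refine (h.eventually_mem ?_).filter_mono nhdsWithin_le_nhds
  rwa [extChartAt_to_inv]

theorem contDiffWithinAt_inCharts [IsManifold I ∞ S]
    (he : e ∈ IsManifold.maximalAtlas (𝓡 n) ∞ M) (hX : ContMDiff I (𝓡 n) ∞ X)
    {p : S} (hp : X p ∈ e.source) :
    ContDiffWithinAt ℝ ∞ (fun z => e (X ((extChartAt I p).symm z))) (Set.range I)
      (extChartAt I p p) := by
  have h1 : ContMDiffWithinAt 𝓘(ℝ, E) I ∞ (extChartAt I p).symm (Set.range I) (extChartAt I p p) :=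
    contMDiffWithinAt_extChartAt_symm_range p (mem_extChartAt_target p)
  have h2 : ContMDiffAt I (𝓡 n) ∞ (fun x => e (X x))
      ((extChartAt I p).symm (extChartAt I p p)) := by
    rw [extChartAt_to_inv]
    exact (contMDiffAt_of_mem_maximalAtlas he hp).comp p (hX p)
  exact (h2.comp_contMDiffWithinAt _ h1).contDiffWithinAt

theorem fderivWithin_inCharts [IsManifold I ∞ S]
    (he : e ∈ IsManifold.maximalAtlas (𝓡 n) ∞ M) (hX : ContMDiff I (𝓡 n) ∞ X)
    {p : S} {z : E} (hz : z ∈ (extChartAt I p).target)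
    (hp : X ((extChartAt I p).symm z) ∈ e.source) (v : E) (i : Fin n) :
    (fderivWithin ℝ (fun z => e (X ((extChartAt I p).symm z))) (Set.range I) z v) i =
      coordCovec e i (X ((extChartAt I p).symm z)) (mfderiv I (𝓡 n) X ((extChartAt I p).symm z)
        (mfderivWithin 𝓘(ℝ, E) I (extChartAt I p).symm (Set.range I) z v)) := by
  have h1 : HasMFDerivWithinAt 𝓘(ℝ, E) I (extChartAt I p).symm (Set.range I) z _ :=
    (mdifferentiableWithinAt_extChartAt_symm hz).hasMFDerivWithinAt
  have h2 := ((hX ((extChartAt I p).symm z)).mdifferentiableAt (by simp)).hasMFDerivAt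
  have h3 := ((mdifferentiable_of_mem_maximalAtlas he).mdifferentiableAt hp).hasMFDerivAt
  let T : E →L[ℝ] EuclideanSpace ℝ (Fin n) := mfderiv I (𝓡 n) X ((extChartAt I p).symm z)
  let T' : E →L[ℝ] E := mfderivWithin 𝓘(ℝ, E) I (extChartAt I p).symm (Set.range I) z
  have h4 : HasFDerivWithinAt (fun z => e (X ((extChartAt I p).symm z)))
      (((chartDeriv e (X ((extChartAt I p).symm z))).comp T).comp T') (Set.range I) z :=
    hasMFDerivWithinAt_iff_hasFDerivWithinAt.1 ((h3.comp _ h2).comp_hasMFDerivWithinAt z h1)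
  rw [coordCovec_apply he hp,
    h4.fderivWithin (I.uniqueDiffOn z (extChartAt_target_subset_range p hz))]
  rfl

end Worldsheet

/-! ### Fields of the stated form -/

section Solutions

variable {E H : Type*} [NormedAddCommGroup E] [NormedSpace ℝ E] [TopologicalSpace H]
  {I : ModelWithCorners ℝ E H} {S : Type*} [TopologicalSpace S] [ChartedSpace H S]
  {n k : ℕ} {M : Type*} [TopologicalSpace M] [ChartedSpace (EuclideanSpace ℝ (Fin n)) M]
  {P : PoissonStructure n M} {L U : Set M} {Ω : DForm (𝓡 n) M 2} {C : Fin k → M → ℝ}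
  {e : OpenPartialHomeomorph M (EuclideanSpace ℝ (Fin n))} {X : S → M}

theorem Fields.chartCov_comp_apply (Φ : Fields I S n M) (i : Fin n) (p : S) (z v : E) :
    (Φ.comp e i).chartCov p z v = Φ.A ((extChartAt I p).symm z)
      (mfderivWithin 𝓘(ℝ, E) I (extChartAt I p).symm (Set.range I) z v)
      (coordVec e i (Φ.X ((extChartAt I p).symm z))) := by
  rw [DForm.chartCov_apply]
  rfl

namespace IsLeafModel

/-- The tangent vectors of a map into the leaf are annihilated by the differentials of the
Casimir functions. -/
theorem dAt_casimir_mfderiv (h : IsLeafModel P L U Ω C) (hX : ContMDiff I (𝓡 n) ∞ X)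
    (hXL : ∀ x, X x ∈ L) (x : S) (v : TangentSpace I x) (K : Fin k) :
    dAt (𝓡 n) (C K) (X x) (mfderiv I (𝓡 n) X x v) = 0 := by
  have h1 := (h.mdifferentiableAt_casimir (hXL x) K).hasMFDerivAt.comp x
    ((hX x).mdifferentiableAt (by simp)).hasMFDerivAt
  have h2 : C K ∘ X = fun _ => 0 := funext fun y => by
    have := hXL y
    rw [h.zeroSet] at this
    exact this.2 K
  rw [h2] at h1
  exact DFunLike.congr_fun (hasMFDerivAt_unique h1 (hasMFDerivAt_const 0 x)) v

/-- A field of the stated form, in a chart of the worldsheet around `p` and a chart of the target,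
is of the form that the lemmas on `LocalModel` require. -/
theorem eventually_solutionForm [IsManifold I ∞ S] (h : IsLeafModel P L U Ω C)
    (hX : ContMDiff I (𝓡 n) ∞ X) (hXL : ∀ x, X x ∈ L) {A : OneFormAlong I n X}
    {α : Fin k → DForm I S 1} (hA : HasSolutionForm X Ω C α A)
    (he : e ∈ IsManifold.maximalAtlas (𝓡 n) ∞ M) {p : S} (hp : X p ∈ e.source) (i : Fin n) :
    ∀ᶠ z in 𝓝[Set.range I] (extChartAt I p p), ∀ v,
      (Fields.comp ⟨X, A⟩ e i).chartCov p z v =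
      -∑ j, Ω (e.symm (e (X ((extChartAt I p).symm z))))
          ![coordVec e i (e.symm (e (X ((extChartAt I p).symm z)))),
            coordVec e j (e.symm (e (X ((extChartAt I p).symm z))))] *
          (fderivWithin ℝ (fun z => e (X ((extChartAt I p).symm z))) (Set.range I) z v) j
        + ∑ K, (α K).chartCov p z v * fderiv ℝ (fun y => C K (e.symm y))
          (e (X ((extChartAt I p).symm z))) (EuclideanSpace.single i 1) := by
  have hnhds : X ⁻¹' e.source ∈ 𝓝 p :=
    (hX p).continuousAt.preimage_mem_nhds (e.open_source.mem_nhds hp)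
  filter_upwards [eventually_mem_target p, eventually_symm_mem hnhds] with z hz hze v
  simp only [fderivWithin_inCharts he hX hz hze, DForm.chartCov_apply (α _)]
  rw [Fields.chartCov_comp_apply]
  exact h.solutionForm_coord he (hXL _) hze (hA _ _) i

theorem field_smooth [IsManifold I ∞ S] [IsManifold (𝓡 n) ∞ M] (h : IsLeafModel P L U Ω C)
    (hX : ContMDiff I (𝓡 n) ∞ X) (hXL : ∀ x, X x ∈ L) {A : OneFormAlong I n X}
    {α : Fin k → DForm I S 1} (hA : HasSolutionForm X Ω C α A) {p : S}
    (hα : ∀ K, (α K).SmoothAt p) (he : e ∈ IsManifold.maximalAtlas (𝓡 n) ∞ M)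
    (hp : X p ∈ e.source) (i : Fin n) : (Fields.comp ⟨X, A⟩ e i).SmoothAt p := by
  rw [DForm.smoothAt_iff]
  have hpp : X ((extChartAt I p).symm (extChartAt I p p)) = X p := by rw [extChartAt_to_inv]
  refine (h.localModel he (q := X ((extChartAt I p).symm (extChartAt I p p))) (by rwa [hpp])
    (hXL _)).contDiffWithinAt_solutionForm
      (Y := fun z => e (X ((extChartAt I p).symm z))) I.uniqueDiffOn (Set.mem_range_self _)
      (contDiffWithinAt_inCharts he hX hp) (fun K => ((α K).smoothAt_iff p).1 (hα K))
      (h.eventually_solutionForm hX hXL hA he hp i)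

theorem coefficient_smooth [IsManifold I ∞ S] [IsManifold (𝓡 n) ∞ M] (h : IsLeafModel P L U Ω C)
    (hX : ContMDiff I (𝓡 n) ∞ X) (hXL : ∀ x, X x ∈ L) {A : OneFormAlong I n X}
    {α : Fin k → DForm I S 1} (hA : HasSolutionForm X Ω C α A) {p : S}
    (he : e ∈ IsManifold.maximalAtlas (𝓡 n) ∞ M) (hp : X p ∈ e.source)
    (ha : ∀ i, (Fields.comp ⟨X, A⟩ e i).SmoothAt p) (K : Fin k) : (α K).SmoothAt p := by
  rw [DForm.smoothAt_iff]
  have hpp : X ((extChartAt I p).symm (extChartAt I p p)) = X p := by rw [extChartAt_to_inv]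
  exact (h.localModel he (q := X ((extChartAt I p).symm (extChartAt I p p))) (by rwa [hpp])
    (hXL _)).contDiffWithinAt_coefficient
      (Y := fun z => e (X ((extChartAt I p).symm z))) I.uniqueDiffOn (Set.mem_range_self _)
      (contDiffWithinAt_inCharts he hX hp) (fun i => (DForm.smoothAt_iff _ p).1 (ha i))
      (fun i => h.eventually_solutionForm hX hXL hA he hp i) K

/-- The field strength of a field of the form `-X^*(∂_i ⌟ Ω) + α_K X^*(∂_i C^K)` is
`dα_K X^*(∂_i C^K)`. -/
theorem fieldStrength [IsManifold I ∞ S] [IsManifold (𝓡 n) ∞ M] (h : IsLeafModel P L U Ω C)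
    (hX : ContMDiff I (𝓡 n) ∞ X) (hXL : ∀ x, X x ∈ L) {A : OneFormAlong I n X}
    {α : Fin k → DForm I S 1} (hA : HasSolutionForm X Ω C α A) {p : S}
    (hα : ∀ K, (α K).SmoothAt p)
    (heq : ∀ (v : TangentSpace I p) (b : TangentSpace (𝓡 n) (X p) →L[ℝ] ℝ),
      b (mfderiv I (𝓡 n) X p v) + P.bivector (X p) b (A p v) = 0)
    (he : e ∈ IsManifold.maximalAtlas (𝓡 n) ∞ M) (hp : X p ∈ e.source) (i : Fin n)
    (v w : TangentSpace I p) :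
    (Fields.comp ⟨X, A⟩ e i).d p ![v, w] + (1 / 2 : ℝ) * ∑ r, ∑ l,
        P.bivector.dcomp e r l i (X p) *
        (Fields.comp ⟨X, A⟩ e r p ![v] * Fields.comp ⟨X, A⟩ e l p ![w]
          - Fields.comp ⟨X, A⟩ e r p ![w] * Fields.comp ⟨X, A⟩ e l p ![v]) =
      ∑ K, curl (Set.range I) ((α K).chartCov p) (extChartAt I p p) v w *
        dAt (𝓡 n) (C K) (X p) (coordVec e i (X p)) := by
  have hpp : X ((extChartAt I p).symm (extChartAt I p p)) = X p := by rw [extChartAt_to_inv]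
  rw [DForm.d_apply (h.field_smooth hX hXL hA hα he hp i)]
  have hcov : ∀ (r : Fin n) (v : TangentSpace I p), Fields.comp ⟨X, A⟩ e r p ![v] =
      (Fields.comp ⟨X, A⟩ e r).chartCov p (extChartAt I p p) v := fun r v =>
    (DForm.chartCov_self _ p v).symm
  have hmain := (h.localModel he (q := X ((extChartAt I p).symm (extChartAt I p p)))
    (by rwa [hpp]) (hXL _)).curvature
      (Y := fun z => e (X ((extChartAt I p).symm z))) (a := fun i => (Fields.comp ⟨X, A⟩ e
        i).chartCov p) I.uniqueDiffOn (Set.mem_range_self _)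
      (I.range_subset_closure_interior (Set.mem_range_self _))
      (contDiffWithinAt_inCharts he hX hp) (fun K => ((α K).smoothAt_iff p).1 (hα K))
      (fun i => h.eventually_solutionForm hX hXL hA he hp i) (by
        intro v i
        rw [fderivWithin_inCharts he hX (mem_extChartAt_target p) (by rwa [hpp])]
        have h1 : ∀ j, (Fields.comp ⟨X, A⟩ e j).chartCov p (extChartAt I p p) v =
            A p v (coordVec e j (X p)) := fun j => DForm.chartCov_self _ p v
        have h2 := eq_X_coord he hp (heq v) i
        simp only [h1]
        rw [mfderivWithin_range_extChartAt_symm, extChartAt_to_inv]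
        exact h2) i v w
  simp only [hcov]
  have h3 := h.fderiv_casimir he (hXL p) hp
  rw [extChartAt_to_inv] at hmain
  simp only [h3] at hmain
  exact hmain

end IsLeafModel

end Solutions

/-! ### Solutions and closed forms -/

section Solutions

variable {E H : Type*} [NormedAddCommGroup E] [NormedSpace ℝ E] [TopologicalSpace H]
  {I : ModelWithCorners ℝ E H} {S : Type*} [TopologicalSpace S] [ChartedSpace H S]
  {n k : ℕ} {M : Type*} [TopologicalSpace M] [ChartedSpace (EuclideanSpace ℝ (Fin n)) M]
  {P : PoissonStructure n M} {L U : Set M} {Ω : DForm (𝓡 n) M 2} {C : Fin k → M → ℝ}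
  {e : OpenPartialHomeomorph M (EuclideanSpace ℝ (Fin n))} {X : S → M}

theorem DForm.ext_oneForm {η θ : DForm I S 1} {x : S} (h : ∀ v, η x ![v] = θ x ![v]) :
    η x = θ x := by
  ext v
  have : v = ![v 0] := by ext i; fin_cases i; rfl
  rw [this, h]

theorem exists_hasSolutionForm (X : S → M) (Ω : DForm (𝓡 n) M 2) (C : Fin k → M → ℝ)
    (α : Fin k → DForm I S 1) : ∃ A : OneFormAlong I n X, HasSolutionForm X Ω C α A := by
  let ι : ∀ x, EuclideanSpace ℝ (Fin n) →L[ℝ] EuclideanSpace ℝ (Fin n) →L[ℝ] ℝ := fun x =>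
    (contract (V := EuclideanSpace ℝ (Fin n)) (Ω (X x))).flip
  let T : ∀ x, E →L[ℝ] EuclideanSpace ℝ (Fin n) := fun x => mfderiv I (𝓡 n) X x
  let a : Fin k → S → E →L[ℝ] ℝ := fun K x =>
    (ContinuousAlternatingMap.ofSubsingletonLIE (𝕜 := ℝ) (E := E) (F := ℝ) (0 : Fin 1)).symm (α K x)
  let c : Fin k → S → EuclideanSpace ℝ (Fin n) →L[ℝ] ℝ := fun K x => dAt (𝓡 n) (C K) (X x)
  let A : ∀ x : S, E →L[ℝ] EuclideanSpace ℝ (Fin n) →L[ℝ] ℝ := fun x =>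
    -(ι x).comp (T x) + ∑ K, (a K x).smulRight (c K x)
  refine ⟨A, fun x v w => ?_⟩
  have ha : ∀ K, a K x v = α K x ![v] := fun K => by
    change α K x _ = _
    congr 1
    ext i
    fin_cases i
    rfl
  have h1 : ∀ v w : EuclideanSpace ℝ (Fin n), ι x v w = Ω (X x) ![w, v] := fun v w =>
    contract_apply _ _ _
  have h2 : ∀ (v : E) (w : EuclideanSpace ℝ (Fin n)),
      A x v w = -ι x (T x v) w + ∑ K, a K x v * c K x w := fun v w => by
    simp only [A, _root_.add_apply, _root_.neg_apply, _root_.sum_apply,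
      ContinuousLinearMap.comp_apply, ContinuousLinearMap.smulRight_apply, _root_.smul_apply,
      smul_eq_mul]
  refine (h2 v w).trans ?_
  simp only [ha]
  exact congrArg (fun r => -r + _) (h1 _ _)

theorem dAt_congr {f g : S → ℝ} {p : S} (h : f =ᶠ[𝓝 p] g) : dAt I f p = dAt I g p :=
  h.mfderiv_eq

theorem dAt_sum_mul {ι : Type*} [Fintype ι] {f g : ι → S → ℝ} {p : S}
    (hf : ∀ K, MDifferentiableAt I 𝓘(ℝ, ℝ) (f K) p) (hg : ∀ K, MDifferentiableAt I 𝓘(ℝ, ℝ) (g K) p)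
    (v : TangentSpace I p) : dAt I (fun x => ∑ K, f K x * g K x) p v =
      ∑ K, (dAt I (f K) p v * g K p + f K p * dAt I (g K) p v) := by
  let Df : ι → E →L[ℝ] ℝ := fun K => dAt I (f K) p
  let Dg : ι → E →L[ℝ] ℝ := fun K => dAt I (g K) p
  have h1 : ∀ K, HasMFDerivAt I 𝓘(ℝ, ℝ) (f K * g K) p
      (f K p • Dg K + g K p • Df K : E →L[ℝ] ℝ) := fun K =>
    (hf K).hasMFDerivAt.mul (hg K).hasMFDerivAt
  have h2 : ∀ s : Finset ι, HasMFDerivAt I 𝓘(ℝ, ℝ) (fun x => ∑ K ∈ s, f K x * g K x) p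
      (∑ K ∈ s, (f K p • Dg K + g K p • Df K) : E →L[ℝ] ℝ) := by
    classical
    intro s
    induction s using Finset.induction_on with
    | empty => simpa using! hasMFDerivAt_const (0 : ℝ) p
    | insert K s hK ih =>
      have h4 : (fun x => ∑ J ∈ insert K s, f J x * g J x) =
          f K * g K + fun x => ∑ J ∈ s, f J x * g J x := by
        ext x
        exact Finset.sum_insert hK
      rw [h4, Finset.sum_insert hK]
      exact (h1 K).add ih
  have h3 : ∀ v : E, (∑ K, (f K p • Dg K + g K p • Df K) : E →L[ℝ] ℝ) v =
      ∑ K, (Df K v * g K p + f K p * Dg K v) := fun v => by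
    simp only [_root_.sum_apply, _root_.add_apply, _root_.smul_apply, smul_eq_mul]
    exact Finset.sum_congr rfl fun K _ => by ring
  exact (DFunLike.congr_fun (h2 Finset.univ).mfderiv v).trans (h3 v)

namespace IsLeafModel

/-- The first field equation alone gives the coefficient forms. They are linear in the tangent
vector because they can be read off with vectors dual to the `dC^K`. -/
theorem exists_coefficientForms [IsManifold (𝓡 n) ∞ M] (h : IsLeafModel P L U Ω C)
    (hXL : ∀ x, X x ∈ L) {A : OneFormAlong I n X}
    (heq : ∀ p (v : TangentSpace I p) (b : TangentSpace (𝓡 n) (X p) →L[ℝ] ℝ),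
      b (mfderiv I (𝓡 n) X p v) + P.bivector (X p) b (A p v) = 0) :
    ∃ α : Fin k → DForm I S 1, HasSolutionForm X Ω C α A := by
  choose w hw using fun x => h.exists_dualVectors (hXL x)
  let B : ∀ x, E →L[ℝ] EuclideanSpace ℝ (Fin n) →L[ℝ] ℝ := A
  let T : ∀ x, E →L[ℝ] EuclideanSpace ℝ (Fin n) := fun x => mfderiv I (𝓡 n) X x
  let a : Fin k → S → E →L[ℝ] ℝ := fun K x => (B x).flip (w x K) +
    (contract (V := EuclideanSpace ℝ (Fin n)) (Ω (X x)) (w x K)).comp (T x)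
  refine ⟨fun K x => ContinuousAlternatingMap.ofSubsingleton ℝ (TangentSpace I x) ℝ 0 (a K x),
    fun x v u => ?_⟩
  obtain ⟨m, hm⟩ := h.exists_decomposition (hXL x) _ _ (heq x v)
  have hma : ∀ K, m K = a K x v := fun K => by
    have h1 := hm (w x K)
    simp only [hw, mul_ite, mul_one, mul_zero, Finset.sum_ite_eq, Finset.mem_univ, if_true] at h1
    have h2 : a K x v = A x v (w x K) + Ω (X x) ![w x K, mfderiv I (𝓡 n) X x v] :=
      congrArg (fun r => A x v (w x K) + r) (contract_apply _ _ _)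
    rw [h2, h1]
    ring
  rw [hm]
  simp only [hma]
  rfl

theorem coefficientForms_unique (h : IsLeafModel P L U Ω C) (hXL : ∀ x, X x ∈ L)
    {A : OneFormAlong I n X} {α α' : Fin k → DForm I S 1} (hα : HasSolutionForm X Ω C α A)
    (hα' : HasSolutionForm X Ω C α' A) : α = α' := by
  ext1 K
  ext1 x
  refine DForm.ext_oneForm fun v => ?_
  refine congrFun (h.coefficients_unique (hXL x) (m := fun K => α K x ![v])
    (m' := fun K => α' K x ![v]) fun w => ?_) K
  exact add_left_cancel ((hα x v w).symm.trans (hα' x v w))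

/-- It suffices to test the independence of the `dC^K` on coordinate vector fields. -/
theorem coefficients_eq_zero (h : IsLeafModel P L U Ω C)
    (he : e ∈ IsManifold.maximalAtlas (𝓡 n) ∞ M) {q : M} (hq : q ∈ L) (hqe : q ∈ e.source)
    {m : Fin k → ℝ} (hm : ∀ i, ∑ K, m K * dAt (𝓡 n) (C K) q (coordVec e i q) = 0) : m = 0 := by
  refine h.coefficients_unique hq (m' := 0) fun u => ?_
  simp only [Pi.zero_apply, zero_mul, Finset.sum_const_zero]
  have h1 : ∀ K, m K * dAt (𝓡 n) (C K) q u = ∑ i, coordCovec e i q u *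
        (m K * dAt (𝓡 n) (C K) q (coordVec e i q)) := fun K => by
    rw [covec_eq_sum he hqe _ u, Finset.mul_sum]
    exact Finset.sum_congr rfl fun i _ => mul_left_comm _ _ _
  refine (Finset.sum_congr rfl fun K _ => h1 K).trans ?_
  rw [Finset.sum_comm]
  refine Finset.sum_eq_zero fun i _ => ?_
  rw [← Finset.mul_sum, hm, mul_zero]

theorem coefficientForms_closed [IsManifold I ∞ S] [IsManifold (𝓡 n) ∞ M]
    (h : IsLeafModel P L U Ω C) (hXL : ∀ x, X x ∈ L) {A : OneFormAlong I n X}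
    (hsol : IsSolution P (⟨X, A⟩ : Fields I S n M)) {α : Fin k → DForm I S 1}
    (hα : HasSolutionForm X Ω C α A) (K : Fin k) : α K ∈ closedForms I S := by
  intro p
  have he : chartAt (EuclideanSpace ℝ (Fin n)) (X p) ∈ IsManifold.maximalAtlas (𝓡 n) ∞ M :=
    IsManifold.chart_mem_maximalAtlas (X p)
  have hp := mem_chart_source (EuclideanSpace ℝ (Fin n)) (X p)
  have hs : ∀ K, (α K).SmoothAt p :=
    h.coefficient_smooth hsol.smooth_X hXL hα he hp (hsol.smooth_A p _ he hp)
  refine ⟨hs K, (DForm.d_eq_zero_iff (hs K)).2 fun v w => ?_⟩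
  exact congrFun (h.coefficients_eq_zero he (hXL p) hp
    (m := fun K => curl (Set.range I) ((α K).chartCov p) (extChartAt I p p) v w) fun i =>
      (h.fieldStrength hsol.smooth_X hXL hα hs (hsol.eq_X p) he hp i v w).symm.trans
        (hsol.eq_A p _ he hp i v w)) K

theorem isSolution [IsManifold I ∞ S] [IsManifold (𝓡 n) ∞ M] (h : IsLeafModel P L U Ω C)
    (hX : ContMDiff I (𝓡 n) ∞ X) (hXL : ∀ x, X x ∈ L) {A : OneFormAlong I n X}
    {α : Fin k → DForm I S 1} (hA : HasSolutionForm X Ω C α A)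
    (hα : ∀ K, α K ∈ closedForms I S) : IsSolution P (⟨X, A⟩ : Fields I S n M) := by
  have heq : ∀ p (v : TangentSpace I p) (b : TangentSpace (𝓡 n) (X p) →L[ℝ] ℝ),
      b (mfderiv I (𝓡 n) X p v) + P.bivector (X p) b (A p v) = 0 := fun p v b =>
    h.eq_X_of_decomposition (hXL p) _ (fun K => h.dAt_casimir_mfderiv hX hXL p v K) (A p v)
      (fun K => α K p ![v]) (hA p v) b
  refine ⟨hX, fun p e he hp i => h.field_smooth hX hXL hA (fun K => (hα K p).1) he hp i, heq,
    fun p e he hp i v w => ?_⟩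
  refine (h.fieldStrength hX hXL hA (fun K => (hα K p).1) (heq p) he hp i v w).trans ?_
  refine Finset.sum_eq_zero fun K _ => ?_
  exact mul_eq_zero_of_left ((DForm.d_eq_zero_iff (hα K p).1).1 (hα K p).2 v w) _

/-- The gauge parameter `h_K X^*dC^K` leaves `X` fixed and changes `α_K` by `dh_K`. -/
theorem gaugeTransform_of_exact [IsManifold I ∞ S] [IsManifold (𝓡 n) ∞ M]
    (h : IsLeafModel P L U Ω C) (hX : ContMDiff I (𝓡 n) ∞ X) (hXL : ∀ x, X x ∈ L)
    {A A' : OneFormAlong I n X} {α α' : Fin k → closedForms I S}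
    (hA : HasSolutionForm X Ω C (fun K => (α K).1) A)
    (hA' : HasSolutionForm X Ω C (fun K => (α' K).1) A')
    (hexact : ∀ K, (α' K).1 - (α K).1 ∈ exactForms I S) :
    GaugeTransform P (⟨X, A⟩ : Fields I S n M) ⟨X, A'⟩ := by
  choose g hg hαg using hexact
  have hdiff : ∀ K x (v : TangentSpace I x), (α' K).1 x ![v] - (α K).1 x ![v] =
      dAt I (g K) x v := fun K x v =>
    congrArg (fun η : DForm I S 1 => η x ![v]) (hαg K)
  let At : ℝ → OneFormAlong I n X := fun t x => A x + t • (A' x - A x)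
  have hAt : ∀ t, HasSolutionForm X Ω C (fun K => (α K + t • (α' K - α K)).1) (At t) := by
    intro t x v w
    have h1 : At t x v w = A x v w + t * (A' x v w - A x v w) := rfl
    have h2 : ∀ K, (α K + t • (α' K - α K)).1 x ![v] =
      (α K).1 x ![v] + t * ((α' K).1 x ![v] - (α K).1 x ![v]) := fun K => rfl
    rw [h1, hA, hA']
    simp only [h2, add_mul, Finset.sum_add_distrib, mul_assoc, ← Finset.mul_sum, sub_mul,
      Finset.sum_sub_distrib]
    ring
  let ε : ℝ → ∀ x, TangentSpace (𝓡 n) (X x) →L[ℝ] ℝ := fun _ x =>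
    ∑ K, g K x • dAt (𝓡 n) (C K) (X x)
  have hε : ∀ t x w, ε t x w = ∑ K, g K x * dAt (𝓡 n) (C K) (X x) w := fun t x w => by
    simp only [ε, _root_.sum_apply, _root_.smul_apply, smul_eq_mul]
  have hsol : ∀ t, IsSolution P (⟨X, At t⟩ : Fields I S n M) := fun t =>
    h.isSolution hX hXL (hAt t) fun K => (α K + t • (α' K - α K)).2
  refine ⟨fun t => ⟨X, At t⟩, ε, ⟨hsol, ?_, ?_, ?_, ?_, ?_⟩, ?_, ?_⟩
  · exact hX.comp contMDiff_snd
  · intro t p e he hp i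
    have h0 : ContDiffWithinAt ℝ ∞ ((Fields.comp ⟨X, At 0⟩ e i).inChart p) (Set.range I)
        (extChartAt I p p) := (hsol 0).smooth_A p e he hp i
    have h1 : ContDiffWithinAt ℝ ∞ ((Fields.comp ⟨X, At 1⟩ e i).inChart p) (Set.range I)
        (extChartAt I p p) := (hsol 1).smooth_A p e he hp i
    have hcomb : ∀ z : ℝ × E, (Fields.comp ⟨X, At z.1⟩ e i).inChart p z.2 =
        (Fields.comp ⟨X, At 0⟩ e i).inChart p z.2 + z.1 •
          ((Fields.comp ⟨X, At 1⟩ e i).inChart p z.2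
            - (Fields.comp ⟨X, At 0⟩ e i).inChart p z.2) := by
      intro z
      ext v
      have hv : ∀ t x (v : TangentSpace I x) w, At t x v w =
          A x v w + t * (A' x v w - A x v w) := fun _ _ _ _ => rfl
      change At z.1 _ _ _ = At 0 _ _ _ + z.1 * (At 1 _ _ _ - At 0 _ _ _)
      simp only [hv]
      ring
    have hmaps : Set.MapsTo (Prod.snd : ℝ × E → E) (Set.univ ×ˢ Set.range I) (Set.range I) :=
      fun z hz => hz.2
    have h0' := h0.comp (t, extChartAt I p p) contDiff_snd.contDiffWithinAt hmaps
    have h1' := h1.comp (t, extChartAt I p p) contDiff_snd.contDiffWithinAt hmaps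
    refine ContDiffWithinAt.congr (h0'.add (contDiff_fst.contDiffWithinAt.smul (h1'.sub h0')))
      (fun z _ => hcomb z) (hcomb _)
  · intro t p e he hp i
    have hloc := h.localModel he hp (hXL p)
    simp only [hε]
    have hnhds : ∀ᶠ z in 𝓝 ((t, p) : ℝ × S), X z.2 ∈ e.source :=
      ((hX p).continuousAt.comp (x := ((t, p) : ℝ × S)) continuousAt_snd).preimage_mem_nhds
        (e.open_source.mem_nhds hp)
    have hsm : ContMDiffAt (𝓘(ℝ, ℝ).prod I) 𝓘(ℝ, ℝ) ∞ (fun z : ℝ × S => ∑ K, g K z.2 *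
        fderiv ℝ (fun y => C K (e.symm y)) (e (X z.2)) (EuclideanSpace.single i 1)) (t, p) := by
      refine contMDiffAt_finsetSum (I := 𝓘(ℝ, ℝ)) fun K _ => ?_
      have h0 : ContMDiffAt (𝓘(ℝ, ℝ).prod I) 𝓘(ℝ, ℝ) ∞ (fun z : ℝ × S => g K z.2) (t, p) :=
        ContMDiffAt.comp (I' := I) (t, p) (hg K p) contMDiffAt_snd
      refine ContMDiffAt.mul (I := 𝓘(ℝ, ℝ)) h0 ?_
      have h1 := (hloc.smooth_dC K i).contMDiffAt
      have h2 : ContMDiffAt I (𝓡 n) ∞ (fun x => e (X x)) p :=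
        (contMDiffAt_of_mem_maximalAtlas he hp).comp p (hX p)
      have h3 : ContMDiffAt I 𝓘(ℝ, ℝ) ∞ (fun x => fderiv ℝ (fun y => C K (e.symm y)) (e (X x))
          (EuclideanSpace.single i 1)) p :=
        ContMDiffAt.comp (I' := 𝓡 n) p h1 h2
      exact ContMDiffAt.comp (I' := I) (t, p) h3 (contMDiffAt_snd (I := 𝓘(ℝ, ℝ)) (J := I))
    refine hsm.congr_of_eventuallyEq ?_
    filter_upwards [hnhds] with z hz
    simp only [h.fderiv_casimir he (hXL z.2) hz]
  · intro t p b
    have h1 : mfderiv 𝓘(ℝ, ℝ) (𝓡 n) (fun _ : ℝ => X p) t = 0 := mfderiv_const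
    change b (mfderiv 𝓘(ℝ, ℝ) (𝓡 n) (fun _ : ℝ => X p) t 1) = _
    rw [h1]
    simp only [ε, map_sum, map_smul, _root_.sum_apply, _root_.smul_apply]
    refine (map_zero b).trans (Finset.sum_eq_zero fun K _ => ?_).symm
    rw [(h.casimir K).casimir _ (h.mem_open (hXL p)), smul_zero]
  · intro t p e he hp i v
    have hloc := h.localModel he hp (hXL p)
    have hcas := h.fderiv_casimir he (hXL p) hp
    -- the velocity of the path is `dh_K ∂_iC^K`
    have hvel : HasDerivAt (fun s => At s p v (coordVec e i (X p)))
        (∑ K, dAt I (g K) p v * dAt (𝓡 n) (C K) (X p) (coordVec e i (X p))) t := by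
      have h1 : ∀ s, At s p v (coordVec e i (X p)) = A p v (coordVec e i (X p)) +
          s * (A' p v (coordVec e i (X p)) - A p v (coordVec e i (X p))) := fun _ => rfl
      simp only [h1]
      have h2 := ((hasDerivAt_id t).mul_const
        (A' p v (coordVec e i (X p)) - A p v (coordVec e i (X p)))).const_add
          (A p v (coordVec e i (X p)))
      have h3 : A' p v (coordVec e i (X p)) - A p v (coordVec e i (X p)) =
          ∑ K, dAt I (g K) p v * dAt (𝓡 n) (C K) (X p) (coordVec e i (X p)) := by
        rw [hA, hA']
        simp only [← hdiff, sub_mul, Finset.sum_sub_distrib]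
        ring
      rw [h3, one_mul] at h2
      rw [h3]
      exact h2
    refine hvel.congr_deriv ?_
    -- the differential of the component `ε_i`
    let c : Fin k → S → ℝ := fun K x => fderiv ℝ (fun y => C K (e.symm y)) (e (X x))
      (EuclideanSpace.single i 1)
    have hc : ∀ K, HasMFDerivAt I 𝓘(ℝ, ℝ) (c K) p
        (((fderiv ℝ (fun y => fderiv ℝ (fun y => C K (e.symm y)) y (EuclideanSpace.single i 1))
          (e (X p))).comp (chartDeriv e (X p))).comp (mfderiv I (𝓡 n) X p)) := fun K =>
      ((((hloc.smooth_dC K i).differentiableAt (by simp)).hasFDerivAt.hasMFDerivAt).comp (X p)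
        ((mdifferentiable_of_mem_maximalAtlas he).mdifferentiableAt hp).hasMFDerivAt).comp p
          ((hX p).mdifferentiableAt (by simp)).hasMFDerivAt
    have hcv : ∀ K, dAt I (c K) p v = ∑ l, (-∑ r, P.bivector.comp e l r (e (X p)) *
        At t p v (coordVec e r (X p))) * fderiv ℝ (fun y => fderiv ℝ (fun y => C K (e.symm y)) y
          (EuclideanSpace.single i 1)) (e (X p)) (EuclideanSpace.single l 1) := by
      intro K
      have h1 : dAt I (c K) p v = fderiv ℝ (fun y => fderiv ℝ (fun y => C K (e.symm y)) y
          (EuclideanSpace.single i 1)) (e (X p)) (chartDeriv e (X p) (mfderiv I (𝓡 n) X p v)) :=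
        DFunLike.congr_fun (hc K).mfderiv v
      rw [h1, fderiv_apply_eq_sum]
      refine Finset.sum_congr rfl fun l _ => ?_
      rw [← coordCovec_apply he hp, eq_X_coord he hp ((hsol t).eq_X p v)]
    have hεd : dAt I (fun x => ε t x (coordVec e i (X x))) p v =
        ∑ K, (dAt I (g K) p v * c K p + g K p * dAt I (c K) p v) := by
      have hnhds : ∀ᶠ x in 𝓝 p, X x ∈ e.source :=
        (hX p).continuousAt.preimage_mem_nhds (e.open_source.mem_nhds hp)
      have h1 : (fun x => ε t x (coordVec e i (X x))) =ᶠ[𝓝 p] fun x => ∑ K, g K x * c K x := by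
        filter_upwards [hnhds] with x hx
        refine (hε t x _).trans (Finset.sum_congr rfl fun K _ => ?_)
        simp only [c, h.fderiv_casimir he (hXL x) hx]
      rw [dAt_congr h1, dAt_sum_mul (fun K => (hg K p).mdifferentiableAt (by simp))
        fun K => (hc K).mdifferentiableAt]
    change _ = dAt I (fun x => ε t x (coordVec e i (X x))) p v + ∑ r, ∑ l,
      P.bivector.dcomp e r l i (X p) * (At t p v (coordVec e r (X p)) *
        ε t p (coordVec e l (X p)))
    rw [hεd]
    -- the remaining terms vanish by the derivative of the Casimir condition
    have hzero : ∑ K, g K p * dAt I (c K) p v + ∑ r, ∑ l, P.bivector.dcomp e r l i (X p) *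
        (At t p v (coordVec e r (X p)) * ε t p (coordVec e l (X p))) = 0 := by
      have hcond : ∀ K, ∑ r, At t p v (coordVec e r (X p)) *
          (∑ l, fderiv ℝ (P.bivector.comp e r l) (e (X p)) (EuclideanSpace.single i 1)
            * fderiv ℝ (fun y => C K (e.symm y)) (e (X p)) (EuclideanSpace.single l 1)
          + ∑ l, P.bivector.comp e r l (e (X p)) * fderiv ℝ (fun y => fderiv ℝ
            (fun y => C K (e.symm y)) y (EuclideanSpace.single i 1)) (e (X p))
            (EuclideanSpace.single l 1)) = 0 := fun K =>
        Finset.sum_eq_zero fun r _ => by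
          rw [hloc.fderiv_casimir_condition K i r, mul_zero]
      have h1 : ∀ K, dAt I (c K) p v + ∑ r, ∑ l, P.bivector.dcomp e r l i (X p) *
          (At t p v (coordVec e r (X p)) * dAt (𝓡 n) (C K) (X p) (coordVec e l (X p))) = 0 := by
        intro K
        rw [← hcond K, hcv]
        simp only [mul_add, Finset.sum_add_distrib, Finset.mul_sum, neg_mul, Finset.sum_mul,
          ← hcas]
        rw [add_comm]
        congr 1
        · exact Finset.sum_congr rfl fun r _ => Finset.sum_congr rfl fun l _ => by
            rw [CotBilin.dcomp]; ring
        · rw [Finset.sum_neg_distrib, Finset.sum_comm, ← Finset.sum_neg_distrib]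
          refine Finset.sum_congr rfl fun r _ => ?_
          rw [← Finset.sum_neg_distrib]
          refine Finset.sum_congr rfl fun l _ => ?_
          have h2 : P.bivector.comp e l r (e (X p)) = -P.bivector.comp e r l (e (X p)) :=
            P.bivector_swap _ _ _
          rw [h2]
          ring
      have h2 : ∑ r, ∑ l, P.bivector.dcomp e r l i (X p) *
          (At t p v (coordVec e r (X p)) * ε t p (coordVec e l (X p))) = ∑ K, g K p *
          ∑ r, ∑ l, P.bivector.dcomp e r l i (X p) *
          (At t p v (coordVec e r (X p)) * dAt (𝓡 n) (C K) (X p) (coordVec e l (X p))) := by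
        simp only [hε, Finset.mul_sum]
        rw [Finset.sum_comm]
        conv_rhs => rw [Finset.sum_comm]
        rw [Finset.sum_comm]
        refine Finset.sum_congr rfl fun r _ => ?_
        rw [Finset.sum_comm]
        exact Finset.sum_congr rfl fun K _ => Finset.sum_congr rfl fun l _ => by ring
      rw [h2, ← Finset.sum_add_distrib]
      refine Finset.sum_eq_zero fun K _ => ?_
      rw [← mul_add, h1, mul_zero]
    rw [Finset.sum_add_distrib, add_assoc, hzero, add_zero]
    simp only [c, hcas]
  · have : At 0 = A := by
      ext x v w
      change A x v w + 0 * (A' x v w - A x v w) = _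
      ring
    exact congrArg (fun B => (⟨X, B⟩ : Fields I S n M)) this
  · have : At 1 = A' := by
      ext x v w
      change A x v w + 1 * (A' x v w - A x v w) = _
      ring
    exact congrArg (fun B => (⟨X, B⟩ : Fields I S n M)) this

end IsLeafModel

end Solutions

/-! ### Integration over the time interval -/

section Homotopy

variable {E : Type*} [NormedAddCommGroup E] [NormedSpace ℝ E]

/-- Differentiation under the integral sign: integrating the `dt`-component of a 1-form `c` on
`ℝ × s` over `0 ≤ t ≤ 1` gives a primitive of the difference of its restrictions to the two ends,
if `c` has no curl in the mixed directions. The set `s` need not be open, so the difference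
quotients are estimated by the mean value inequality on the convex set `s`. -/
theorem hasFDerivWithinAt_integral {s : Set E} (hs : Convex ℝ s) (hu : UniqueDiffOn ℝ s)
    {c : ℝ × E → ℝ × E →L[ℝ] ℝ} {z₀ : E} (hz : z₀ ∈ s)
    (hc : ∀ t, ContDiffWithinAt ℝ ∞ c (Set.univ ×ˢ s) (t, z₀))
    (hcurl : ∀ t v, curl (Set.univ ×ˢ s) c (t, z₀) (1, 0) (0, v) = 0) :
    HasFDerivWithinAt (fun z => ∫ t in (0 : ℝ)..1, c (t, z) (1, 0))
      ((c (1, z₀) - c (0, z₀)).comp (ContinuousLinearMap.inr ℝ ℝ E)) s z₀ := by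
  set B : Set (ℝ × E) := Set.univ ×ˢ s with hB
  have huB : UniqueDiffOn ℝ B := uniqueDiffOn_univ.prod hu
  have hmem : ∀ (t : ℝ) {z}, z ∈ s → (t, z) ∈ B := fun t z hz => ⟨trivial, hz⟩
  let b : ℝ × E → ℝ := fun p => c p (1, 0)
  have hb : ∀ t, ContDiffWithinAt ℝ ∞ b B (t, z₀) := fun t =>
    (hc t).clm_apply contDiffWithinAt_const
  let G : ℝ × E → E →L[ℝ] ℝ := fun p =>
    (fderivWithin ℝ b B p).comp (ContinuousLinearMap.inr ℝ ℝ E)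
  have hG : ∀ t, ContinuousWithinAt G B (t, z₀) := fun t =>
    (((hb t).fderivWithin_right (m := ∞) huB (by simp) (hmem t hz)).clm_comp
      contDiffWithinAt_const).continuousWithinAt
  have hslice : ∀ z ∈ s, ∀ t, Tendsto (fun r : ℝ => (r, z)) (𝓝 t) (𝓝[B] (t, z)) := fun z hz t =>
    tendsto_nhdsWithin_iff.2
      ⟨(continuous_id.prodMk continuous_const).tendsto t, Eventually.of_forall fun r => hmem r hz⟩
  have hGc : Continuous fun t => G (t, z₀) := continuous_iff_continuousAt.2 fun t =>
    (hG t).tendsto.comp (hslice z₀ hz t)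
  have hbd : ∀ t, ∀ᶠ p in 𝓝[B] (t, z₀), DifferentiableWithinAt ℝ b B p := fun t => by
    have h1 := ((hb t).of_le (m := 1) (by simp)).eventually (by simp)
    rw [Set.insert_eq_of_mem (hmem t hz)] at h1
    exact h1.mono fun p hp => hp.differentiableWithinAt (by simp)
  have hFTC : ∀ v, ∫ t in (0 : ℝ)..1, G (t, z₀) v = (c (1, z₀) - c (0, z₀)) (0, v) := by
    intro v
    have hder : ∀ t, HasDerivAt (fun r => c (r, z₀) (0, v)) (G (t, z₀) v) t := by
      intro t
      have hd := ((hc t).differentiableWithinAt (by simp)).hasFDerivWithinAt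
      have h1 : HasFDerivWithinAt b _ B (t, z₀) :=
        hd.clm_apply (hasFDerivWithinAt_const ((1, 0) : ℝ × E) _ _)
      have h2 : G (t, z₀) v = fderivWithin ℝ c B (t, z₀) (1, 0) (0, v) := by
        change fderivWithin ℝ b B (t, z₀) (0, v) = _
        rw [h1.fderivWithin (huB _ (hmem t hz))]
        have h3 := hcurl t v
        rw [curl, sub_eq_zero] at h3
        rw [h3]
        simp
      rw [h2]
      have h4 : HasDerivAt (fun r : ℝ => (r, z₀)) ((1, 0) : ℝ × E) t :=
        (hasDerivAt_id t).prodMk (hasDerivAt_const t z₀)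
      have h5 : HasDerivAt (fun r : ℝ => c (r, z₀)) (fderivWithin ℝ c B (t, z₀) (1, 0)) t := by
        rw [← hasDerivWithinAt_univ]
        exact hd.comp_hasDerivWithinAt t h4.hasDerivWithinAt fun r _ => hmem r hz
      simpa using h5.clm_apply (hasDerivAt_const t ((0, v) : ℝ × E))
    exact intervalIntegral.integral_eq_sub_of_hasDerivAt (fun t _ => hder t)
      ((hGc.clm_apply continuous_const).intervalIntegrable 0 1)
  rw [hasFDerivWithinAt_iff_isLittleO, Asymptotics.isLittleO_iff]
  intro δ hδ
  have hunif : ∀ᶠ z in 𝓝 z₀, ∀ t ∈ Set.Icc (0 : ℝ) 1, z ∈ s →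
      DifferentiableWithinAt ℝ b B (t, z) ∧ ‖G (t, z) - G (t, z₀)‖ ≤ δ := by
    refine isCompact_Icc.eventually_forall_of_forall_eventually fun t _ => ?_
    have h1 : ∀ᶠ p in 𝓝[B] (t, z₀), dist (G p) (G (t, z₀)) < δ / 2 :=
      (hG t).tendsto.eventually (Metric.ball_mem_nhds _ (half_pos hδ))
    have h2 : ∀ᶠ r in 𝓝 t, dist (G (r, z₀)) (G (t, z₀)) < δ / 2 :=
      hGc.continuousAt.eventually (Metric.ball_mem_nhds _ (half_pos hδ))
    have h3 := eventually_nhdsWithin_iff.1 (h1.and (hbd t))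
    have h4 : Tendsto (fun p : E × ℝ => (p.2, p.1)) (𝓝 (z₀, t)) (𝓝 (t, z₀)) :=
      continuous_swap.tendsto (z₀, t)
    filter_upwards [h4.eventually h3, (continuous_snd.tendsto (z₀, t)).eventually h2]
      with p hp hp2 hps
    obtain ⟨h5, h6⟩ := hp (hmem _ hps)
    refine ⟨h6, ?_⟩
    rw [← dist_eq_norm]
    have := dist_triangle_right (G (p.2, p.1)) (G (p.2, z₀)) (G (t, z₀))
    linarith
  obtain ⟨r, hr, hball⟩ := Metric.eventually_nhds_iff_ball.1 hunif
  filter_upwards [self_mem_nhdsWithin, nhdsWithin_le_nhds (Metric.ball_mem_nhds z₀ hr)]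
    with z hzs hzr
  have hint : ∀ z ∈ s, z ∈ Metric.ball z₀ r →
      IntervalIntegrable (fun t => b (t, z)) MeasureTheory.volume 0 1 := fun z hzs hzr => by
    refine ContinuousOn.intervalIntegrable ?_
    rw [Set.uIcc_of_le zero_le_one]
    exact fun t ht => ((hball z hzr t ht hzs).1.continuousWithinAt.tendsto.comp
      (hslice z hzs t)).mono_left nhdsWithin_le_nhds
  have hdiff : (∫ t in (0 : ℝ)..1, c (t, z) (1, 0)) - (∫ t in (0 : ℝ)..1, c (t, z₀) (1, 0)) -
      ((c (1, z₀) - c (0, z₀)).comp (ContinuousLinearMap.inr ℝ ℝ E)) (z - z₀) =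
      ∫ t in (0 : ℝ)..1, (b (t, z) - b (t, z₀) - G (t, z₀) (z - z₀)) := by
    have h0 := hint z₀ hz (Metric.mem_ball_self hr)
    rw [intervalIntegral.integral_sub ((hint z hzs hzr).sub h0)
      ((hGc.clm_apply continuous_const).intervalIntegrable 0 1),
      intervalIntegral.integral_sub (hint z hzs hzr) h0, hFTC]
    rfl
  rw [hdiff]
  refine (intervalIntegral.norm_integral_le_of_norm_le_const (C := δ * ‖z - z₀‖)
    fun t ht => ?_).trans (by simp)
  rw [Set.uIoc_of_le zero_le_one] at ht
  have ht' : t ∈ Set.Icc (0 : ℝ) 1 := Set.Ioc_subset_Icc_self ht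
  refine Convex.norm_image_sub_le_of_norm_hasFDerivWithin_le' (f := fun z => b (t, z))
    (s := s ∩ Metric.ball z₀ r) (f' := fun z => G (t, z)) (fun y hy => ?_)
    (fun y hy => (hball y hy.2 t ht' hy.1).2) (hs.inter (convex_ball _ _))
    ⟨hz, Metric.mem_ball_self hr⟩ ⟨hzs, hzr⟩
  have h1 := (hball y hy.2 t ht' hy.1).1.hasFDerivWithinAt
  exact h1.comp y (hasFDerivAt_prodMk_right t y).hasFDerivWithinAt fun w hw => hmem t hw.1

end Homotopy

/-! ### 1-forms on the cylinder -/

section Cylinder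

variable {E H : Type*} [NormedAddCommGroup E] [NormedSpace ℝ E] [TopologicalSpace H]
  {I : ModelWithCorners ℝ E H} {S : Type*} [TopologicalSpace S] [ChartedSpace H S]

theorem hasMFDerivAt_of_comp_symm {f : S → ℝ} {p : S} {D : E →L[ℝ] ℝ}
    (h : HasFDerivWithinAt (fun z => f ((extChartAt I p).symm z)) D (Set.range I)
      (extChartAt I p p)) : HasMFDerivAt I 𝓘(ℝ, ℝ) f p D := by
  refine ⟨?_, h⟩
  have h1 : Tendsto (fun x => f ((extChartAt I p).symm (extChartAt I p x))) (𝓝 p)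
      (𝓝 (f ((extChartAt I p).symm (extChartAt I p p)))) := by
    refine h.continuousWithinAt.tendsto.comp (tendsto_nhdsWithin_iff.2
      ⟨continuousAt_extChartAt p, Eventually.of_forall fun x => ?_⟩)
    rw [extChartAt_coe]
    exact Set.mem_range_self _
  rw [extChartAt_to_inv] at h1
  refine h1.congr' ?_
  filter_upwards [extChartAt_source_mem_nhds (I := I) p] with x hx
  rw [(extChartAt I p).left_inv hx]

/-- A function whose differential is a smooth form is smooth. -/
theorem contMDiff_of_smooth_dAt [IsManifold I ∞ S] {g : S → ℝ} {θ : DForm I S 1}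
    (hθ : ∀ p, θ.SmoothAt p) (hg : ∀ p, MDifferentiableAt I 𝓘(ℝ, ℝ) g p)
    (h : ∀ p v, dAt I g p v = θ p ![v]) : ContMDiff I 𝓘(ℝ, ℝ) ∞ g := by
  intro p
  rw [contMDiffAt_iff]
  refine ⟨(hg p).continuousAt, ?_⟩
  change ContDiffWithinAt ℝ ∞ (fun z => g ((extChartAt I p).symm z)) _ _
  have hz := Set.mem_range_self (f := I) (chartAt H p p)
  have hmem : extChartAt I p p ∈ Set.range I := by
    rw [extChartAt_coe]; exact hz
  rw [contDiffWithinAt_infty]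
  intro m
  refine ContDiffWithinAt.of_le (n := (m : ℕ∞ω) + 1) ?_ le_self_add
  rw [contDiffWithinAt_succ_iff_hasFDerivWithinAt' (by simp), Set.insert_eq_of_mem hmem]
  refine ⟨(extChartAt I p).target, extChartAt_target_mem_nhdsWithin p,
    extChartAt_target_subset_range p, by simp, θ.chartCov p, fun z hzt => ?_,
    ((θ.smoothAt_iff p).1 (hθ p)).of_le (by exact_mod_cast le_top)⟩
  have h1 : HasMFDerivWithinAt 𝓘(ℝ, E) I (extChartAt I p).symm (Set.range I) z _ :=
    (mdifferentiableWithinAt_extChartAt_symm hzt).hasMFDerivWithinAt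
  have h2 := hasMFDerivWithinAt_iff_hasFDerivWithinAt.1
    ((hg ((extChartAt I p).symm z)).hasMFDerivAt.comp_hasMFDerivWithinAt z h1)
  have h3 : ∀ v : E, mfderiv I 𝓘(ℝ, ℝ) g ((extChartAt I p).symm z)
      (mfderivWithin 𝓘(ℝ, E) I (extChartAt I p).symm (Set.range I) z v) = θ.chartCov p z v :=
    fun v => (h _ _).trans (θ.chartCov_apply p z v).symm
  exact HasFDerivWithinAt.congr_fderiv h2 (ContinuousLinearMap.ext h3)

/-- The preferred charts of `ℝ × S` are those of `S`, with the identity on `ℝ`; in particular they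
do not depend on the time `r` of the base point. -/
theorem DForm.chartCov_prod [IsManifold I ∞ S]
    (η : DForm (𝓘(ℝ, ℝ).prod I) (ℝ × S) 1) (r : ℝ) (p : S) (t τ : ℝ)
    {z : E} (hz : z ∈ (extChartAt I p).target) (v : E) :
    η.chartCov (r, p) (t, z) (τ, v) = η (t, (extChartAt I p).symm z)
      ![(τ, mfderivWithin 𝓘(ℝ, E) I (extChartAt I p).symm (Set.range I) z v)] := by
  have hfun : ((extChartAt (𝓘(ℝ, ℝ).prod I) (r, p)).symm : ℝ × E → ℝ × S) =
      fun y => (y.1, (extChartAt I p).symm y.2) := by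
    rw [extChartAt_prod]
    rfl
  have hder : HasMFDerivWithinAt 𝓘(ℝ, ℝ × E) (𝓘(ℝ, ℝ).prod I)
      (fun y : ℝ × E => (y.1, (extChartAt I p).symm y.2)) (Set.range (𝓘(ℝ, ℝ).prod I)) (t, z)
      ((ContinuousLinearMap.fst ℝ ℝ E).prod ((mfderivWithin 𝓘(ℝ, E) I (extChartAt I p).symm
        (Set.range I) z).comp (ContinuousLinearMap.snd ℝ ℝ E))) := by
    have h1 : HasMFDerivWithinAt 𝓘(ℝ, ℝ × E) 𝓘(ℝ, ℝ) (Prod.fst : ℝ × E → ℝ)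
        (Set.range (𝓘(ℝ, ℝ).prod I)) (t, z) (ContinuousLinearMap.fst ℝ ℝ E) :=
      hasFDerivWithinAt_fst.hasMFDerivWithinAt
    have h2 : HasMFDerivWithinAt 𝓘(ℝ, ℝ × E) 𝓘(ℝ, E) (Prod.snd : ℝ × E → E)
        (Set.range (𝓘(ℝ, ℝ).prod I)) (t, z) (ContinuousLinearMap.snd ℝ ℝ E) :=
      hasFDerivWithinAt_snd.hasMFDerivWithinAt
    refine h1.prodMk (HasMFDerivWithinAt.comp (t, z) (u := Set.range I)
      (mdifferentiableWithinAt_extChartAt_symm hz).hasMFDerivWithinAt h2 ?_)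
    rw [ModelWithCorners.range_prod]
    exact fun y hy => hy.2
  have hu : UniqueMDiffWithinAt 𝓘(ℝ, ℝ × E) (Set.range (𝓘(ℝ, ℝ).prod I)) (t, z) := by
    refine ((𝓘(ℝ, ℝ).prod I).uniqueDiffOn (t, z) ?_).uniqueMDiffWithinAt
    rw [ModelWithCorners.range_prod]
    exact ⟨by simp, extChartAt_target_subset_range p hz⟩
  have hsub : ∀ f g : ℝ × E → ℝ × S, f = g → ∀ y w : ℝ × E,
      η (f y) ![mfderivWithin 𝓘(ℝ, ℝ × E) (𝓘(ℝ, ℝ).prod I) f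
        (Set.range (𝓘(ℝ, ℝ).prod I)) y w] =
      η (g y) ![mfderivWithin 𝓘(ℝ, ℝ × E) (𝓘(ℝ, ℝ).prod I) g
        (Set.range (𝓘(ℝ, ℝ).prod I)) y w] := by
    rintro f _ rfl y w
    rfl
  refine (η.chartCov_apply (r, p) (t, z) (τ, v)).trans ((hsub _ _ hfun _ _).trans ?_)
  rw [hder.mfderivWithin hu]
  rfl

theorem DForm.chartCov_prod_self [IsManifold I ∞ S] (η : DForm (𝓘(ℝ, ℝ).prod I) (ℝ × S) 1)
    (r : ℝ) (p : S) (t τ : ℝ) (v : E) :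
    η.chartCov (r, p) (t, extChartAt I p p) (τ, v) = η (t, p) ![(τ, v)] :=
  DForm.chartCov_self η (t, p) (τ, v)

theorem DForm.eventually_chartCov_prod [IsManifold I ∞ S]
    (η : DForm (𝓘(ℝ, ℝ).prod I) (ℝ × S) 1) (r : ℝ) (p : S) :
    ∀ᶠ z in 𝓝[Set.range I] (extChartAt I p p), ∀ t,
      η.chartCov (r, p) (t, z) (1, 0) = η (t, (extChartAt I p).symm z) ![(1, 0)] := by
  filter_upwards [eventually_mem_target p] with z hz t
  refine (η.chartCov_prod r p t 1 hz 0).trans ?_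
  exact congrArg (fun w : E => η (t, (extChartAt I p).symm z) ![((1, w) : ℝ × E)])
    (map_zero (mfderivWithin 𝓘(ℝ, E) I (extChartAt I p).symm (Set.range I) z))

/-- The mixed components of the exterior derivative of a 1-form on `ℝ × S`. -/
theorem DForm.curl_mixed [IsManifold I ∞ S] {η : DForm (𝓘(ℝ, ℝ).prod I) (ℝ × S) 1} {t : ℝ} {p : S}
    (hη : η.SmoothAt (t, p)) (v : E) : HasDerivAt (fun r => η (r, p) ![(0, v)])
      (curl (Set.range (𝓘(ℝ, ℝ).prod I)) (η.chartCov (t, p))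
        (extChartAt (𝓘(ℝ, ℝ).prod I) (t, p) (t, p)) (1, 0) (0, v)
        + dAt I (fun x => η (t, x) ![(1, 0)]) p v) t := by
  have h0 := (((η.smoothAt_iff (t, p)).1 hη).differentiableWithinAt (by simp)).hasFDerivWithinAt
  set D : ℝ × E →L[ℝ] ℝ × E →L[ℝ] ℝ := fderivWithin ℝ (η.chartCov (t, p))
    (Set.range (𝓘(ℝ, ℝ).prod I)) (extChartAt (𝓘(ℝ, ℝ).prod I) (t, p) (t, p)) with hD
  have hrange : Set.range (𝓘(ℝ, ℝ).prod I) = Set.univ ×ˢ Set.range I := by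
    rw [ModelWithCorners.range_prod]
    simp
  have hpt : extChartAt (𝓘(ℝ, ℝ).prod I) (t, p) (t, p) = (t, extChartAt I p p) := by
    rw [extChartAt_prod]
    rfl
  rw [hrange, hpt] at h0
  have h1 : HasMFDerivAt I 𝓘(ℝ, ℝ) (fun x => η (t, x) ![(1, 0)]) p
      ((D.flip (1, 0)).comp (ContinuousLinearMap.inr ℝ ℝ E)) := by
    refine hasMFDerivAt_of_comp_symm ?_
    have h2 : HasFDerivWithinAt (fun z => η.chartCov (t, p) (t, z))
        (D.comp (ContinuousLinearMap.inr ℝ ℝ E)) (Set.range I) (extChartAt I p p) :=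
      h0.comp (extChartAt I p p) (hasFDerivAt_prodMk_right t _).hasFDerivWithinAt
        fun z hz => ⟨trivial, hz⟩
    have h3 := h2.clm_apply (hasFDerivWithinAt_const ((1, 0) : ℝ × E) _ _)
    have h4 := η.eventually_chartCov_prod t p
    refine (h3.congr_of_eventuallyEq (h4.mono fun z hz => (hz t).symm) ?_).congr_fderiv ?_
    · exact (h4.self_of_nhdsWithin (by rw [extChartAt_coe]; exact Set.mem_range_self _) t).symm
    · ext w
      change (η.chartCov (t, p) (t, extChartAt I p p)) 0 + D (0, w) (1, 0) = D (0, w) (1, 0)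
      rw [map_zero, zero_add]
  have h2 : dAt I (fun x => η (t, x) ![(1, 0)]) p v = D (0, v) (1, 0) :=
    DFunLike.congr_fun h1.mfderiv v
  rw [h2, curl, ← hD, sub_add_cancel]
  have h4 : HasDerivAt (fun r : ℝ => (r, extChartAt I p p)) ((1, 0) : ℝ × E) t :=
    (hasDerivAt_id t).prodMk (hasDerivAt_const t _)
  have h5 : HasDerivAt (fun r : ℝ => η.chartCov (t, p) (r, extChartAt I p p)) (D (1, 0)) t := by
    rw [← hasDerivWithinAt_univ]
    have hmaps : Set.MapsTo (fun r : ℝ => (r, extChartAt I p p)) Set.univ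
        (Set.univ ×ˢ Set.range I) := fun r _ =>
      ⟨trivial, by rw [extChartAt_coe]; exact Set.mem_range_self _⟩
    exact h0.comp_hasDerivWithinAt t h4.hasDerivWithinAt hmaps
  have h6 := h5.clm_apply (hasDerivAt_const t ((0, v) : ℝ × E))
  rw [map_zero, add_zero] at h6
  simp only [η.chartCov_prod_self] at h6
  exact h6

/-- If the 1-form `η` on the cylinder `ℝ × S` has `dη(∂_t, v) = 0` for all `v` tangent to `S`, then
the difference of its restrictions to the slices `1` and `0` is exact. -/
theorem mem_exactForms_of_cylinder [IsManifold I ∞ S] {η : DForm (𝓘(ℝ, ℝ).prod I) (ℝ × S) 1}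
    (hη : ∀ z, η.SmoothAt z)
    (hcurl : ∀ t p v, curl (Set.range (𝓘(ℝ, ℝ).prod I)) (η.chartCov (t, p))
        (extChartAt (𝓘(ℝ, ℝ).prod I) (t, p) (t, p)) (1, 0) (0, v) = 0)
    {θ : DForm I S 1} (hθ : ∀ p, θ.SmoothAt p)
    (hηθ : ∀ x (v : E), θ x ![v] = η (1, x) ![(0, v)] - η (0, x) ![(0, v)]) :
    θ ∈ exactForms I S := by
  have hrange : Set.range (𝓘(ℝ, ℝ).prod I) = Set.univ ×ˢ Set.range I := by
    rw [ModelWithCorners.range_prod]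
    simp
  let g : S → ℝ := fun x => ∫ t in (0 : ℝ)..1, η (t, x) ![(1, 0)]
  have hg : ∀ p, HasMFDerivAt I 𝓘(ℝ, ℝ) g p
      ((η.chartCov (0, p) (1, extChartAt I p p) - η.chartCov (0, p) (0, extChartAt I p p)).comp
        (ContinuousLinearMap.inr ℝ ℝ E)) := by
    intro p
    have hp : extChartAt I p p ∈ Set.range I := by
      rw [extChartAt_coe]; exact Set.mem_range_self _
    refine hasMFDerivAt_of_comp_symm ?_
    have hpt : ∀ t : ℝ, extChartAt (𝓘(ℝ, ℝ).prod I) (t, p) (t, p) = (t, extChartAt I p p) := by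
      intro t
      rw [extChartAt_prod]
      rfl
    have h1 := hasFDerivWithinAt_integral I.convex_range I.uniqueDiffOn
      (c := η.chartCov (0, p)) hp
      (fun t => by
        have := (η.smoothAt_iff (t, p)).1 (hη (t, p))
        rw [hrange, hpt] at this
        exact this)
      (fun t v => by
        have := hcurl t p v
        rw [hrange, hpt] at this
        exact this)
    have h4 := η.eventually_chartCov_prod 0 p
    refine h1.congr_of_eventuallyEq (h4.mono fun z hz => ?_) ?_
    · exact intervalIntegral.integral_congr fun t _ => (hz t).symm
    · exact intervalIntegral.integral_congr fun t _ => (h4.self_of_nhdsWithin hp t).symm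
  have hd : ∀ p v, dAt I g p v = θ p ![v] := by
    intro p v
    refine (DFunLike.congr_fun (hg p).mfderiv v).trans ((hηθ p v).trans ?_).symm
    exact congrArg₂ (· - ·) (η.chartCov_prod_self 0 p 1 0 v).symm
      (η.chartCov_prod_self 0 p 0 0 v).symm
  refine ⟨g, contMDiff_of_smooth_dAt hθ (fun p => (hg p).mdifferentiableAt) hd, ?_⟩
  ext1 x
  exact DForm.ext_oneForm fun v => (hd x v).symm

end Cylinder

/-! ### Gauge paths as fields on the cylinder -/

section GaugePaths

variable {E H : Type*} [NormedAddCommGroup E] [NormedSpace ℝ E] [TopologicalSpace H]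
  {I : ModelWithCorners ℝ E H} {S : Type*} [TopologicalSpace S] [ChartedSpace H S]
  {n k : ℕ} {M : Type*} [TopologicalSpace M] [ChartedSpace (EuclideanSpace ℝ (Fin n)) M]
  {P : PoissonStructure n M} {L U : Set M} {Ω : DForm (𝓡 n) M 2} {C : Fin k → M → ℝ}
  {Ψ : ℝ → Fields I S n M} {ε : ∀ t x, TangentSpace (𝓡 n) ((Ψ t).X x) →L[ℝ] ℝ}

theorem PoissonStructure.dcomp_swap (P : PoissonStructure n M)
    (e : OpenPartialHomeomorph M (EuclideanSpace ℝ (Fin n))) (i j l : Fin n) (q : M) :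
    P.bivector.dcomp e i j l q = -P.bivector.dcomp e j i l q := by
  have h : P.bivector.comp e i j = -P.bivector.comp e j i :=
    funext fun y => P.bivector_swap _ _ _
  rw [CotBilin.dcomp, CotBilin.dcomp, h, fderiv_neg]
  rfl

/-- A point moves along its symplectic leaf under gauge transformations. -/
theorem IsGaugePath.joined (hg : IsGaugePath P Ψ ε) (s t : ℝ) (p : S) :
    P.Joined ((Ψ s).X p) ((Ψ t).X p) := by
  let ρ : ℝ → ℝ := fun r => s + r * (t - s)
  have hρ : ContDiff ℝ ∞ ρ := contDiff_const.add (contDiff_id.mul contDiff_const)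
  have hρp : ContMDiff 𝓘(ℝ, ℝ) (𝓘(ℝ, ℝ).prod I) ∞ fun r => (ρ r, p) :=
    hρ.contMDiff.prodMk contMDiff_const
  refine ⟨fun r => (Ψ (ρ r)).X p, fun r => -(t - s) • ε (ρ r) p, ⟨?_, ?_, ?_⟩, ?_, ?_⟩
  · exact hg.smooth_X.comp hρp
  · intro r e he hr i
    have h1 := (hg.smooth_param (ρ r) p e he hr i).comp r (hρp r)
    exact contDiffAt_const.mul h1.contDiffAt
  · intro r b
    have h1 : MDifferentiableAt 𝓘(ℝ, ℝ) (𝓡 n) (fun r => (Ψ r).X p) (ρ r) :=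
      ((hg.smooth_X.comp (contMDiff_id.prodMk contMDiff_const)) (ρ r)).mdifferentiableAt (by simp)
    have h2 : HasDerivAt ρ (t - s) r := by
      have := ((hasDerivAt_id r).mul_const (t - s)).const_add s
      rwa [one_mul] at this
    have h3 := h1.hasMFDerivAt.comp r h2.hasFDerivAt.hasMFDerivAt
    let T : ℝ →L[ℝ] EuclideanSpace ℝ (Fin n) :=
      mfderiv 𝓘(ℝ, ℝ) (𝓡 n) (fun r => (Ψ r).X p) (ρ r)
    let b' : EuclideanSpace ℝ (Fin n) →L[ℝ] ℝ := b
    have h4 : mfderiv 𝓘(ℝ, ℝ) (𝓡 n) (fun r => (Ψ (ρ r)).X p) r (1 : ℝ) =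
        T ((1 : ℝ) • (t - s)) := DFunLike.congr_fun h3.mfderiv (1 : ℝ)
    have h5 : b' (T ((1 : ℝ) • (t - s))) = (t - s) * b' (T 1) := by
      rw [one_smul, ← mul_one (t - s), ← smul_eq_mul, map_smul, map_smul, smul_eq_mul, smul_eq_mul,
        mul_one]
    have h6 : b' (T 1) = P.bivector _ (ε (ρ r) p) b := hg.flow_X (ρ r) p b
    refine (congrArg b' h4).trans (h5.trans ?_)
    rw [h6, P.bivector_swap, map_smul, smul_eq_mul]
    ring
  · simp [ρ]
  · simp [ρ]

theorem IsGaugePath.mem_leaf (hg : IsGaugePath P Ψ ε) (hL : P.IsSymplecticLeaf L) (s t : ℝ) (p : S)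
    (h : (Ψ s).X p ∈ L) : (Ψ t).X p ∈ L := by
  obtain ⟨q, rfl⟩ := hL
  exact Relation.EqvGen.trans _ _ _ h (Relation.EqvGen.rel _ _ (hg.joined s t p))

/-- A path of fields with parameters `ε`, combined into the field `ε dt + A_t` on the cylinder
`ℝ × S`. For a gauge path it satisfies the field equations on the cylinder. -/
def Fields.onCylinder (Ψ : ℝ → Fields I S n M)
    (ε : ∀ t x, TangentSpace (𝓡 n) ((Ψ t).X x) →L[ℝ] ℝ) : Fields (𝓘(ℝ, ℝ).prod I) (ℝ × S) n M where
  X z := (Ψ z.1).X z.2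
  A z :=
    let a : E →L[ℝ] EuclideanSpace ℝ (Fin n) →L[ℝ] ℝ := (Ψ z.1).A z.2
    let b : EuclideanSpace ℝ (Fin n) →L[ℝ] ℝ := ε z.1 z.2
    ((ContinuousLinearMap.fst ℝ ℝ E).smulRight b + a.comp (ContinuousLinearMap.snd ℝ ℝ E) :
      ℝ × E →L[ℝ] EuclideanSpace ℝ (Fin n) →L[ℝ] ℝ)

theorem Fields.onCylinder_A (t τ : ℝ) (x : S) (v : TangentSpace I x)
    (w : TangentSpace (𝓡 n) ((Ψ t).X x)) :
    (Fields.onCylinder Ψ ε).A (t, x) (τ, v) w = τ * ε t x w + (Ψ t).A x v w := rfl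

theorem Fields.onCylinder_comp (e : OpenPartialHomeomorph M (EuclideanSpace ℝ (Fin n)))
    (i : Fin n) (t τ : ℝ) (x : S) (v : TangentSpace I x) :
    (Fields.onCylinder Ψ ε).comp e i (t, x) ![(τ, v)] =
      τ * ε t x (coordVec e i ((Ψ t).X x)) + (Ψ t).comp e i x ![v] := rfl

theorem IsGaugePath.mfderiv_onCylinder (hg : IsGaugePath P Ψ ε) (t τ : ℝ) (x : S)
    (v : E) :
    mfderiv (𝓘(ℝ, ℝ).prod I) (𝓡 n) (Fields.onCylinder Ψ ε).X (t, x) (τ, v) =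
      mfderiv 𝓘(ℝ, ℝ) (𝓡 n) (fun s => (Ψ s).X x) t τ + mfderiv I (𝓡 n) (Ψ t).X x v :=
  mfderiv_prod_eq_add_apply (f := (Fields.onCylinder Ψ ε).X) (p := (t, x)) (v := ((τ, v) : ℝ × E))
    ((hg.smooth_X (t, x)).mdifferentiableAt (by simp))

theorem IsGaugePath.onCylinder_eq_X (hg : IsGaugePath P Ψ ε) (z : ℝ × S)
    (y : TangentSpace (𝓘(ℝ, ℝ).prod I) z)
    (b : TangentSpace (𝓡 n) ((Fields.onCylinder Ψ ε).X z) →L[ℝ] ℝ) :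
    b (mfderiv (𝓘(ℝ, ℝ).prod I) (𝓡 n) (Fields.onCylinder Ψ ε).X z y) +
      P.bivector ((Fields.onCylinder Ψ ε).X z) b ((Fields.onCylinder Ψ ε).A z y) = 0 := by
  obtain ⟨t, x⟩ := z
  obtain ⟨τ, v⟩ := y
  let b' : EuclideanSpace ℝ (Fin n) →L[ℝ] ℝ := b
  let T : ℝ →L[ℝ] EuclideanSpace ℝ (Fin n) := mfderiv 𝓘(ℝ, ℝ) (𝓡 n) (fun s => (Ψ s).X x) t
  have h1 : b' (mfderiv (𝓘(ℝ, ℝ).prod I) (𝓡 n) (Fields.onCylinder Ψ ε).X (t, x) (τ, v)) =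
      τ * b' (T 1) + b' (mfderiv I (𝓡 n) (Ψ t).X x v) := by
    refine (congrArg b' (hg.mfderiv_onCylinder t τ x v)).trans ((map_add b' _ _).trans ?_)
    congr 1
    have h2 : T τ = τ • T 1 := by rw [← map_smul, smul_eq_mul, mul_one]
    exact (congrArg b' h2).trans (map_smul b' τ (T 1))
  have h3 : P.bivector ((Ψ t).X x) b ((Fields.onCylinder Ψ ε).A (t, x) (τ, v)) =
      τ * P.bivector ((Ψ t).X x) b (ε t x) + P.bivector ((Ψ t).X x) b ((Ψ t).A x v) := by
    have h4 : (Fields.onCylinder Ψ ε).A (t, x) (τ, v) = τ • ε t x + (Ψ t).A x v := rfl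
    rw [h4]
    exact (map_add _ _ _).trans (congrArg (· + _) (map_smul _ τ (ε t x)))
  have h5 : b' (T 1) = P.bivector ((Ψ t).X x) (ε t x) b := hg.flow_X t x b
  have h6 := (hg.solution t).eq_X x v b
  refine (congrArg₂ (· + ·) h1 h3).trans ?_
  have h7 : P.bivector ((Ψ t).X x) b (ε t x) = -P.bivector ((Ψ t).X x) (ε t x) b :=
    P.bivector_swap _ _ _
  rw [h5, h7]
  have aux : ∀ c d d' : ℝ, d + d' = 0 → τ * c + d + (τ * -c + d') = 0 := fun c d d' h => by
    linear_combination h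
  exact aux _ _ _ h6

theorem IsGaugePath.onCylinder_smooth [IsManifold I ∞ S] (hg : IsGaugePath P Ψ ε)
    {e : OpenPartialHomeomorph M (EuclideanSpace ℝ (Fin n))}
    (he : e ∈ IsManifold.maximalAtlas (𝓡 n) ∞ M) (t : ℝ) (p : S) (hp : (Ψ t).X p ∈ e.source)
    (i : Fin n) : ((Fields.onCylinder Ψ ε).comp e i).SmoothAt (t, p) := by
  have hrange : Set.range (𝓘(ℝ, ℝ).prod I) = Set.univ ×ˢ Set.range I := by
    rw [ModelWithCorners.range_prod]
    simp
  have hpt : extChartAt (𝓘(ℝ, ℝ).prod I) (t, p) (t, p) = (t, extChartAt I p p) := by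
    rw [extChartAt_prod]
    rfl
  have hfun : ((extChartAt (𝓘(ℝ, ℝ).prod I) (t, p)).symm : ℝ × E → ℝ × S) =
      fun y => (y.1, (extChartAt I p).symm y.2) := by
    rw [extChartAt_prod]
    rfl
  have hε := (contMDiffAt_iff.1 (hg.smooth_param t p e he hp i)).2
  rw [hfun, hrange, hpt] at hε
  have hA := ((ContinuousAlternatingMap.ofSubsingletonLIE (𝕜 := ℝ) (E := E)
    (F := ℝ) (0 : Fin 1)).symm.toContinuousLinearEquiv.comp_contDiffWithinAt_iff).2
      (hg.smooth_A t p e he hp i)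
  rw [DForm.smoothAt_iff, hrange, hpt]
  have h1 := (hε.smul_const (ContinuousLinearMap.fst ℝ ℝ E)).add
    (hA.clm_comp (contDiffWithinAt_const (c := ContinuousLinearMap.snd ℝ ℝ E)))
  have hev : ∀ᶠ z : ℝ × E in 𝓝[Set.univ ×ˢ Set.range I] (t, extChartAt I p p),
      z.2 ∈ (extChartAt I p).target := by
    rw [nhdsWithin_prod_eq]
    exact (eventually_mem_target p).prod_inr _
  refine h1.congr_of_eventuallyEq_of_mem (hev.mono fun z hz => ?_) ⟨trivial, by
      rw [extChartAt_coe]; exact Set.mem_range_self _⟩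
  obtain ⟨s, z⟩ := z
  refine ContinuousLinearMap.ext fun ⟨τ, v⟩ => ?_
  refine (DForm.chartCov_prod _ t p s τ hz v).trans ((Fields.onCylinder_comp _ _ _ _ _ _).trans ?_)
  rw [← DForm.chartCov_apply, mul_comm τ]
  rfl

/-- The `dt ∧ v` components of the curvature of `ε dt + A_t` measure how far the velocity of `A_t`
is from the infinitesimal gauge transformation by `ε`. -/
theorem IsGaugePath.onCylinder_eq_A [IsManifold I ∞ S] (hg : IsGaugePath P Ψ ε)
    {e : OpenPartialHomeomorph M (EuclideanSpace ℝ (Fin n))}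
    (he : e ∈ IsManifold.maximalAtlas (𝓡 n) ∞ M) (t : ℝ) (p : S) (hp : (Ψ t).X p ∈ e.source)
    (i : Fin n) (v : E) :
    ((Fields.onCylinder Ψ ε).comp e i).d (t, p) ![((1, 0) : ℝ × E), (0, v)] +
      (1 / 2 : ℝ) * ∑ r, ∑ l, P.bivector.dcomp e r l i ((Fields.onCylinder Ψ ε).X (t, p)) *
        ((Fields.onCylinder Ψ ε).comp e r (t, p) ![((1, 0) : ℝ × E)] *
            (Fields.onCylinder Ψ ε).comp e l (t, p) ![((0, v) : ℝ × E)]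
          - (Fields.onCylinder Ψ ε).comp e r (t, p) ![((0, v) : ℝ × E)] *
            (Fields.onCylinder Ψ ε).comp e l (t, p) ![((1, 0) : ℝ × E)]) = 0 := by
  have hs := hg.onCylinder_smooth he t p hp i
  have hcomp0 : ∀ (s : ℝ) (x : S) r, (Fields.onCylinder Ψ ε).comp e r (s, x) ![((1, 0) : ℝ × E)] =
      ε s x (coordVec e r ((Ψ s).X x)) := fun s x r => by
    refine (Fields.onCylinder_comp e r s 1 x 0).trans ?_
    have h0 : (Ψ s).comp e r x ![0] = 0 := by
      refine ((Ψ s).comp_apply e r x ![0]).trans ?_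
      exact congrArg (fun a : EuclideanSpace ℝ (Fin n) →L[ℝ] ℝ => a (coordVec e r ((Ψ s).X x)))
        (map_zero ((Ψ s).A x))
    rw [h0, one_mul, add_zero]
  have hcomp1 : ∀ (s : ℝ) r, (Fields.onCylinder Ψ ε).comp e r (s, p) ![((0, v) : ℝ × E)] =
      (Ψ s).comp e r p ![v] := fun s r => by
    refine (Fields.onCylinder_comp e r s 0 p v).trans ?_
    rw [zero_mul, zero_add]
  have h1 := DForm.curl_mixed hs v
  have hd : ((Fields.onCylinder Ψ ε).comp e i).d (t, p) ![((1, 0) : ℝ × E), (0, v)] =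
      curl (Set.range (𝓘(ℝ, ℝ).prod I)) (((Fields.onCylinder Ψ ε).comp e i).chartCov (t, p))
        (extChartAt (𝓘(ℝ, ℝ).prod I) (t, p) (t, p)) (1, 0) (0, v) := DForm.d_apply hs _ _
  rw [← hd] at h1
  simp only [hcomp0, hcomp1] at h1 ⊢
  have h2 := h1.unique (hg.flow_A t p e he hp i v)
  rw [add_comm, add_left_cancel_iff] at h2
  rw [h2]
  change _ + (1 / 2 : ℝ) * ∑ r, ∑ l, P.bivector.dcomp e r l i ((Ψ t).X p) * _ = 0
  simp only [mul_sub, Finset.sum_sub_distrib]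
  have h3 : ∑ r, ∑ l, P.bivector.dcomp e r l i ((Ψ t).X p) *
      (ε t p (coordVec e r ((Ψ t).X p)) * (Ψ t).comp e l p ![v]) =
      -∑ r, ∑ l, P.bivector.dcomp e r l i ((Ψ t).X p) *
      ((Ψ t).comp e r p ![v] * ε t p (coordVec e l ((Ψ t).X p))) := by
    rw [Finset.sum_comm, ← Finset.sum_neg_distrib]
    refine Finset.sum_congr rfl fun r _ => ?_
    rw [← Finset.sum_neg_distrib]
    refine Finset.sum_congr rfl fun l _ => ?_
    rw [P.dcomp_swap e l r]
    ring
  rw [h3]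
  ring

/-- Gauge transformations along maps into the leaf preserve cohomology classes. The field
`ε dt + A_t` on the cylinder is of the stated form too, and its coefficient forms restrict to those
of `A_t` at time `t`. Since the mixed components of its curvature vanish, so do those of the
exterior derivatives of the coefficient forms. -/
theorem IsLeafModel.sub_mem_exactForms [IsManifold I ∞ S] [IsManifold (𝓡 n) ∞ M]
    (h : IsLeafModel P L U Ω C) (hg : IsGaugePath P Ψ ε) (hXL : ∀ t x, (Ψ t).X x ∈ L)
    {α α' : Fin k → DForm I S 1} (hα : HasSolutionForm (Ψ 0).X Ω C α (Ψ 0).A)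
    (hα' : HasSolutionForm (Ψ 1).X Ω C α' (Ψ 1).A) (K : Fin k) :
    α' K - α K ∈ exactForms I S := by
  have hXL' : ∀ z, (Fields.onCylinder Ψ ε).X z ∈ L := fun z => hXL z.1 z.2
  obtain ⟨η, hη⟩ := h.exists_coefficientForms hXL' hg.onCylinder_eq_X
  have he : ∀ q : M, chartAt (EuclideanSpace ℝ (Fin n)) q ∈ IsManifold.maximalAtlas (𝓡 n) ∞ M :=
    fun q => IsManifold.chart_mem_maximalAtlas q
  have hq : ∀ q : M, q ∈ (chartAt (EuclideanSpace ℝ (Fin n)) q).source :=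
    mem_chart_source (EuclideanSpace ℝ (Fin n))
  have hsm : ∀ K z, (η K).SmoothAt z := fun K z =>
    h.coefficient_smooth hg.smooth_X hXL' hη (he _) (hq _)
      (hg.onCylinder_smooth (he _) z.1 z.2 (hq _)) K
  have hcurl : ∀ t p (v : E), curl (Set.range (𝓘(ℝ, ℝ).prod I)) ((η K).chartCov (t, p))
      (extChartAt (𝓘(ℝ, ℝ).prod I) (t, p) (t, p)) (1, 0) (0, v) = 0 := fun t p v =>
    congrFun (h.coefficients_eq_zero (he _) (hXL t p) (hq _)
      (m := fun K => curl (Set.range (𝓘(ℝ, ℝ).prod I)) ((η K).chartCov (t, p))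
        (extChartAt (𝓘(ℝ, ℝ).prod I) (t, p) (t, p)) (1, 0) (0, v)) fun i =>
      (h.fieldStrength hg.smooth_X hXL' hη (fun K => hsm K (t, p))
        (hg.onCylinder_eq_X (t, p)) (he _) (hq _) i (1, 0) (0, v)).symm.trans
        (hg.onCylinder_eq_A (he _) t p (hq _) i v)) K
  have hslice : ∀ t {β : Fin k → DForm I S 1}, HasSolutionForm (Ψ t).X Ω C β (Ψ t).A →
      ∀ x (v : E), β K x ![v] = η K (t, x) ![(0, v)] := by
    intro t β hβ x v
    refine congrFun (h.coefficients_unique (hXL t x) (m := fun K => β K x ![v])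
      (m' := fun K => η K (t, x) ![((0, v) : ℝ × E)]) fun w => ?_) K
    have h1 := hη (t, x) ((0, v) : ℝ × E) w
    have h2 : (Fields.onCylinder Ψ ε).A (t, x) (0, v) w = (Ψ t).A x v w :=
      (Fields.onCylinder_A t 0 x v w).trans (by rw [zero_mul, zero_add])
    have h3 : mfderiv (𝓘(ℝ, ℝ).prod I) (𝓡 n) (Fields.onCylinder Ψ ε).X (t, x) (0, v) =
        mfderiv I (𝓡 n) (Ψ t).X x v := by
      refine (hg.mfderiv_onCylinder t 0 x v).trans ?_
      refine (congrArg (· + _) (map_zero _)).trans (zero_add _)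
    rw [h2, h3] at h1
    exact add_left_cancel ((hβ x v w).symm.trans h1)
  have hsol : ∀ t {β : Fin k → DForm I S 1}, HasSolutionForm (Ψ t).X Ω C β (Ψ t).A →
      β K ∈ closedForms I S := fun t β hβ =>
    h.coefficientForms_closed (hXL t) (hg.solution t) hβ K
  refine mem_exactForms_of_cylinder (hsm K) hcurl
    (fun p => ((closedForms I S).sub_mem (hsol 1 hα') (hsol 0 hα) p).1) fun x v => ?_
  rw [← hslice 1 hα' x v, ← hslice 0 hα x v]
  rfl

end GaugePaths

/-! ### Gauge classes -/

section Classification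

variable {E H : Type*} [NormedAddCommGroup E] [NormedSpace ℝ E] [TopologicalSpace H]
  {I : ModelWithCorners ℝ E H} {S : Type*} [TopologicalSpace S] [ChartedSpace H S]
  {n k : ℕ} {M : Type*} [TopologicalSpace M] [ChartedSpace (EuclideanSpace ℝ (Fin n)) M]
  {P : PoissonStructure n M} {L U : Set M} {Ω : DForm (𝓡 n) M 2} {C : Fin k → M → ℝ} {X : S → M}

theorem cohomClass_eq_iff {α α' : closedForms I S} :
    cohomClass α = cohomClass α' ↔ α'.1 - α.1 ∈ exactForms I S := by
  rw [eq_comm, Subtype.ext_iff]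
  exact Submodule.Quotient.eq _

theorem cohomClass_surjective : Function.Surjective (cohomClass : closedForms I S → H1 I S) := by
  rintro ⟨_, α, hα, rfl⟩
  exact ⟨⟨α, hα⟩, rfl⟩

namespace IsLeafModel

theorem existsUnique_closedForms [IsManifold I ∞ S] [IsManifold (𝓡 n) ∞ M]
    (h : IsLeafModel P L U Ω C) (hXL : ∀ x, X x ∈ L) {A : OneFormAlong I n X}
    (hsol : IsSolution P (⟨X, A⟩ : Fields I S n M)) :
    ∃! α : Fin k → closedForms I S, HasSolutionForm X Ω C (fun K => (α K).1) A := by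
  obtain ⟨α, hα⟩ := h.exists_coefficientForms hXL hsol.eq_X
  refine ⟨fun K => ⟨α K, h.coefficientForms_closed hXL hsol hα K⟩, hα, fun α' hα' => ?_⟩
  ext1 K
  exact Subtype.ext (congrFun (h.coefficientForms_unique hXL hα' hα) K)

/-- A gauge transformation that starts or ends at a map into the leaf stays in the leaf, and it
preserves the cohomology classes of the closed forms in the solution. -/
theorem cohomClass_iff_of_gaugeTransform [IsManifold I ∞ S] [IsManifold (𝓡 n) ∞ M]
    (h : IsLeafModel P L U Ω C) (hL : P.IsSymplecticLeaf L) (c : Fin k → H1 I S)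
    {Φ Φ' : Fields I S n M} (hΦ : GaugeTransform P Φ Φ') :
    ((∀ x, Φ.X x ∈ L) ∧ ∃ α : Fin k → closedForms I S,
        HasSolutionForm Φ.X Ω C (fun K => (α K).1) Φ.A ∧ (fun K => cohomClass (α K)) = c) ↔
      ((∀ x, Φ'.X x ∈ L) ∧ ∃ α : Fin k → closedForms I S,
        HasSolutionForm Φ'.X Ω C (fun K => (α K).1) Φ'.A ∧ (fun K => cohomClass (α K)) = c) := by
  obtain ⟨Ψ, ε, hg, rfl, rfl⟩ := hΦ
  have hclass : ∀ s, (∀ x, (Ψ s).X x ∈ L) → ∀ {α α' : Fin k → closedForms I S},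
      HasSolutionForm (Ψ 0).X Ω C (fun K => (α K).1) (Ψ 0).A →
      HasSolutionForm (Ψ 1).X Ω C (fun K => (α' K).1) (Ψ 1).A →
      (fun K => cohomClass (α K)) = fun K => cohomClass (α' K) := fun s hs α α' hα hα' =>
    funext fun K => cohomClass_eq_iff.2
      (h.sub_mem_exactForms hg (fun t x => hg.mem_leaf hL s t x (hs x)) hα hα' K)
  constructor
  · rintro ⟨h0, α, hα, rfl⟩
    have h1 : ∀ x, (Ψ 1).X x ∈ L := fun x => hg.mem_leaf hL 0 1 x (h0 x)
    obtain ⟨α', hα', -⟩ := h.existsUnique_closedForms h1 (hg.solution 1)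
    exact ⟨h1, α', hα', (hclass 0 h0 hα hα').symm⟩
  · rintro ⟨h1, α', hα', rfl⟩
    have h0 : ∀ x, (Ψ 0).X x ∈ L := fun x => hg.mem_leaf hL 1 0 x (h1 x)
    obtain ⟨α, hα, -⟩ := h.existsUnique_closedForms h0 (hg.solution 0)
    exact ⟨h0, α, hα, hclass 1 h1 hα hα'⟩

theorem cohomClass_eq_of_gaugeEquiv [IsManifold I ∞ S] [IsManifold (𝓡 n) ∞ M]
    (h : IsLeafModel P L U Ω C) (hL : P.IsSymplecticLeaf L) (hXL : ∀ x, X x ∈ L)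
    {A A' : OneFormAlong I n X} {α α' : Fin k → closedForms I S}
    (hA : HasSolutionForm X Ω C (fun K => (α K).1) A)
    (hA' : HasSolutionForm X Ω C (fun K => (α' K).1) A')
    (hequiv : GaugeEquiv P (⟨X, A⟩ : Fields I S n M) ⟨X, A'⟩) :
    (fun K => cohomClass (α K)) = fun K => cohomClass (α' K) := by
  have key : ∀ {Φ Φ' : Fields I S n M} (c : Fin k → H1 I S), GaugeEquiv P Φ Φ' →
      (((∀ x, Φ.X x ∈ L) ∧ ∃ α : Fin k → closedForms I S,
        HasSolutionForm Φ.X Ω C (fun K => (α K).1) Φ.A ∧ (fun K => cohomClass (α K)) = c) ↔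
      ((∀ x, Φ'.X x ∈ L) ∧ ∃ α : Fin k → closedForms I S,
        HasSolutionForm Φ'.X Ω C (fun K => (α K).1) Φ'.A ∧ (fun K => cohomClass (α K)) = c)) := by
    intro Φ Φ' c hΦ
    induction hΦ with
    | rel _ _ hr => exact h.cohomClass_iff_of_gaugeTransform hL c hr
    | refl _ => exact Iff.rfl
    | symm _ _ _ ih => exact ih.symm
    | trans _ _ _ _ _ ih ih' => exact ih.trans ih'
  obtain ⟨-, β, hβ, hc⟩ := (key _ hequiv).1 ⟨hXL, α, hA, rfl⟩
  rw [← hc]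
  have h1 := h.coefficientForms_unique hXL hβ hA'
  exact funext fun K => congrArg cohomClass (Subtype.ext (congrFun h1 K))

end IsLeafModel

end Classification

end

end PSM

open PSM in
theorem proposition2
    {H : Type*} [TopologicalSpace H] (I : ModelWithCorners ℝ (EuclideanSpace ℝ (Fin 2)) H)
    {S : Type*} [TopologicalSpace S] [T2Space S] [SecondCountableTopology S]
    [ChartedSpace H S] [IsManifold I ∞ S]
    {n : ℕ} {M : Type*} [TopologicalSpace M] [T2Space M] [SecondCountableTopology M]
    [ChartedSpace (EuclideanSpace ℝ (Fin n)) M] [IsManifold (𝓡 n) ∞ M]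
    (P : PoissonStructure n M)
    (L : Set M) (hL : P.IsSymplecticLeaf L)
    (U : Set M) (hU : IsOpen U)
    (Ω : DForm (𝓡 n) M 2) (hΩ : P.IsCompatiblePresymplectic U Ω)
    {k : ℕ} (C : Fin k → M → ℝ) (hC : ∀ K, P.IsCasimirOn U (C K))
    (hLC : L = {q | q ∈ U ∧ ∀ K, C K q = 0})
    (hind : ∀ q ∈ L, LinearIndependent ℝ fun K => dAt (𝓡 n) (C K) q)
    (hk : ∀ q ∈ L, Module.finrank ℝ (P.bivector q).ker = k)
    (X : S → M) (hX : ContMDiff I (𝓡 n) ∞ X) (hXL : Set.range X ⊆ L) :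
    -- every solution is of the stated form, with unique closed 1-forms
    (∀ A : OneFormAlong I n X, IsSolution P ⟨X, A⟩ →
      ∃! α : Fin k → closedForms I S, HasSolutionForm X Ω C (fun K => (α K).1) A) ∧
    -- all closed 1-forms occur
    (∀ α : Fin k → closedForms I S,
      ∃ A : OneFormAlong I n X,
        HasSolutionForm X Ω C (fun K => (α K).1) A ∧ IsSolution P ⟨X, A⟩) ∧
    -- adding exact 1-forms is a gauge transformation
    (∀ (α α' : Fin k → closedForms I S) (A A' : OneFormAlong I n X),
      HasSolutionForm X Ω C (fun K => (α K).1) A →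
      HasSolutionForm X Ω C (fun K => (α' K).1) A' →
      (∀ K, (α' K).1 - (α K).1 ∈ exactForms I S) →
      GaugeTransform P ⟨X, A⟩ ⟨X, A'⟩) ∧
    -- gauge classes correspond to `k` elements of the first cohomology
    (∃ e : GaugeClasses I P X ≃ (Fin k → H1 I S),
      ∀ (A : SolutionsOver I P X) (α : Fin k → closedForms I S),
        HasSolutionForm X Ω C (fun K => (α K).1) A.1 →
        e (Quot.mk _ A) = fun K => cohomClass (α K)) := by
  have h : IsLeafModel P L U Ω C := ⟨hU, hΩ, hC, hLC, hind, hk⟩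
  have hXL' : ∀ x, X x ∈ L := fun x => hXL ⟨x, rfl⟩
  have hall : ∀ α : Fin k → closedForms I S, ∃ A : OneFormAlong I n X,
      HasSolutionForm X Ω C (fun K => (α K).1) A ∧ IsSolution P ⟨X, A⟩ := fun α => by
    obtain ⟨A, hA⟩ := exists_hasSolutionForm (I := I) X Ω C fun K => (α K).1
    exact ⟨A, hA, h.isSolution hX hXL' hA fun K => (α K).2⟩
  refine ⟨fun A hA => h.existsUnique_closedForms hXL' hA, hall,
    fun α α' A A' hA hA' => h.gaugeTransform_of_exact hX hXL' hA hA', ?_⟩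
  choose α hα _ using fun A : SolutionsOver I P X => h.existsUnique_closedForms hXL' A.2
  let f : GaugeClasses I P X → Fin k → H1 I S := Quot.lift (fun A K => cohomClass (α A K))
    fun A A' hA => h.cohomClass_eq_of_gaugeEquiv hL hXL' (hα A) (hα A') hA
  have hf : ∀ (A : SolutionsOver I P X) (β : Fin k → closedForms I S),
      HasSolutionForm X Ω C (fun K => (β K).1) A.1 →
      f (Quot.mk _ A) = fun K => cohomClass (β K) := fun A β hβ =>
    funext fun K => congrArg cohomClass
      (Subtype.ext (congrFun (h.coefficientForms_unique hXL' (hα A) hβ) K))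
  have hbij : Function.Bijective f := by
    constructor
    · rintro ⟨A⟩ ⟨A'⟩ hAA'
      refine Quot.sound (Relation.EqvGen.rel _ _ ?_)
      exact h.gaugeTransform_of_exact hX hXL' (hα A) (hα A') fun K =>
        cohomClass_eq_iff.1 (congrFun hAA' K)
    · intro c
      choose β hβ using fun K => cohomClass_surjective (c K)
      obtain ⟨A, hA, hsol⟩ := hall β
      exact ⟨Quot.mk _ ⟨A, hsol⟩, (hf ⟨A, hsol⟩ β hA).trans (funext hβ)⟩
  exact ⟨Equiv.ofBijective f hbij, hf⟩
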